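/- **Setting.** Let $L\ge 4$ be even, $\Gamma=\Gamma_L=(\mathbb Z/L\mathbb Z)^2$ with nearest-neighbour relation $\sim$, and let $\Gamma^*=\Gamma+(\tfrac12,\tfrac12)$ be the dual lattice. Both are embedded in the continuous torus $(\mathbb R/L\mathbb Z)^2$; distances, diameters and balls refer to its Euclidean distance. On the fermionic Fock space over $\ell^2(\Gamma,\mathbb C^n)$, with annihilation and creation operators $c_{x,\sigma},c^*_{x,\sigma}$ and $n_x=\sum_\sigma c^*_{x,\sigma}c_{x,\sigma}$, let $$H=\sum_{x\sim y}\sum_{\sigma,\tau}\alpha(x,\sigma,y,\tau)\,c^*_{x,\sigma}c_{y,\tau}+\sum_{X\subset\Gamma}B_X ,$$ (sum over ordered pairs of neighbours), where $\alpha(x,\sigma,y,\tau)=\overline{\alpha(y,\tau,x,\sigma)}$, $|\alpha|\le m$, and each $B_X$ is Hermitian, supported in $X$ (i.e. in the algebra generated by the $c_{x,\sigma},c_{x,\sigma}^*$ with $x\in X$), commutes with every $n_x$, satisfies $\|B_X\|\le m$, and vanishes unless $\mathrm{diam}(X)\le R$. Assume that $H$ has a non-degenerate ground state, with projection $P$ and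 expectation $\omega(O)=\mathrm{Tr}(PO)$, separated from the rest of the spectrum by at least $g>0$. **Adiabatic curvature.** For $j=1,2$ let $\xi_j(x,y)=\pm 1/L$ if $y=x\pm e_j$ and $\xi_j(x,y)=0$ for the other edges. Let $H(\phi_1,\phi_2)$ be obtained from $H$ by replacing $\alpha(x,\sigma,y,\tau)$ by $\alpha(x,\sigma,y,\tau)\,e^{i(\phi_1\xi_1+\phi_2\xi_2)(x,y)}$, let $P(\phi)$ be its ground state projection, and $$\kappa=i\,\omega\big([\partial_{\phi_1}P,\partial_{\phi_2}P]\big)\big|_{\phi=0}.$$ **Current and response.** Let $\gamma$ be a path in $\Gamma^*$ from $y_{\rm b}$ to $y_{\rm e}$ that is part of the oriented boundary of some set $X\subset\Gamma$: $\gamma$ is a sequence of consecutive, pairwise distinct oriented dual edges $e$, such that the site $e_R$ just to the right of $e$ is in $X$ and the site $e_L$ just to the left of $e$ is not. Put $$J_\gamma=-i\sum_{e\in\gamma}\sum_{\sigma,\tau}\Big(\alpha(e_R,\sigma,e_L,\tau)\,c^*_{e_R,\sigma}c_{e_L,\tau}-\alpha(e_L,\sigma,e_R,\tau)\,c^*_{e_L,\sigma}c_{e_R,\tau}\Big).$$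 For $v:\Gamma\to\mathbb R$ let $V=\sum_x v(x)n_x$, $\|{\rm d}v\|=\max_{x\sim y}|v(y)-v(x)|$ and, with $V(t)=e^{itH}Ve^{-itH}$, $$\chi_{J_\gamma,V}=i\lim_{\epsilon\to0^+}\int_0^\infty \omega\big([V(-t),J_\gamma]\big)\,e^{-\epsilon t}\,dt .$$ **Lemma 4.4.** For all $n,R,m$, all $g>0$ and every $k\in\mathbb N$ there is a constant $K$, depending only on $n,R,m,g,k$ (in particular not on $L$, $\gamma$, $v$, $r$ or the choice of $H$ with these parameters), such that for all $L$ and $H$ as above the curvature $\kappa$ exists (the partial derivatives of $P(\phi)$ at $0$ exist) and is real, and the following holds for every $\gamma$ as above. Let $r\ge1$ and let $v$ be constant on $\{x\in\Gamma:\mathrm{dist}(x,y_{\rm b})\le r\}$ with value $v(y_{\rm b})$, and constant on $\{x\in\Gamma:\mathrm{dist}(x,y_{\rm e})\le r\}$ with value $v(y_{\rm e})$, where $\Delta v=v(y_{\rm e})-v(y_{\rm b})\neq0$. Then $\chi_{J_\gamma,V}$ exists (the integrals and the limit converge), is real, and $$\Big|\kappa-\frac{\chi_{J_\gamma,V}}{\Delta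 v}\Big|\le K\,\frac{\|{\rm d}v\|}{|\Delta v|}\,r^{-k}.$$ In particular, the left-hand side is $O(r^{-\infty})$, uniformly in $L$, as long as $\|{\rm d}v\|$ is bounded and $|\Delta v|$ is bounded away from $0$. -/

import Mathlib

open scoped BigOperators

noncomputable section

namespace HallTorus

/-! ### The discrete torus, its dual lattice and distances -/

/-- The sites of the discrete torus `ℤ_L × ℤ_L`. The same type also labels the sites of the dual
lattice: the label `(a, b)` stands for the dual site `(a + 1/2, b + 1/2)`. -/
abbrev Site (L : ℕ) : Type := ZMod L × ZMod L

/-- The four lattice directions. -/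
inductive Dir : Type
  | east | north | west | south

/-- The unit lattice vector of a direction. -/
def Dir.vec (L : ℕ) : Dir → Site L
  | .east => (1, 0)
  | .north => (0, 1)
  | .west => (-1, 0)
  | .south => (0, -1)

/-- Nearest neighbours on the discrete torus. -/
def Adj {L : ℕ} (x y : Site L) : Prop := ∃ d : Dir, y = x + d.vec L

/-- The continuous torus `(ℝ / Lℤ)²`. -/
abbrev Torus (L : ℕ) : Type := AddCircle (L : ℝ) × AddCircle (L : ℝ)

/-- Euclidean distance on the continuous torus (the norm of `AddCircle` is the distance to `0`
along the circle). -/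
def torusDist {L : ℕ} (p q : Torus L) : ℝ :=
  Real.sqrt (‖p.1 - q.1‖ ^ 2 + ‖p.2 - q.2‖ ^ 2)

/-- The position of a lattice site in the continuous torus. -/
def sitePos {L : ℕ} (x : Site L) : Torus L :=
  (((x.1.val : ℝ) : AddCircle (L : ℝ)), ((x.2.val : ℝ) : AddCircle (L : ℝ)))

/-- The position of a dual lattice site in the continuous torus. -/
def dualPos {L : ℕ} (y : Site L) : Torus L :=
  (((y.1.val + 1 / 2 : ℝ) : AddCircle (L : ℝ)), ((y.2.val + 1 / 2 : ℝ) : AddCircle (L : ℝ)))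

/-- An oriented edge of the dual lattice: its initial dual site and its direction. -/
structure DualEdge (L : ℕ) : Type where
  src : Site L
  dir : Dir

/-- The final dual site of an oriented dual edge. -/
def DualEdge.tgt {L : ℕ} (e : DualEdge L) : Site L := e.src + e.dir.vec L

/-- The lattice site just to the left of an oriented dual edge. -/
def DualEdge.left {L : ℕ} (e : DualEdge L) : Site L :=
  match e.dir with
  | .east => (e.src.1 + 1, e.src.2 + 1)
  | .north => (e.src.1, e.src.2 + 1)
  | .west => (e.src.1, e.src.2)
  | .south => (e.src.1 + 1, e.src.2)

/-- The lattice site just to the right of an oriented dual edge. -/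
def DualEdge.right {L : ℕ} (e : DualEdge L) : Site L :=
  match e.dir with
  | .east => (e.src.1 + 1, e.src.2)
  | .north => (e.src.1 + 1, e.src.2 + 1)
  | .west => (e.src.1, e.src.2 + 1)
  | .south => (e.src.1, e.src.2)

/-- The list of oriented dual edges `γ` is a path in the dual lattice from `yb` to `ye`. -/
def IsDualPath {L : ℕ} : Site L → List (DualEdge L) → Site L → Prop
  | yb, [], ye => yb = ye
  | yb, e :: γ, ye => e.src = yb ∧ IsDualPath e.tgt γ ye

/-- `γ` is part of the oriented boundary of some set `X` of sites: it runs at most once through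
each oriented edge, and only through edges that have `X` on their right and the complement of `X`
on their left. -/
def IsPartOfBoundary {L : ℕ} (γ : List (DualEdge L)) : Prop :=
  γ.Nodup ∧ ∃ X : Set (Site L), ∀ e ∈ γ, e.right ∈ X ∧ e.left ∉ X

/-- The potential `v` is flat, with value `c`, on the ball of radius `r` around the dual site `y`. -/
def IsFlatNear {L : ℕ} (v : Site L → ℝ) (y : Site L) (r c : ℝ) : Prop :=
  ∀ x : Site L, torusDist (sitePos x) (dualPos y) ≤ r → v x = c

/-! ### Fermions on the torus -/

/-- One-particle modes: a site and an internal label. -/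
abbrev Mode (L n : ℕ) : Type := Site L × Fin n

/-- An injective numbering of the modes, used for the fermionic signs. -/
def modeIndex {L n : ℕ} (a : Mode L n) : ℕ := (a.1.1.val * L + a.1.2.val) * n + a.2.val

/-- The fermionic Fock space over `ℓ²(Γ, ℂⁿ)` in the occupation number representation: the
orthonormal basis is indexed by the finite sets of occupied modes. -/
abbrev Fock (L n : ℕ) [NeZero L] : Type := EuclideanSpace ℂ (Finset (Mode L n))

/-- Operators on Fock space, with the operator norm. -/
abbrev Op (L n : ℕ) [NeZero L] : Type := Fock L n →L[ℂ] Fock L n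

section Fermions

variable {L n : ℕ} [NeZero L]

/-- The annihilation operator `c_a`: it maps the basis vector of an occupied set `T ∋ a` to
`(-1) ^ #{b ∈ T | b before a}` times the basis vector of `T \ {a}`, and all others to `0`. -/
def annihilate (a : Mode L n) : Op L n :=
  Matrix.toEuclideanCLM (𝕜 := ℂ) (n := Finset (Mode L n))
    (Matrix.of fun S T : Finset (Mode L n) =>
      if a ∈ T ∧ S = T.erase a then
        (-1 : ℂ) ^ (T.filter fun b => modeIndex b < modeIndex a).card else 0)

/-- The creation operator `c_a^*`. -/
def create (a : Mode L n) : Op L n := star (annihilate a)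

/-- The particle number operator at the site `x`. -/
def number (x : Site L) : Op L n := ∑ σ : Fin n, create (x, σ) * annihilate (x, σ)

/-- The algebra of operators with spatial support in `X`. -/
def localAlgebra (n : ℕ) (X : Finset (Site L)) : Subalgebra ℂ (Op L n) :=
  Algebra.adjoin ℂ {O | ∃ a : Mode L n, a.1 ∈ X ∧ (O = annihilate a ∨ O = create a)}

/-- The operator `⟨v, n⟩ = ∑ₓ v(x) nₓ` of an electrostatic potential `v`. -/
def potentialOp (n : ℕ) (v : Site L → ℝ) : Op L n := ∑ x : Site L, (v x : ℂ) • number x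

end Fermions

/-! ### Hamiltonians -/

/-- The data of a Hamiltonian
`∑_{x ∼ y} ∑_{σ, τ} α(x, σ, y, τ) c_{x,σ}^* c_{y,τ} + ∑_X B_X`
with nearest neighbour hopping amplitudes `α = hop` (only their values at pairs of neighbours
matter) and interaction terms `B = int` that commute with all the local particle numbers. -/
structure LatticeHamiltonian (L n : ℕ) [NeZero L] where
  hop : Site L → Fin n → Site L → Fin n → ℂ
  hop_symm : ∀ x y, Adj x y → ∀ σ τ, hop x σ y τ = (starRingEnd ℂ) (hop y τ x σ)
  int : Finset (Site L) → Op L n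
  int_mem : ∀ X, int X ∈ localAlgebra n X
  int_selfAdjoint : ∀ X, IsSelfAdjoint (int X)
  int_comm : ∀ X x, Commute (int X) (number x)

namespace LatticeHamiltonian

variable {L n : ℕ} [NeZero L]

/-- The Hamiltonian is local with range `R` and strength `m`: the local terms `B_X` have norm at
most `m` and vanish unless `diam X ≤ R`, and the hopping amplitudes are bounded by `m`. -/
def IsLocal (Φ : LatticeHamiltonian L n) (R m : ℝ) : Prop :=
  (∀ x y, Adj x y → ∀ σ τ, ‖Φ.hop x σ y τ‖ ≤ m) ∧
  (∀ X, ‖Φ.int X‖ ≤ m) ∧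
  (∀ X, Φ.int X ≠ 0 → ∀ x ∈ X, ∀ y ∈ X, torusDist (sitePos x) (sitePos y) ≤ R)

open Classical in
/-- The Hamiltonian `H_A` in the background of a vector potential `A`: the hopping amplitude
`α(x, σ, y, τ)` is multiplied by `exp (i A(x, y))`. -/
def hamWith (Φ : LatticeHamiltonian L n) (A : Site L → Site L → ℝ) : Op L n :=
  (∑ x : Site L, ∑ y : Site L, if Adj x y then
    ∑ σ : Fin n, ∑ τ : Fin n, (Φ.hop x σ y τ * Complex.exp (Complex.I * (A x y : ℂ))) •
      (create (x, σ) * annihilate (y, τ)) else 0) +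
  ∑ X : Finset (Site L), Φ.int X

/-- The Hamiltonian `H` itself. -/
def ham (Φ : LatticeHamiltonian L n) : Op L n := Φ.hamWith fun _ _ => 0

/-- The current operator of an oriented path in the dual lattice: it measures the flow of charge
from the left to the right of the path. If `γ` is the whole boundary of `X`, with `X` on the right,
then this is `i [H, n_X]`. -/
def current (Φ : LatticeHamiltonian L n) (γ : List (DualEdge L)) : Op L n :=
  (-Complex.I) • (γ.map fun e => ∑ σ : Fin n, ∑ τ : Fin n,
    (Φ.hop e.right σ e.left τ • (create (e.right, σ) * annihilate (e.left, τ)) -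
      Φ.hop e.left σ e.right τ • (create (e.left, σ) * annihilate (e.right, τ)))).sum

end LatticeHamiltonian

/-! ### Ground states, adiabatic curvature and the Kubo coefficient -/

section Response

variable {L n : ℕ} [NeZero L]

/-- The set of real eigenvalues of an operator. -/
def energies (H : Op L n) : Set ℝ :=
  {E | Module.End.HasEigenvalue (H : Fock L n →ₗ[ℂ] Fock L n) (E : ℂ)}

/-- The ground state energy of a self-adjoint operator. -/
def groundEnergy (H : Op L n) : ℝ := sInf (energies H)

/-- The eigenspace of the ground state energy. -/
def groundSpace (H : Op L n) : Submodule ℂ (Fock L n) :=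
  Module.End.eigenspace (H : Fock L n →ₗ[ℂ] Fock L n) (groundEnergy H : ℂ)

/-- The orthogonal projection `P` onto the ground state space. -/
def groundProj (H : Op L n) : Op L n := (groundSpace H).starProjection

/-- The ground state is non-degenerate and separated from the rest of the spectrum by at
least `g`. -/
def HasGap (H : Op L n) (g : ℝ) : Prop :=
  Module.finrank ℂ (groundSpace H) = 1 ∧
    ∀ E ∈ energies H, E ≠ groundEnergy H → groundEnergy H + g ≤ E

/-- The expectation `Tr (P O)` in the non-degenerate ground state of `H`. -/
def expect (H O : Op L n) : ℂ :=
  LinearMap.trace ℂ (Fock L n) ((groundProj H * O : Op L n) : Fock L n →ₗ[ℂ] Fock L n)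

/-- The vector potential `ξ₁`: the value `1 / L` on edges in the positive `1`-direction. -/
def xi₁ (x y : Site L) : ℝ :=
  if y = x + Dir.east.vec L then 1 / L else if y = x + Dir.west.vec L then -(1 / L) else 0

/-- The vector potential `ξ₂`: the value `1 / L` on edges in the positive `2`-direction. -/
def xi₂ (x y : Site L) : ℝ :=
  if y = x + Dir.north.vec L then 1 / L else if y = x + Dir.south.vec L then -(1 / L) else 0

/-- The twist Hamiltonian `H(φ₁, φ₂)` with fluxes `φ₁, φ₂` threaded through the torus. -/
def twistHam (Φ : LatticeHamiltonian L n) (φ₁ φ₂ : ℝ) : Op L n :=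
  Φ.hamWith fun x y => φ₁ * xi₁ x y + φ₂ * xi₂ x y

/-- `κ` is the adiabatic curvature at zero flux: the ground state projections `P(φ)` of the twist
Hamiltonians have partial derivatives `∂₁P`, `∂₂P` at `φ = 0`, and `κ = i ω([∂₁P, ∂₂P])`. -/
def IsAdiabaticCurvature (Φ : LatticeHamiltonian L n) (κ : ℂ) : Prop :=
  ∃ P₁ P₂ : Op L n,
    HasDerivAt (fun φ : ℝ => groundProj (twistHam Φ φ 0)) P₁ 0 ∧
    HasDerivAt (fun φ : ℝ => groundProj (twistHam Φ 0 φ)) P₂ 0 ∧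
    κ = Complex.I * expect Φ.ham (P₁ * P₂ - P₂ * P₁)

/-- Heisenberg evolution `O(t) = exp (i t H) O exp (-i t H)`. -/
def evolve (H O : Op L n) (t : ℝ) : Op L n :=
  NormedSpace.exp ((Complex.I * (t : ℂ)) • H) * O * NormedSpace.exp ((-(Complex.I * (t : ℂ))) • H)

/-- The integrand `ω([V(-t), J]) exp (-ε t)` of the zero-frequency Kubo coefficient. -/
def kuboIntegrand (H J V : Op L n) (ε t : ℝ) : ℂ :=
  expect H (evolve H V (-t) * J - J * evolve H V (-t)) * (Real.exp (-(ε * t)) : ℂ)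

/-- `χ` is the linear response coefficient `χ_{J,V}` at zero frequency,
`χ = i lim_{ε → 0⁺} ∫₀^∞ ω([V(-t), J]) exp (-ε t) dt`, where the integrals converge and the limit
exists. -/
def IsKuboCoefficient (H J V : Op L n) (χ : ℂ) : Prop :=
  (∀ ε : ℝ, 0 < ε →
    MeasureTheory.IntegrableOn (kuboIntegrand H J V ε) (Set.Ioi 0) MeasureTheory.volume) ∧
  Filter.Tendsto (fun ε : ℝ => Complex.I * ∫ t in Set.Ioi (0 : ℝ), kuboIntegrand H J V ε t)
    (nhdsWithin 0 (Set.Ioi 0)) (nhds χ)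

end Response

end HallTorus

end

/-!
The gap turns both sides of the inequality into values of one bilinear form. Let `ψ` be the ground
state vector with energy `E`, let `S = (H - E)⁻¹ (1 - P)` be the reduced resolvent, and put
`⟨A, B⟩ = -2 Im ⟨S A ψ, S B ψ⟩` (`SpectralGap.curvForm`). First order perturbation theory
(`SpectralGap.hasDerivAt_proj`) shows `κ = ⟨J(ξ₁), J(ξ₂)⟩`, where `J(A) = ∑ₑ A(e) jₑ` is the total
current that belongs to a vector potential `A`. Since `i [H, V] = J(dv)`, evaluating the Kubo
integral in an eigenbasis (`SpectralGap.kubo_limit`) shows `χ = ⟨J(A_γ), J(dv)⟩`, where `A_γ` is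
the vector potential of a unit flux tube that is moved along `γ`. In particular `κ` and `χ` are real.

The kernel `Ω(e, e') = ⟨jₑ, jₑ'⟩` decays faster than any power of the distance, uniformly in `L`
(`exists_isQuasiLocal_curvKernel`): by the gap, `Ω(e, e')` is the integral over time of
the twice integrated ground state expectation of the commutator `[jₑ(t), jₑ']` against a function of
rapid decay (`exists_norm_sum_div_sq_le`), and the Lieb-Robinson bound (`lieb_robinson_pow`) controls
the commutator. Moreover the form vanishes on pairs of gradients, because electrostatic potentials
commute with each other (`SpectralGap.curvForm_commutator_commutator`).

The rest is lattice geometry for such a form (`exists_abs_form_grad_pathForm_add_le`). The pairing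
of `dv` with `A` is `∑ₓ v(x) ρ(x)`, where the charge `ρ(x)` is the pairing of the gradient of the
indicator of `x` with `A`. By the discrete Poincaré lemma `exists_grad_eq` and the vanishing on
gradients, `ρ(x)` is small wherever the curl of `A` vanishes in a large neighbourhood of `x`. The
curl of `A_γ` vanishes away from the end points of `γ`, so its charge sits near the end points,
where `v` is constant, and a telescoping sum over `γ` shows that the charge at an end point is
the charge of a straight flux tube there, whatever the path is. The total charge of such a tube is
the current through a slice of the torus in response to the tube. Closing the tube around the torus
far away from the slice makes it a constant vector potential up to a gradient, and so the total
charge is `-⟨J(ξ₁), J(ξ₂)⟩ = -κ`. The approximations are good up to errors that decay faster than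
any power of `L` or of `r`, and `r` is at most of the order of `L`, since `v` takes different values
near the two end points.
-/

noncomputable section

namespace HallTorus

/-! ### Fermionic algebra in the occupation number basis -/

section FockAlgebra

variable {L n : ℕ} [NeZero L]

/-- The occupation number basis vector with set `T` of occupied modes. -/
def ket (T : Finset (Mode L n)) : Fock L n := EuclideanSpace.single T 1

/-- The sign `(-1) ^ #{b ∈ T | b before a}` of the Jordan-Wigner string. -/
def jwSign (a : Mode L n) (T : Finset (Mode L n)) : ℂ :=
  (-1 : ℂ) ^ (T.filter fun b => modeIndex b < modeIndex a).card

/-- The operator that is diagonal in the occupation number basis, with eigenvalues `d`. -/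
def occDiag (d : Finset (Mode L n) → ℂ) : Op L n :=
  Matrix.toEuclideanCLM (𝕜 := ℂ) (n := Finset (Mode L n)) (Matrix.diagonal d)

/-- The fermion parity `(-1) ^ N`. -/
def parity : Op L n := occDiag fun T => (-1 : ℂ) ^ T.card

-- On the concrete type `Op L n` general algebraic identities are often not found by `rw` and `simp`,
-- so that the needed instances are stated separately.

lemma op_neg_mul (A B : Op L n) : -A * B = -(A * B) := neg_mul A B

lemma op_mul_neg (A B : Op L n) : A * -B = -(A * B) := mul_neg A B

lemma op_neg_neg (A : Op L n) : - -A = A := neg_neg A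

lemma op_star_neg (A : Op L n) : star (-A) = -star A := star_neg A

lemma op_norm_star (A : Op L n) : ‖star A‖ = ‖A‖ := norm_star A

lemma op_ext_ket {A B : Op L n} (h : ∀ T, A (ket T) = B (ket T)) : A = B := by
  have : (A : Fock L n →ₗ[ℂ] Fock L n) = B := by
    apply (EuclideanSpace.basisFun (Finset (Mode L n)) ℂ).toBasis.ext
    intro T
    simpa [ket] using h T
  exact ContinuousLinearMap.coe_injective this

lemma toEuclideanCLM_ket (M : Matrix (Finset (Mode L n)) (Finset (Mode L n)) ℂ)
    (S T : Finset (Mode L n)) :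
    (Matrix.toEuclideanCLM (𝕜 := ℂ) (n := Finset (Mode L n)) M (ket T)) S = M S T := by
  simp [ket]

lemma ket_apply (S T : Finset (Mode L n)) : (ket T : Fock L n) S = if S = T then 1 else 0 := by
  simp [ket]

lemma annihilate_ket (a : Mode L n) (T : Finset (Mode L n)) :
    annihilate a (ket T) = if a ∈ T then jwSign a T • ket (T.erase a) else 0 := by
  ext S
  rw [annihilate, toEuclideanCLM_ket]
  by_cases ha : a ∈ T <;> simp [ha, ket_apply, jwSign]

lemma create_ket (a : Mode L n) (T : Finset (Mode L n)) :
    create a (ket T) = if a ∈ T then 0 else jwSign a T • ket (insert a T) := by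
  ext S
  rw [create, annihilate, ← map_star, toEuclideanCLM_ket, Matrix.star_apply, Matrix.of_apply]
  by_cases ha : a ∈ T
  · have : ¬ (a ∈ S ∧ T = S.erase a) := by
      rintro ⟨h, rfl⟩
      simp at ha
    simp [ha, this]
  · by_cases hS : S = insert a T
    · subst hS
      have : (Finset.filter (fun b => modeIndex b < modeIndex a) (insert a T)) =
          Finset.filter (fun b => modeIndex b < modeIndex a) T := by
        rw [Finset.filter_insert]; simp
      simp [ha, ket_apply, jwSign, this]
    · have : ¬ (a ∈ S ∧ T = S.erase a) := by
        rintro ⟨h, rfl⟩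
        exact hS (Finset.insert_erase h).symm
      simp [ha, this, ket_apply, hS]

lemma occDiag_apply (d : Finset (Mode L n) → ℂ) (x : Fock L n) (S : Finset (Mode L n)) :
    (occDiag d x) S = d S * x S := by
  simp [occDiag, Matrix.mulVec_diagonal]

lemma occDiag_ket (d : Finset (Mode L n) → ℂ) (T : Finset (Mode L n)) :
    occDiag d (ket T) = d T • ket T := by
  ext S
  rw [occDiag_apply]
  by_cases h : S = T <;> simp [ket_apply, h]

lemma occDiag_commute (d e : Finset (Mode L n) → ℂ) : Commute (occDiag d) (occDiag e) := by
  apply op_ext_ket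
  intro T
  simp [mul_apply_eq_comp, occDiag_ket, smul_smul, mul_comm]

lemma isSelfAdjoint_occDiag {d : Finset (Mode L n) → ℂ} (h : ∀ T, star (d T) = d T) :
    IsSelfAdjoint (occDiag d) := by
  rw [IsSelfAdjoint, occDiag, ← map_star, Matrix.star_eq_conjTranspose,
    Matrix.diagonal_conjTranspose]
  congr 2
  ext T
  exact h T

lemma modeIndex_injective : Function.Injective (modeIndex : Mode L n → ℕ) := by
  rintro ⟨⟨a, b⟩, s⟩ ⟨⟨a', b'⟩, s'⟩ h
  simp only [modeIndex] at h
  have hn : 0 < n := by have := s.2; omega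
  have hL : 0 < L := Nat.pos_of_ne_zero (NeZero.ne L)
  have h1 : s.val = s'.val := by
    have := congrArg (· % n) h
    simpa [Nat.mul_add_mod', Nat.mod_eq_of_lt s.2, Nat.mod_eq_of_lt s'.2] using this
  have h2 : a.val * L + b.val = a'.val * L + b'.val := by
    rw [h1] at h
    exact Nat.eq_of_mul_eq_mul_right hn (Nat.add_right_cancel h)
  have h3 : b.val = b'.val := by
    have := congrArg (· % L) h2
    simpa [Nat.mul_add_mod', Nat.mod_eq_of_lt (ZMod.val_lt b), Nat.mod_eq_of_lt (ZMod.val_lt b')]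
      using this
  have h4 : a.val = a'.val := by
    rw [h3] at h2
    exact Nat.eq_of_mul_eq_mul_right hL (Nat.add_right_cancel h2)
  rw [ZMod.val_injective L h3, ZMod.val_injective L h4, Fin.ext h1]

lemma jwSign_erase (a : Mode L n) {b : Mode L n} {T : Finset (Mode L n)} (hb : b ∈ T) :
    jwSign a (T.erase b) =
      if modeIndex b < modeIndex a then -jwSign a T else jwSign a T := by
  rw [jwSign, jwSign, Finset.filter_erase]
  split_ifs with h
  · have hm : b ∈ T.filter fun c => modeIndex c < modeIndex a := by simp [hb, h]
    rw [← Finset.card_erase_add_one hm, pow_succ]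
    ring
  · rw [Finset.erase_eq_of_notMem]
    simp [h]

lemma jwSign_insert (a : Mode L n) {b : Mode L n} {T : Finset (Mode L n)} (hb : b ∉ T) :
    jwSign a (insert b T) =
      if modeIndex b < modeIndex a then -jwSign a T else jwSign a T := by
  have := jwSign_erase a (Finset.mem_insert_self b T)
  rw [Finset.erase_insert hb] at this
  rw [this]
  split_ifs <;> simp

lemma jwSign_mul_self (a : Mode L n) (T : Finset (Mode L n)) : jwSign a T * jwSign a T = 1 := by
  rw [jwSign, ← mul_pow]; simp

lemma annihilate_mul_annihilate {a b : Mode L n} (hab : a ≠ b) :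
    annihilate a * annihilate b = -(annihilate b * annihilate a) := by
  apply op_ext_ket
  intro T
  rw [neg_apply, mul_apply_eq_comp, mul_apply_eq_comp,
    annihilate_ket, annihilate_ket]
  by_cases ha : a ∈ T <;> by_cases hb : b ∈ T <;>
    simp only [ha, hb, if_true, if_false, map_smul, map_zero, annihilate_ket, Finset.mem_erase,
      ne_eq, hab, hab.symm, not_false_eq_true, and_true, and_false, smul_zero, neg_zero]
  rw [jwSign_erase a hb, jwSign_erase b ha, smul_smul, smul_smul, Finset.erase_right_comm]
  have hne : modeIndex a ≠ modeIndex b := fun h => hab (modeIndex_injective h)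
  rcases lt_or_gt_of_ne hne with h | h
  · simp [h, not_lt.mpr h.le, mul_comm]
  · simp [h, not_lt.mpr h.le, mul_comm]

lemma annihilate_mul_create {a b : Mode L n} (hab : a ≠ b) :
    annihilate a * create b = -(create b * annihilate a) := by
  apply op_ext_ket
  intro T
  rw [neg_apply, mul_apply_eq_comp, mul_apply_eq_comp,
    annihilate_ket, create_ket]
  by_cases ha : a ∈ T <;> by_cases hb : b ∈ T <;>
    simp only [ha, hb, if_true, if_false, map_smul, map_zero, annihilate_ket, create_ket,
      Finset.mem_erase, Finset.mem_insert, or_true, or_self,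
      ne_eq, hab, hab.symm, not_false_eq_true, and_true, and_false, smul_zero, neg_zero]
  rw [jwSign_insert a hb, jwSign_erase b ha, smul_smul, smul_smul,
    Finset.erase_insert_of_ne hab.symm]
  have hne : modeIndex a ≠ modeIndex b := fun h => hab (modeIndex_injective h)
  rcases lt_or_gt_of_ne hne with h | h
  · simp [h, not_lt.mpr h.le, mul_comm]
  · simp [h, not_lt.mpr h.le, mul_comm]

lemma create_mul_create {a b : Mode L n} (hab : a ≠ b) :
    create a * create b = -(create b * create a) := by
  have := congrArg star (annihilate_mul_annihilate hab.symm)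
  rw [op_star_neg, star_mul, star_mul] at this
  exact this

lemma create_mul_annihilate_self (a : Mode L n) :
    create a * annihilate a = occDiag fun T => if a ∈ T then 1 else 0 := by
  apply op_ext_ket
  intro T
  rw [mul_apply_eq_comp, annihilate_ket, occDiag_ket]
  by_cases ha : a ∈ T
  · simp [ha, create_ket, jwSign_erase, smul_smul, jwSign_mul_self, Finset.insert_erase]
  · simp [ha]

lemma norm_adjoint_mul_self {E : Type*} [NormedAddCommGroup E] [InnerProductSpace ℂ E]
    [CompleteSpace E] (A : E →L[ℂ] E) : ‖star A * A‖ = ‖A‖ * ‖A‖ :=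
  CStarRing.norm_star_mul_self

lemma norm_annihilate_le (a : Mode L n) : ‖annihilate a‖ ≤ 1 := by
  have h1 : ‖create a * annihilate a‖ = ‖annihilate a‖ * ‖annihilate a‖ :=
    norm_adjoint_mul_self (annihilate a)
  have h2 : ‖create a * annihilate a‖ ≤ 1 := by
    rw [create_mul_annihilate_self]
    apply ContinuousLinearMap.opNorm_le_bound _ zero_le_one
    intro x
    rw [one_mul, EuclideanSpace.norm_eq, EuclideanSpace.norm_eq]
    apply Real.sqrt_le_sqrt
    apply Finset.sum_le_sum
    intro S _
    rw [occDiag_apply]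
    split_ifs <;> simp
  nlinarith [norm_nonneg (annihilate a)]

lemma norm_create_le (a : Mode L n) : ‖create a‖ ≤ 1 := by
  rw [create, op_norm_star]; exact norm_annihilate_le a

lemma norm_create_mul_annihilate_le (a b : Mode L n) : ‖create a * annihilate b‖ ≤ 1 :=
  (norm_mul_le _ _).trans (mul_le_one₀ (norm_create_le a) (norm_nonneg _) (norm_annihilate_le b))

/-! ### Particle numbers and electrostatic potentials -/

lemma sum_occDiag {ι : Type*} (s : Finset ι) (d : ι → Finset (Mode L n) → ℂ) :
    ∑ i ∈ s, occDiag (d i) = occDiag fun T => ∑ i ∈ s, d i T := by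
  apply op_ext_ket
  intro T
  simp [occDiag_ket, Finset.sum_smul]

lemma smul_occDiag (c : ℂ) (d : Finset (Mode L n) → ℂ) :
    c • occDiag d = occDiag fun T => c * d T := by
  apply op_ext_ket
  intro T
  simp [occDiag_ket, smul_smul]

lemma potentialOp_eq_occDiag (v : Site L → ℝ) :
    potentialOp n v = occDiag fun T => ∑ a ∈ T, (v a.1 : ℂ) := by
  simp only [potentialOp, number, create_mul_annihilate_self, sum_occDiag, smul_occDiag]
  congr 1
  ext T
  simp only [Finset.mul_sum]
  rw [← Finset.sum_product', Finset.univ_product_univ, Finset.sum_congr rfl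
    (g := fun a : Mode L n => if a ∈ T then (v a.1 : ℂ) else 0)]
  · simp
  · rintro ⟨x, s⟩ _
    simp

lemma isSelfAdjoint_potentialOp (v : Site L → ℝ) : IsSelfAdjoint (potentialOp n v) := by
  rw [potentialOp_eq_occDiag]
  apply isSelfAdjoint_occDiag
  intro T
  simp

lemma potentialOp_commute (v w : Site L → ℝ) :
    Commute (potentialOp n v) (potentialOp n w) := by
  rw [potentialOp_eq_occDiag, potentialOp_eq_occDiag]
  exact occDiag_commute _ _

/-- Hopping from `b` to `a` changes the potential energy by `v a - v b`. -/
lemma potentialOp_mul_hop (v : Site L → ℝ) (a b : Mode L n) :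
    potentialOp n v * (create a * annihilate b) =
      (create a * annihilate b) * potentialOp n v +
        ((v a.1 - v b.1 : ℝ) : ℂ) • (create a * annihilate b) := by
  rw [potentialOp_eq_occDiag]
  apply op_ext_ket
  intro T
  simp only [mul_apply_eq_comp, add_apply, occDiag_ket,
    smul_apply, map_smul]
  rw [annihilate_ket]
  by_cases hb : b ∈ T
  · rw [if_pos hb, map_smul, create_ket]
    by_cases ha : a ∈ T.erase b
    · simp [ha]
    · rw [if_neg ha]
      simp only [map_smul, occDiag_ket, Finset.sum_insert ha]
      rw [← Finset.add_sum_erase T _ hb]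
      simp only [smul_smul, ← add_smul]
      congr 1
      push_cast
      ring
  · simp [hb]

/-! ### Even local operators -/

lemma commute_occDiag_comp {O : Op L n} {d : Finset (Mode L n) → ℂ} (h : Commute O (occDiag d))
    (F : ℂ → ℂ) : Commute O (occDiag fun T => F (d T)) := by
  apply op_ext_ket
  intro T
  have h1 := congrArg (fun A : Op L n => A (ket T)) h
  simp only [mul_apply_eq_comp, occDiag_ket, map_smul] at h1 ⊢
  ext S
  have h2 := congrArg (fun x : Fock L n => x S) h1
  simp only [PiLp.smul_apply, occDiag_apply, smul_eq_mul] at h2 ⊢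
  by_cases hz : (O (ket T)) S = 0
  · simp [hz]
  · rw [mul_right_cancel₀ hz h2]

/-- `O` is even: it preserves the fermion parity; and it is supported in `X`. -/
def IsEvenLocal (X : Finset (Site L)) (O : Op L n) : Prop :=
  O ∈ localAlgebra n X ∧ Commute O parity

lemma localAlgebra_mono {X Y : Finset (Site L)} (h : X ⊆ Y) :
    localAlgebra n X ≤ localAlgebra n Y := by
  apply Algebra.adjoin_mono
  rintro O ⟨a, ha, hO⟩
  exact ⟨a, h ha, hO⟩

namespace IsEvenLocal

variable {X Y : Finset (Site L)} {O O' : Op L n}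

lemma mono (h : IsEvenLocal X O) (hXY : X ⊆ Y) : IsEvenLocal Y O :=
  ⟨localAlgebra_mono hXY h.1, h.2⟩

lemma add (h : IsEvenLocal X O) (h' : IsEvenLocal X O') : IsEvenLocal X (O + O') :=
  ⟨add_mem h.1 h'.1, h.2.add_left h'.2⟩

lemma smul (h : IsEvenLocal X O) (c : ℂ) : IsEvenLocal X (c • O) :=
  ⟨Subalgebra.smul_mem _ h.1 c, h.2.smul_left c⟩

lemma zero : IsEvenLocal X (0 : Op L n) := ⟨zero_mem _, Commute.zero_left _⟩

lemma sum {ι : Type*} {s : Finset ι} {f : ι → Op L n} (h : ∀ i ∈ s, IsEvenLocal X (f i)) :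
    IsEvenLocal X (∑ i ∈ s, f i) :=
  ⟨sum_mem fun i hi => (h i hi).1, Commute.sum_left _ _ _ fun i hi => (h i hi).2⟩

end IsEvenLocal

lemma parity_mul_parity : (parity * parity : Op L n) = 1 := by
  apply op_ext_ket
  intro T
  simp [mul_apply_eq_comp, parity, occDiag_ket, smul_smul, ← mul_pow]

lemma parity_mul_annihilate (a : Mode L n) :
    parity * annihilate a = -(annihilate a * parity) := by
  apply op_ext_ket
  intro T
  simp only [neg_apply, mul_apply_eq_comp, parity, occDiag_ket,
    map_smul, annihilate_ket]
  by_cases ha : a ∈ T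
  · simp only [ha, if_true, map_smul, occDiag_ket, smul_smul, ← neg_smul]
    rw [← Finset.card_erase_add_one ha, pow_succ]
    congr 1
    ring
  · simp [ha]

lemma isSelfAdjoint_parity : IsSelfAdjoint (parity : Op L n) := by
  apply isSelfAdjoint_occDiag
  intro T
  simp

lemma parity_mul_create (a : Mode L n) :
    parity * create a = -(create a * parity) := by
  have := congrArg star (parity_mul_annihilate a)
  rw [op_star_neg, star_mul, star_mul, isSelfAdjoint_parity.star_eq] at this
  rw [create, this, op_neg_neg]

/-- Moving an operator with support in `X` past a creation or annihilation operator outside `X`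
conjugates it with the fermion parity. -/
lemma mul_eq_mul_parity_conj {X : Finset (Site L)} {O : Op L n} (hO : O ∈ localAlgebra n X)
    {b : Mode L n} (hb : b.1 ∉ X) {c : Op L n} (hc : c = annihilate b ∨ c = create b) :
    O * c = c * (parity * O * parity) := by
  induction hO using Algebra.adjoin_induction with
  | mem O h =>
    obtain ⟨a, ha, h⟩ := h
    have hab : a ≠ b := by rintro rfl; exact hb ha
    have hp : parity * O * parity = -O := by
      rcases h with rfl | rfl
      · rw [parity_mul_annihilate, op_neg_mul, mul_assoc, parity_mul_parity, mul_one]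
      · rw [parity_mul_create, op_neg_mul, mul_assoc, parity_mul_parity, mul_one]
    rw [hp, op_mul_neg]
    rcases h with rfl | rfl <;> rcases hc with rfl | rfl
    · exact annihilate_mul_annihilate hab
    · exact annihilate_mul_create hab
    · rw [annihilate_mul_create hab.symm, op_neg_neg]
    · exact create_mul_create hab
  | algebraMap r =>
    rw [Algebra.algebraMap_eq_smul_one]
    simp [parity_mul_parity]
  | add x y _ _ hx hy => rw [add_mul, hx, hy]; noncomm_ring
  | mul x y _ _ hx hy =>
    rw [mul_assoc, hy, ← mul_assoc, hx]
    have : parity * (x * y) * parity = parity * x * (parity * parity) * y * (parity : Op L n) := by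
      rw [parity_mul_parity]; noncomm_ring
    rw [this]
    noncomm_ring

/-- Even operators commute with all operators of disjoint support. -/
lemma IsEvenLocal.commute {X Y : Finset (Site L)} {O O' : Op L n} (h : IsEvenLocal X O)
    (h' : O' ∈ localAlgebra n Y) (hXY : Disjoint X Y) : Commute O O' := by
  have key : ∀ (b : Mode L n), b.1 ∉ X → ∀ c : Op L n, (c = annihilate b ∨ c = create b) →
      O * c = c * O := by
    intro b hb c hc
    rw [mul_eq_mul_parity_conj h.1 hb hc, ← h.2.eq, mul_assoc O, parity_mul_parity, mul_one]
  induction h' using Algebra.adjoin_induction with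
  | mem O' h =>
    obtain ⟨a, ha, h⟩ := h
    exact key a (Finset.disjoint_right.mp hXY ha) _ h
  | algebraMap r => exact (Algebra.commutes r O).symm
  | add x y _ _ hx hy => exact hx.add_right hy
  | mul x y _ _ hx hy => exact hx.mul_right hy

lemma isEvenLocal_hop {X : Finset (Site L)} {a b : Mode L n} (ha : a.1 ∈ X) (hb : b.1 ∈ X) :
    IsEvenLocal X (create a * annihilate b) := by
  refine ⟨mul_mem (Algebra.subset_adjoin ⟨a, ha, Or.inr rfl⟩)
    (Algebra.subset_adjoin ⟨b, hb, Or.inl rfl⟩), ?_⟩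
  rw [Commute, SemiconjBy, ← mul_assoc, parity_mul_create, op_neg_mul, mul_assoc (create a) parity,
    parity_mul_annihilate, op_mul_neg, op_neg_neg, mul_assoc]

lemma isEvenLocal_int (Φ : LatticeHamiltonian L n) (X : Finset (Site L)) :
    IsEvenLocal X (Φ.int X) := by
  refine ⟨Φ.int_mem X, ?_⟩
  have h1 : Commute (Φ.int X) (potentialOp n fun _ => 1) := by
    apply Commute.sum_right
    intro x _
    exact (Φ.int_comm X x).smul_right _
  rw [potentialOp_eq_occDiag] at h1
  -- the parity is the function `(-1) ^ N` of the total particle number `N`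
  have h2 := commute_occDiag_comp h1 fun z => (-1 : ℂ) ^ ⌊z.re⌋₊
  have h3 : (parity : Op L n) =
      occDiag fun T => (-1 : ℂ) ^ ⌊(∑ a ∈ T, ((1 : ℝ) : ℂ)).re⌋₊ := by
    simp [parity]
  rw [h3]
  exact h2

lemma int_commute_potentialOp (Φ : LatticeHamiltonian L n) (X : Finset (Site L))
    (v : Site L → ℝ) : Commute (Φ.int X) (potentialOp n v) := by
  apply Commute.sum_right
  intro x _
  exact (Φ.int_comm X x).smul_right _

end FockAlgebra

/-! ### A time filter that resolves the spectral gap -/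

section TimeFilter

open MeasureTheory Complex
open scoped FourierTransform

/-- There is a rapidly decaying function of time with integral one and vanishing first moment, whose
Fourier transform vanishes at all frequencies outside `(-g, g)`. -/
lemma exists_gapFilter {g : ℝ} (hg : 0 < g) :
    ∃ f : ℝ → ℂ, Continuous f ∧ (∀ p : ℕ, Integrable fun t : ℝ => |t| ^ p * ‖f t‖) ∧
      ∫ t, f t = 1 ∧ ∫ t : ℝ, (t : ℂ) * f t = 0 ∧
      ∀ ω : ℝ, g ≤ |ω| → ∫ t : ℝ, f t * exp (-(I * ω * t)) = 0 := by
  have hpi := Real.pi_pos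
  -- `f` is the Fourier transform of an even bump function in frequency space
  let φ : ContDiffBump (0 : ℝ) :=
    ⟨g / (4 * Real.pi), g / (2 * Real.pi), by positivity, by
      apply div_lt_div_of_pos_left hg (by positivity); linarith⟩
  let φc : ℝ → ℂ := fun x => (φ x : ℂ)
  have hc1 : HasCompactSupport φc := φ.hasCompactSupport.comp_left (g := fun x : ℝ => (x : ℂ)) rfl
  have hc2 : ContDiff ℝ ((⊤ : ℕ∞) : WithTop ℕ∞) φc := ofRealCLM.contDiff.comp φ.contDiff
  let Φ := hc1.toSchwartzMap hc2
  have hΦ : (Φ : ℝ → ℂ) = φc := rfl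
  obtain ⟨F, hF⟩ : ∃ F : SchwartzMap ℝ ℂ, F = 𝓕 Φ := ⟨_, rfl⟩
  have hinv : 𝓕⁻ F = Φ := by rw [hF]; exact FourierTransform.fourierInv_fourier_eq Φ
  have hinv' : ∀ ω : ℝ, ∫ t : ℝ, exp (((2 * Real.pi * (t * ω) : ℝ) : ℂ) * I) * F t = φ ω := by
    intro ω
    have h1 : (𝓕⁻ F : SchwartzMap ℝ ℂ) ω = (φ ω : ℂ) := by rw [hinv, hΦ]
    rw [SchwartzMap.fourierInv_coe, Real.fourierInv_eq'] at h1
    rw [← h1]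
    congr 1
    funext t
    simp [mul_comm]
  have heven : ∀ t, F (-t) = F t := by
    intro t
    rw [hF, SchwartzMap.fourier_coe, hΦ, ← Real.fourierInv_eq_fourier_neg,
      Real.fourierInv_eq_fourier_comp_neg]
    have : (fun x => φc (-x)) = φc := by
      funext x
      simp [φc, φ.neg]
    rw [this]
  refine ⟨F, F.continuous, fun p => F.integrable_pow_mul volume p, ?_, ?_, ?_⟩
  · have := hinv' 0
    simpa [φ.one_of_mem_closedBall (Metric.mem_closedBall_self φ.rIn_pos.le)] using this
  · have h := integral_neg_eq_self (fun t : ℝ => (t : ℂ) * F t) volume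
    simp only [heven, ofReal_neg, neg_mul, integral_neg] at h
    have h2 : (2 : ℂ) * ∫ t : ℝ, (t : ℂ) * F t = 0 := by linear_combination -h
    simpa using h2
  · intro ω hω
    have h := hinv' (-ω / (2 * Real.pi))
    rw [φ.zero_of_le_dist] at h
    · rw [← ofReal_zero, ← h]
      congr 1
      ext t
      rw [mul_comm]
      congr 2
      push_cast
      have : (Real.pi : ℂ) ≠ 0 := by exact_mod_cast hpi.ne'
      field_simp
    · rw [dist_zero_right, norm_div, norm_neg, Real.norm_eq_abs, Real.norm_eq_abs,
        abs_of_pos (show 0 < 2 * Real.pi by positivity)]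
      exact div_le_div_of_nonneg_right hω (by positivity)

/-- The solution `D` of `D'' = exp (-i ω t)` with `D 0 = D' 0 = 0`. -/
def secondPrimitive (ω t : ℝ) : ℂ := (1 - exp (-(I * ω * t)) - I * ω * t) / (ω : ℂ) ^ 2

lemma hasDerivAt_exp_neg_I_mul (ω t : ℝ) :
    HasDerivAt (fun t : ℝ => exp (-(I * ω * t))) (-(I * ω) * exp (-(I * ω * t))) t := by
  have h := (((hasDerivAt_id (t : ℂ)).const_mul (I * (ω : ℂ))).neg.cexp).comp_ofReal
  simpa [mul_comm] using h

lemma hasDerivAt_secondPrimitive (ω t : ℝ) :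
    HasDerivAt (secondPrimitive ω) (I * ω * (exp (-(I * ω * t)) - 1) / (ω : ℂ) ^ 2) t := by
  have h1 := hasDerivAt_exp_neg_I_mul ω t
  have h2 : HasDerivAt (fun t : ℝ => I * ω * (t : ℂ)) (I * ω) t := by
    simpa using ((hasDerivAt_id (t : ℂ)).const_mul (I * (ω : ℂ))).comp_ofReal
  have h3 := (((hasDerivAt_const t (1 : ℂ)).sub h1).sub h2).div_const ((ω : ℂ) ^ 2)
  exact h3.congr_deriv (by ring)

lemma hasDerivAt_deriv_secondPrimitive {ω : ℝ} (hω : ω ≠ 0) (t : ℝ) :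
    HasDerivAt (fun t : ℝ => I * ω * (exp (-(I * ω * t)) - 1) / (ω : ℂ) ^ 2)
      (exp (-(I * ω * t))) t := by
  have h1 := (((hasDerivAt_exp_neg_I_mul ω t).sub_const 1).const_mul (I * (ω : ℂ))).div_const
    ((ω : ℂ) ^ 2)
  have : (ω : ℂ) ≠ 0 := by exact_mod_cast hω
  refine h1.congr_deriv ?_
  rw [div_eq_iff (pow_ne_zero 2 this)]
  linear_combination (-(exp (-(I * ω * t)) * ω ^ 2)) * I_sq

/-- A trigonometric sum of polynomial growth with frequencies away from zero: its second primitive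
at zero frequency is bounded by a constant that depends on the gap and on the growth only. -/
lemma exists_norm_sum_div_sq_le {g : ℝ} (hg : 0 < g) (p : ℕ) :
    ∃ M : ℝ, 0 ≤ M ∧ ∀ {ι : Type} [Fintype ι] (a : ι → ℂ) (ω : ι → ℝ), (∀ i, g ≤ |ω i|) →
      ∀ K : ℝ, 0 ≤ K → (∀ t : ℝ, ‖∑ i, a i * exp (-(I * ω i * t))‖ ≤ K * (1 + |t|) ^ p) →
        ‖∑ i, a i / (ω i : ℂ) ^ 2‖ ≤ M * K := by
  obtain ⟨f, hfc, hfi, hf0, hf1, hfω⟩ := exists_gapFilter hg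
  have hint : Integrable fun t : ℝ => t ^ 2 * (1 + |t|) ^ p * ‖f t‖ := by
    have h : Integrable fun t : ℝ =>
        ∑ m ∈ Finset.range (p + 1), (p.choose m : ℝ) * (|t| ^ (p - m + 2) * ‖f t‖) :=
      integrable_finsetSum _ fun m _ => (hfi _).const_mul _
    refine h.congr (Filter.Eventually.of_forall fun t => ?_)
    simp only
    rw [add_pow, Finset.mul_sum, Finset.sum_mul]
    refine Finset.sum_congr rfl fun m _ => ?_
    rw [pow_add, sq_abs]
    ring
  have hf_int : Integrable f := by
    have := hfi 0
    simp only [pow_zero, one_mul] at this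
    exact (integrable_norm_iff hfc.aestronglyMeasurable).mp this
  have hft_int : Integrable fun t : ℝ => (t : ℂ) * f t := by
    have := hfi 1
    refine (integrable_norm_iff (by fun_prop)).mp ?_
    refine this.congr (Filter.Eventually.of_forall fun t => ?_)
    simp
  refine ⟨∫ t : ℝ, t ^ 2 * (1 + |t|) ^ p * ‖f t‖, by positivity, ?_⟩
  intro ι _ a ω hω K hK hc
  have hω0 : ∀ i, ω i ≠ 0 := fun i h => by
    have := hω i
    rw [h, abs_zero] at this
    linarith
  set G : ℝ → ℂ := fun t => ∑ i, a i * secondPrimitive (ω i) t with hG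
  set G1 : ℝ → ℂ := fun t =>
    ∑ i, a i * (I * ω i * (exp (-(I * ω i * t)) - 1) / (ω i : ℂ) ^ 2) with hG1
  have hdG : ∀ t : ℝ, HasDerivAt G (G1 t) t := fun t =>
    HasDerivAt.fun_sum fun i _ => (hasDerivAt_secondPrimitive (ω i) t).const_mul (a i)
  have hdG1 : ∀ t : ℝ, HasDerivAt G1 (∑ i, a i * exp (-(I * ω i * t))) t := fun t =>
    HasDerivAt.fun_sum fun i _ => (hasDerivAt_deriv_secondPrimitive (hω0 i) t).const_mul (a i)
  have hG0 : G 0 = 0 := by simp [hG, secondPrimitive]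
  have hG10 : G1 0 = 0 := by simp [hG1]
  have habs : ∀ {s t : ℝ}, s ∈ Set.uIcc 0 t → |s| ≤ |t| := by
    intro s t hs
    have := Set.abs_sub_left_of_mem_uIcc hs
    simpa using this
  have hG1b : ∀ t, ‖G1 t‖ ≤ K * (1 + |t|) ^ p * |t| := by
    intro t
    have := Convex.norm_image_sub_le_of_norm_hasDerivWithin_le (𝕜 := ℝ) (s := Set.uIcc 0 t)
      (C := K * (1 + |t|) ^ p) (fun s _ => (hdG1 s).hasDerivWithinAt)
      (fun s hs => (hc s).trans (by have := habs hs; gcongr)) (convex_uIcc 0 t)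
      Set.left_mem_uIcc Set.right_mem_uIcc
    simpa [hG10] using this
  have hGb : ∀ t, ‖G t‖ ≤ K * (t ^ 2 * (1 + |t|) ^ p) := by
    intro t
    have := Convex.norm_image_sub_le_of_norm_hasDerivWithin_le (𝕜 := ℝ) (s := Set.uIcc 0 t)
      (C := K * (1 + |t|) ^ p * |t|) (fun s _ => (hdG s).hasDerivWithinAt)
      (fun s hs => (hG1b s).trans (by have := habs hs; gcongr)) (convex_uIcc 0 t)
      Set.left_mem_uIcc Set.right_mem_uIcc
    rw [hG0, sub_zero, sub_zero, Real.norm_eq_abs] at this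
    calc ‖G t‖ ≤ _ := this
      _ = K * (|t| ^ 2 * (1 + |t|) ^ p) := by ring
      _ = _ := by rw [sq_abs]
  have hD : ∀ i, ∫ t : ℝ, f t * secondPrimitive (ω i) t = 1 / (ω i : ℂ) ^ 2 := by
    intro i
    have he : Integrable fun t : ℝ => f t * exp (-(I * ω i * t)) := by
      refine (integrable_norm_iff (by fun_prop)).mp ?_
      refine hf_int.norm.congr (Filter.Eventually.of_forall fun t => ?_)
      have : -(I * ω i * t) = ((-(ω i * t) : ℝ) : ℂ) * I := by push_cast; ring
      simp only [norm_mul, this, norm_exp_ofReal_mul_I, mul_one]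
    have h : (fun t : ℝ => f t * secondPrimitive (ω i) t) = fun t : ℝ =>
        (1 / (ω i : ℂ) ^ 2) * f t - (1 / (ω i : ℂ) ^ 2) * (f t * exp (-(I * ω i * t))) -
          (I * ω i / (ω i : ℂ) ^ 2) * ((t : ℂ) * f t) := by
      ext t
      rw [secondPrimitive]
      ring
    rw [h, integral_sub, integral_sub, integral_const_mul, integral_const_mul, integral_const_mul,
      hf0, hf1, hfω _ (hω i)]
    · simp
    · exact hf_int.const_mul _
    · exact he.const_mul _
    · exact (hf_int.const_mul _).sub (he.const_mul _)
    · exact hft_int.const_mul _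
  have hfG_int : ∀ i, Integrable fun t : ℝ => a i * (f t * secondPrimitive (ω i) t) := by
    intro i
    by_contra hni
    have : ¬ Integrable fun t : ℝ => f t * secondPrimitive (ω i) t := fun h => hni (h.const_mul _)
    have h0 := integral_undef this
    rw [hD i] at h0
    have : (ω i : ℂ) ≠ 0 := by exact_mod_cast hω0 i
    simp [this] at h0
  have hsum : ∑ i, a i / (ω i : ℂ) ^ 2 = ∫ t : ℝ, f t * G t := by
    have : (fun t : ℝ => f t * G t) = fun t : ℝ => ∑ i, a i * (f t * secondPrimitive (ω i) t) := by
      ext t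
      rw [hG, Finset.mul_sum]
      exact Finset.sum_congr rfl fun i _ => by ring
    rw [this, integral_finsetSum _ fun i _ => hfG_int i]
    refine Finset.sum_congr rfl fun i _ => ?_
    rw [integral_const_mul, hD i]
    ring
  rw [hsum, ← integral_mul_const]
  refine norm_integral_le_of_norm_le (hint.mul_const K) (Filter.Eventually.of_forall fun t => ?_)
  rw [norm_mul]
  calc ‖f t‖ * ‖G t‖ ≤ ‖f t‖ * (K * (t ^ 2 * (1 + |t|) ^ p)) := by gcongr; exact hGb t
    _ = _ := by ring

end TimeFilter

/-! ### Operators with a gapped non-degenerate ground state -/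

section Spectral

open Complex

variable {E : Type*} [NormedAddCommGroup E] [InnerProductSpace ℂ E]

section Diagonal

variable {ι : Type*} [Fintype ι] (b : OrthonormalBasis ι ℂ E)

/-- The operator that is diagonal in the orthonormal basis `b`, with eigenvalues `f`. -/
def diagOp (f : ι → ℂ) : E →L[ℂ] E := ∑ i, f i • (innerSL ℂ (b i)).smulRight (b i)

lemma diagOp_apply (f : ι → ℂ) (x : E) : diagOp b f x = ∑ i, (f i * inner ℂ (b i) x) • b i := by
  simp [diagOp, smul_smul]

lemma diagOp_basis (f : ι → ℂ) (i : ι) : diagOp b f (b i) = f i • b i := by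
  classical
  rw [diagOp_apply, Finset.sum_eq_single i]
  · simp
  · intro j _ hj
    simp [b.inner_eq_ite, hj]
  · simp

lemma clm_ext_basis {A B : E →L[ℂ] E} (h : ∀ i, A (b i) = B (b i)) : A = B :=
  ContinuousLinearMap.coe_injective (b.toBasis.ext fun i => by simpa using h i)

lemma diagOp_mul (f f' : ι → ℂ) : diagOp b f * diagOp b f' = diagOp b (f * f') :=
  clm_ext_basis b fun i => by simp [diagOp_basis, smul_smul, mul_comm]

lemma diagOp_add (f f' : ι → ℂ) : diagOp b f + diagOp b f' = diagOp b (f + f') :=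
  clm_ext_basis b fun i => by simp [diagOp_basis, add_smul]

lemma diagOp_one : diagOp b 1 = 1 :=
  clm_ext_basis b fun i => by simp [diagOp_basis]

lemma inner_basis_diagOp (f : ι → ℂ) (i : ι) (x : E) :
    inner ℂ (b i) (diagOp b f x) = f i * inner ℂ (b i) x := by
  classical
  rw [diagOp_apply, inner_sum, Finset.sum_eq_single i]
  · rw [inner_smul_right, b.inner_eq_one, mul_one]
  · intro j _ hj
    rw [inner_smul_right, b.inner_eq_zero hj.symm, mul_zero]
  · simp

lemma norm_diagOp_le {f : ι → ℂ} {C : ℝ} (hC : 0 ≤ C) (h : ∀ i, ‖f i‖ ≤ C) : ‖diagOp b f‖ ≤ C := by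
  refine ContinuousLinearMap.opNorm_le_bound _ hC fun x => ?_
  have h1 : ‖diagOp b f x‖ ^ 2 ≤ (C * ‖x‖) ^ 2 := by
    rw [← b.sum_sq_norm_inner_right, mul_pow, ← b.sum_sq_norm_inner_right x, Finset.mul_sum]
    refine Finset.sum_le_sum fun i _ => ?_
    rw [inner_basis_diagOp, norm_mul, mul_pow]
    gcongr
    exact h i
  exact (sq_le_sq₀ (norm_nonneg _) (by positivity)).mp h1

variable [CompleteSpace E]

lemma star_diagOp (f : ι → ℂ) : star (diagOp b f) = diagOp b (star f) := by
  classical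
  refine clm_ext_basis b fun i => b.repr.injective (PiLp.ext fun j => ?_)
  rw [b.repr_apply_apply, b.repr_apply_apply, ContinuousLinearMap.star_eq_adjoint, ContinuousLinearMap.adjoint_inner_right,
    diagOp_basis, diagOp_basis, inner_smul_left, inner_smul_right, b.inner_eq_ite]
  split_ifs with h
  · subst h; simp
  · simp

lemma exp_diagOp (f : ι → ℂ) :
    NormedSpace.exp (diagOp b f) = diagOp b fun i => exp (f i) := by
  let Ψ : (ι → ℂ) →+* (E →L[ℂ] E) :=
    { toFun := diagOp b
      map_one' := diagOp_one b
      map_mul' := fun f f' => (diagOp_mul b f f').symm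
      map_zero' := clm_ext_basis b fun i => by simp [diagOp_basis]
      map_add' := fun f f' => (diagOp_add b f f').symm }
  have hc : Continuous Ψ := by
    change Continuous fun f : ι → ℂ => ∑ i, f i • (innerSL ℂ (b i)).smulRight (b i)
    fun_prop
  let _ : Algebra ℚ (E →L[ℂ] E) := Algebra.compHom _ (algebraMap ℚ ℂ)
  have h := NormedSpace.map_exp Ψ hc f
  change diagOp b (NormedSpace.exp f) = NormedSpace.exp (diagOp b f) at h
  rw [← h]
  congr 1
  ext i
  rw [Pi.coe_exp, Complex.exp_eq_exp_ℂ]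

end Diagonal

/-- An orthonormal eigenbasis of `H`, with a distinguished ground state vector whose energy is
separated by at least `g` from the energies of the other basis vectors. -/
structure SpectralGap (H : E →L[ℂ] E) (g : ℝ) where
  basis : OrthonormalBasis (Fin (Module.finrank ℂ E)) ℂ E
  energy : Fin (Module.finrank ℂ E) → ℝ
  ground : Fin (Module.finrank ℂ E)
  apply_basis : ∀ i, H (basis i) = (energy i : ℂ) • basis i
  gap_pos : 0 < g
  gap_le : ∀ i, i ≠ ground → energy ground + g ≤ energy i

namespace SpectralGap

variable {H : E →L[ℂ] E} {g : ℝ} (G : SpectralGap H g)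

/-- The ground state vector. -/
def vec : E := G.basis G.ground

/-- The excitation energies. -/
def freq (i : Fin (Module.finrank ℂ E)) : ℝ := G.energy i - G.energy G.ground

/-- The reduced resolvent `(H - E)⁻¹ (1 - P)` at the ground state energy `E`; the junk value
`0⁻¹ = 0` makes it vanish on the ground state. -/
def resolvent : E →L[ℂ] E := diagOp G.basis fun i => ((G.freq i)⁻¹ : ℝ)

/-- The projection onto the ground state. -/
def proj : E →L[ℂ] E := diagOp G.basis (Pi.single G.ground 1)

lemma norm_vec : ‖G.vec‖ = 1 := G.basis.norm_eq_one _

lemma proj_apply (x : E) : G.proj x = inner ℂ G.vec x • G.vec := by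
  rw [proj, diagOp_apply, Finset.sum_eq_single G.ground]
  · simp [vec]
  · intro j _ hj
    simp [hj]
  · simp

lemma apply_vec : H G.vec = (G.energy G.ground : ℂ) • G.vec := G.apply_basis _

lemma freq_ground : G.freq G.ground = 0 := sub_self _

lemma le_freq {i : Fin (Module.finrank ℂ E)} (hi : i ≠ G.ground) : g ≤ G.freq i := by
  have := G.gap_le i hi
  rw [freq]
  linarith

lemma freq_pos {i : Fin (Module.finrank ℂ E)} (hi : i ≠ G.ground) : 0 < G.freq i :=
  G.gap_pos.trans_le (G.le_freq hi)

lemma resolvent_mul : G.resolvent * (H - (G.energy G.ground : ℂ) • 1) = 1 - G.proj := by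
  refine clm_ext_basis G.basis fun i => ?_
  simp only [mul_apply_eq_comp, sub_apply, G.apply_basis, smul_apply,
    one_apply_eq_self, map_sub, map_smul, resolvent, proj, diagOp_basis, smul_smul]
  by_cases hi : i = G.ground
  · subst hi
    simp
  · have h0 : ((G.freq i : ℝ) : ℂ) ≠ 0 := by exact_mod_cast (G.freq_pos hi).ne'
    rw [← sub_smul, ← sub_mul, ← ofReal_sub, ← freq, ofReal_inv, mul_inv_cancel₀ h0]
    simp [hi]

lemma resolvent_mul_proj : G.resolvent * G.proj = 0 := by
  refine clm_ext_basis G.basis fun i => ?_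
  by_cases hi : i = G.ground
  · subst hi
    simp [resolvent, proj, diagOp_basis, freq_ground]
  · simp [resolvent, proj, diagOp_basis, hi]

lemma proj_mul_resolvent : G.proj * G.resolvent = 0 := by
  rw [proj, resolvent, diagOp_mul, mul_comm, ← diagOp_mul]
  exact G.resolvent_mul_proj

lemma resolvent_vec : G.resolvent G.vec = 0 := by
  simp [resolvent, vec, diagOp_basis, freq_ground]

lemma proj_mul_proj : G.proj * G.proj = G.proj := by
  rw [proj, diagOp_mul, ← Pi.single_mul, mul_one]

lemma proj_mul_mul_proj (A : E →L[ℂ] E) :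
    G.proj * A * G.proj = (inner ℂ G.vec (A G.vec)) • G.proj := by
  ext x
  simp only [mul_apply_eq_comp, smul_apply, G.proj_apply, map_smul, smul_smul]
  rw [mul_comm]

lemma norm_resolvent_le : ‖G.resolvent‖ ≤ g⁻¹ := by
  refine norm_diagOp_le _ (inv_nonneg.mpr G.gap_pos.le) fun i => ?_
  rw [norm_real, Real.norm_eq_abs, abs_inv]
  by_cases hi : i = G.ground
  · rw [hi, freq_ground, abs_zero, inv_zero]
    exact inv_nonneg.mpr G.gap_pos.le
  · rw [abs_of_pos (G.freq_pos hi)]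
    exact inv_anti₀ G.gap_pos (G.le_freq hi)

lemma norm_proj_le : ‖G.proj‖ ≤ 1 := by
  refine norm_diagOp_le _ zero_le_one fun i => ?_
  by_cases hi : i = G.ground
  · subst hi; simp
  · simp [hi]

/-- The spectral weight of the pair `A`, `B` of observables at the excitation `i`. -/
def weight (A B : E →L[ℂ] E) (i : Fin (Module.finrank ℂ E)) : ℂ :=
  inner ℂ (A G.vec) (G.basis i) * inner ℂ (G.basis i) (B G.vec)

lemma weight_swap (A B : E →L[ℂ] E) (i : Fin (Module.finrank ℂ E)) :
    G.weight B A i = (starRingEnd ℂ) (G.weight A B i) := by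
  rw [weight, weight, map_mul, inner_conj_symm, inner_conj_symm, mul_comm]

lemma inner_diagOp_eq_sum (A B : E →L[ℂ] E) (f : Fin (Module.finrank ℂ E) → ℂ) :
    inner ℂ (A G.vec) (diagOp G.basis f (B G.vec)) = ∑ i, f i * G.weight A B i := by
  rw [← G.basis.sum_inner_mul_inner]
  refine Finset.sum_congr rfl fun i _ => ?_
  rw [inner_basis_diagOp, weight]
  ring

variable [CompleteSpace E]

lemma star_resolvent : star G.resolvent = G.resolvent := by
  rw [resolvent, star_diagOp]
  congr 1
  ext i
  simp

lemma star_proj : star G.proj = G.proj := by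
  rw [proj, star_diagOp, ← Pi.single_star, star_one]

lemma exp_smul_eq (z : ℂ) :
    NormedSpace.exp (z • H) = diagOp G.basis fun i => exp (z * G.energy i) := by
  have : z • H = diagOp G.basis fun i => z * G.energy i :=
    clm_ext_basis G.basis fun i => by
      rw [diagOp_basis, smul_apply, G.apply_basis, smul_smul]
  rw [this, exp_diagOp]

/-- The expectation of the commutator `[A(t), B]` in the ground state, as a sum over excitations. -/
lemma inner_commutator_eq_sum {A B : E →L[ℂ] E} (hA : IsSelfAdjoint A) (hB : IsSelfAdjoint B)
    (t : ℝ) :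
    inner ℂ G.vec ((NormedSpace.exp ((I * (t : ℂ)) • H) * A * NormedSpace.exp ((-(I * (t : ℂ))) • H)
        * B - B * (NormedSpace.exp ((I * (t : ℂ)) • H) * A *
          NormedSpace.exp ((-(I * (t : ℂ))) • H))) G.vec) =
      ∑ i, (G.weight A B i * exp (-(I * G.freq i * t)) -
        (starRingEnd ℂ) (G.weight A B i) * exp (I * G.freq i * t)) := by
  have hexp : ∀ z : ℂ, ∀ x : E, NormedSpace.exp (z • H) x =
      diagOp G.basis (fun i => exp (z * G.energy i)) x := fun z x => by rw [G.exp_smul_eq]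
  have hstar : ∀ x : E, inner ℂ G.vec (NormedSpace.exp ((I * (t : ℂ)) • H) x) =
      exp (I * t * G.energy G.ground) * inner ℂ G.vec x := by
    intro x
    rw [hexp, vec, inner_basis_diagOp]
  have hvec : NormedSpace.exp ((-(I * (t : ℂ))) • H) G.vec =
      exp (-(I * t) * G.energy G.ground) • G.vec := by
    rw [hexp, vec, diagOp_basis]
  have hA' : ∀ x, inner ℂ G.vec (A x) = inner ℂ (A G.vec) x := fun x => by
    rw [← ContinuousLinearMap.adjoint_inner_left, ← ContinuousLinearMap.star_eq_adjoint,
      hA.star_eq]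
  have hB' : ∀ x, inner ℂ G.vec (B x) = inner ℂ (B G.vec) x := fun x => by
    rw [← ContinuousLinearMap.adjoint_inner_left, ← ContinuousLinearMap.star_eq_adjoint,
      hB.star_eq]
  rw [sub_apply, inner_sub_right, Finset.sum_sub_distrib]
  simp only [mul_apply_eq_comp]
  congr 1
  · rw [hstar, hA', hexp, inner_diagOp_eq_sum, Finset.mul_sum]
    refine Finset.sum_congr rfl fun i _ => ?_
    rw [← mul_assoc, ← exp_add, mul_comm]
    congr 2
    rw [freq]
    push_cast
    ring
  · rw [hvec, map_smul, map_smul, map_smul, inner_smul_right, hB', hexp, inner_diagOp_eq_sum,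
      Finset.mul_sum]
    refine Finset.sum_congr rfl fun i _ => ?_
    rw [← mul_assoc, ← exp_add, mul_comm, weight_swap]
    congr 2
    rw [freq]
    push_cast
    ring

/-- The curvature form `-2 Im ⟨A (H - E)⁻² B⟩` of a pair of observables. -/
def curvForm (A B : E →L[ℂ] E) : ℝ :=
  -2 * (inner ℂ (G.resolvent (A G.vec)) (G.resolvent (B G.vec))).im

lemma inner_resolvent_resolvent (A B : E →L[ℂ] E) :
    inner ℂ (G.resolvent (A G.vec)) (G.resolvent (B G.vec)) =
      ∑ i, G.weight A B i / (G.freq i : ℂ) ^ 2 := by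
  rw [← ContinuousLinearMap.adjoint_inner_right, ← ContinuousLinearMap.star_eq_adjoint,
    star_resolvent, ← mul_apply_eq_comp, resolvent, diagOp_mul, inner_diagOp_eq_sum]
  refine Finset.sum_congr rfl fun i _ => ?_
  simp only [Pi.mul_apply, ofReal_inv]
  rw [div_eq_mul_inv, pow_two, mul_inv, mul_comm]

lemma weight_ground_real {A B : E →L[ℂ] E} (hA : IsSelfAdjoint A)
    (hB : IsSelfAdjoint B) :
    (starRingEnd ℂ) (G.weight A B G.ground) = G.weight A B G.ground := by
  have hA' : inner ℂ (A G.vec) G.vec = inner ℂ G.vec (A G.vec) := by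
    rw [← ContinuousLinearMap.adjoint_inner_right, ← ContinuousLinearMap.star_eq_adjoint,
      hA.star_eq]
  have hB' : inner ℂ (B G.vec) G.vec = inner ℂ G.vec (B G.vec) := by
    rw [← ContinuousLinearMap.adjoint_inner_right, ← ContinuousLinearMap.star_eq_adjoint,
      hB.star_eq]
  rw [weight, map_mul, inner_conj_symm, inner_conj_symm, ← vec, hA', hB']

end SpectralGap

/-- If the commutator of `A(t)` and `B` grows at most polynomially in time, with a prefactor `K`,
then the curvature form of `A` and `B` is bounded by `K`, up to a constant that depends only on the
gap and on the power. -/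
lemma exists_abs_curvForm_le {g : ℝ} (hg : 0 < g) (p : ℕ) :
    ∃ M : ℝ, 0 ≤ M ∧ ∀ {E : Type} [NormedAddCommGroup E] [InnerProductSpace ℂ E] [CompleteSpace E]
      {H A B : E →L[ℂ] E} (G : SpectralGap H g), IsSelfAdjoint A → IsSelfAdjoint B →
      ∀ K : ℝ, 0 ≤ K →
      (∀ t : ℝ, ‖NormedSpace.exp ((I * (t : ℂ)) • H) * A * NormedSpace.exp ((-(I * (t : ℂ))) • H)
        * B - B * (NormedSpace.exp ((I * (t : ℂ)) • H) * A *
          NormedSpace.exp ((-(I * (t : ℂ))) • H))‖ ≤ K * (1 + |t|) ^ p) →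
      |G.curvForm A B| ≤ M * K := by
  obtain ⟨M, hM, h⟩ := exists_norm_sum_div_sq_le hg p
  refine ⟨M, hM, ?_⟩
  intro E _ _ _ H A B G hA hB K hK hb
  let ι := {i : Fin (Module.finrank ℂ E) // i ≠ G.ground}
  let a : ι ⊕ ι → ℂ := Sum.elim (fun i => G.weight A B i) fun i => -(starRingEnd ℂ) (G.weight A B i)
  let ω : ι ⊕ ι → ℝ := Sum.elim (fun i => G.freq i) fun i => -G.freq i
  have key : ∀ F : Fin (Module.finrank ℂ E) → ℂ, F G.ground = 0 → ∑ i, F i = ∑ i : ι, F i := by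
    intro F hF
    have h1 := Fintype.sum_subtype_add_sum_subtype (fun i => i ≠ G.ground) F
    rw [← h1]
    have h2 : ∑ i : {i // ¬ i ≠ G.ground}, F i = 0 := by
      refine Finset.sum_eq_zero fun i _ => ?_
      rw [not_not.mp i.2, hF]
    rw [h2, add_zero]
  have h1 := h a ω ?_ K hK ?_
  · have h2 : ((G.curvForm A B : ℝ) : ℂ) = I * ∑ i, a i / (ω i : ℂ) ^ 2 := by
      rw [Fintype.sum_sum_type, SpectralGap.curvForm]
      have h3 := G.inner_resolvent_resolvent A B
      rw [key _ (by rw [G.freq_ground]; simp)] at h3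
      have h4 := congrArg (starRingEnd ℂ) h3
      rw [map_sum] at h4
      have h5 := sub_conj (inner ℂ (G.resolvent (A G.vec)) (G.resolvent (B G.vec)))
      rw [h4, h3] at h5
      rw [h3]
      have h6 : ∑ i : ι, a (Sum.inl i) / (ω (Sum.inl i) : ℂ) ^ 2 +
          ∑ i : ι, a (Sum.inr i) / (ω (Sum.inr i) : ℂ) ^ 2 =
          ((2 * (∑ i : ι, G.weight A B i / (G.freq i : ℂ) ^ 2).im : ℝ) : ℂ) * I := by
        rw [← h5, sub_eq_add_neg, ← Finset.sum_neg_distrib]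
        congr 1
        refine Finset.sum_congr rfl fun i _ => ?_
        simp [a, ω, neg_div]
      rw [h6, mul_comm _ I, ← mul_assoc, I_mul_I]
      push_cast
      ring
    have h7 : |G.curvForm A B| = ‖∑ i, a i / (ω i : ℂ) ^ 2‖ := by
      rw [← Real.norm_eq_abs, ← norm_real, h2, norm_mul, norm_I, one_mul]
    rw [h7]
    exact h1
  · rintro (i | i)
    · exact (G.le_freq i.2).trans (le_abs_self _)
    · change g ≤ |-G.freq i|
      rw [abs_neg]
      exact (G.le_freq i.2).trans (le_abs_self _)
  · intro t
    have h2 := G.inner_commutator_eq_sum hA hB t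
    rw [key _ ?_] at h2
    · have h3 : ∑ i, a i * exp (-(I * ω i * t)) =
          ∑ i : ι, (G.weight A B i * exp (-(I * G.freq i * t)) -
            (starRingEnd ℂ) (G.weight A B i) * exp (I * G.freq i * t)) := by
        rw [Fintype.sum_sum_type, ← Finset.sum_add_distrib]
        refine Finset.sum_congr rfl fun i _ => ?_
        simp [a, ω, sub_eq_add_neg]
      rw [h3, ← h2]
      refine (norm_inner_le_norm _ _).trans ?_
      rw [G.norm_vec, one_mul]
      refine (ContinuousLinearMap.le_opNorm _ _).trans ?_
      rw [G.norm_vec, mul_one]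
      exact hb t
    · rw [G.freq_ground, G.weight_ground_real hA hB]
      simp

end Spectral

/-! ### Perturbation theory for the ground state projection -/

section Perturbation

open Complex

variable {E : Type*} [NormedAddCommGroup E] [InnerProductSpace ℂ E] [CompleteSpace E]

namespace SpectralGap

variable {H : E →L[ℂ] E} {g : ℝ} (G : SpectralGap H g)

/-- First order perturbation theory: if `P'` is a projection onto an eigenspace of `H'` whose
eigenvalue is close to the ground state energy of `H`, then it agrees with the ground state
projection of `H`, up to the first order term and a quadratic error. -/
lemma norm_proj_sub_le {H' P' : E →L[ℂ] E} {e : ℝ} (hH : IsSelfAdjoint H)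
    (hH' : IsSelfAdjoint H') (hP1 : P' * P' = P') (hP2 : star P' = P')
    (hP3 : H' * P' = (e : ℂ) • P') (he : |e - G.energy G.ground| ≤ ‖H' - H‖)
    {x : E} (hx : ‖x‖ = 1) (hPx : P' x = x) :
    ‖P' - G.proj + (G.resolvent * (H' - H) * G.proj + G.proj * (H' - H) * G.resolvent)‖ ≤
      (16 / g ^ 2 + 8 / g ^ 3 * ‖H' - H‖) * ‖H' - H‖ ^ 2 := by
  have hg := G.gap_pos
  set V := H' - H with hV
  set S := G.resolvent with hS
  set P := G.proj with hP
  set δ := ‖V‖ with hδ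
  have hδ0 : 0 ≤ δ := norm_nonneg _
  set d : ℂ := ((e - G.energy G.ground : ℝ) : ℂ) with hd
  have hdn : ‖d‖ ≤ δ := by rw [hd, norm_real]; exact he
  have hSn : ‖S‖ ≤ g⁻¹ := G.norm_resolvent_le
  have hPn : ‖P‖ ≤ 1 := G.norm_proj_le
  have hP'n : ‖P'‖ ≤ 1 := by
    have h1 : ‖P'‖ * ‖P'‖ = ‖P'‖ := by
      rw [← norm_adjoint_mul_self, hP2, hP1]
    nlinarith [norm_nonneg P']
  have hP'1 : ∀ y : E, ‖P' y‖ ≤ ‖y‖ := fun y => by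
    have := P'.le_opNorm y
    nlinarith [norm_nonneg y]
  -- the component of `P'` outside the ground state of `H`
  set X := (1 - P) * P' with hX
  have hX1 : X = S * (d • P' - V * P') := by
    have h1 : (H - (G.energy G.ground : ℂ) • (1 : E →L[ℂ] E)) * P' = d • P' - V * P' := by
      rw [hV, sub_mul, sub_mul, hP3, smul_mul_assoc, one_mul, hd, ofReal_sub, sub_smul]
      abel
    rw [hX, hP, ← G.resolvent_mul, mul_assoc, h1]
  have hXn : ‖X‖ ≤ 2 * δ / g := by
    rw [hX1]
    calc ‖S * (d • P' - V * P')‖ ≤ ‖S‖ * ‖d • P' - V * P'‖ := norm_mul_le _ _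
      _ ≤ g⁻¹ * (δ * 1 + δ * 1) := by
        gcongr
        refine (norm_sub_le _ _).trans (add_le_add ?_ ?_)
        · rw [norm_smul]; gcongr
        · exact (norm_mul_le _ _).trans (by gcongr)
      _ = _ := by ring
  set τ : ℂ := inner ℂ G.vec (P' G.vec) with hτ
  have hPP : P * P' * P = τ • P := G.proj_mul_mul_proj P'
  -- the ground states of `H` and `H'` have overlap one up to second order
  have hτn : ‖τ - 1‖ ≤ (2 * δ / g) ^ 2 := by
    have h1 : τ = ((‖P' G.vec‖ ^ 2 : ℝ) : ℂ) := by
      have : P' G.vec = P' (P' G.vec) := by rw [← mul_apply_eq_comp, hP1]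
      rw [hτ, this, ← ContinuousLinearMap.adjoint_inner_left, ← ContinuousLinearMap.star_eq_adjoint,
        hP2, ← this, inner_self_eq_norm_sq_to_K]
      norm_cast
    have h2 : ‖P' G.vec‖ ≤ 1 := (hP'1 _).trans G.norm_vec.le
    have h3 : ‖inner ℂ G.vec x‖ ≤ ‖P' G.vec‖ := by
      have : inner ℂ G.vec x = inner ℂ (P' G.vec) x := by
        conv_lhs => rw [← hPx]
        rw [← ContinuousLinearMap.adjoint_inner_left, ← ContinuousLinearMap.star_eq_adjoint, hP2]
      rw [this]
      refine (norm_inner_le_norm _ _).trans ?_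
      rw [hx, mul_one]
    have h4 : ‖x - P x‖ ^ 2 = 1 - ‖inner ℂ G.vec x‖ ^ 2 := by
      rw [@norm_sub_sq ℂ, hP, G.proj_apply, hx, norm_smul, G.norm_vec, inner_smul_right,
        ← inner_conj_symm x G.vec, mul_conj']
      simp only [RCLike.re_to_complex]
      rw [← ofReal_pow, ofReal_re]
      ring
    have h5 : ‖x - P x‖ ≤ 2 * δ / g := by
      have : x - P x = X x := by simp [hX, hPx]
      rw [this]
      refine (X.le_opNorm x).trans ?_
      rw [hx, mul_one]
      exact hXn
    have h6 : ‖x - P x‖ ^ 2 ≤ (2 * δ / g) ^ 2 := by gcongr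
    have h7 : ‖inner ℂ G.vec x‖ ^ 2 ≤ ‖P' G.vec‖ ^ 2 := by gcongr
    rw [h1, ← ofReal_one, ← ofReal_sub, norm_real, Real.norm_eq_abs, abs_le]
    constructor
    · nlinarith
    · nlinarith [norm_nonneg (P' G.vec), sq_nonneg (2 * δ / g)]
  set Y := (1 - P) * P' * P with hY
  have hSQ : S * P' = S * X := by
    rw [hX, ← mul_assoc, mul_sub, mul_one, hS, hP, G.resolvent_mul_proj, sub_zero]
  have hYe : Y + S * V * P = d • (S * X * P) - (τ - 1) • (S * V * P) - S * V * (X * P) := by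
    have h1 : P' * P = τ • P + X * P := by
      rw [← hPP, hX]
      noncomm_ring
    have h2 : Y = d • (S * X * P) - S * V * (P' * P) := by
      have h3 : X = d • (S * X) - S * V * P' := by
        rw [← hSQ, mul_assoc, ← mul_smul_comm, ← mul_sub, ← hX1]
      calc Y = X * P := rfl
        _ = (d • (S * X) - S * V * P') * P := by rw [← h3]
        _ = _ := by rw [sub_mul, smul_mul_assoc, mul_assoc (S * V)]
    rw [h2, h1, mul_add, mul_smul_comm, sub_smul, one_smul]
    abel
  have hYn : ‖Y + S * V * P‖ ≤ 4 * δ ^ 2 / g ^ 2 + 4 * δ ^ 3 / g ^ 3 := by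
    have h1 : ‖S * X * P‖ ≤ g⁻¹ * (2 * δ / g) * 1 :=
      (norm_mul_le _ _).trans (mul_le_mul ((norm_mul_le _ _).trans (by gcongr)) hPn
        (norm_nonneg _) (by positivity))
    have h2 : ‖S * V * P‖ ≤ g⁻¹ * δ * 1 :=
      (norm_mul_le _ _).trans (mul_le_mul ((norm_mul_le _ _).trans (by gcongr)) hPn
        (norm_nonneg _) (by positivity))
    have h3 : ‖S * V * (X * P)‖ ≤ g⁻¹ * δ * ((2 * δ / g) * 1) :=
      (norm_mul_le _ _).trans (mul_le_mul ((norm_mul_le _ _).trans (by gcongr))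
        ((norm_mul_le _ _).trans (by gcongr)) (norm_nonneg _) (by positivity))
    rw [hYe]
    calc _ ≤ ‖d‖ * ‖S * X * P‖ + ‖τ - 1‖ * ‖S * V * P‖ + ‖S * V * (X * P)‖ := by
          refine (norm_sub_le _ _).trans (add_le_add_left ((norm_sub_le _ _).trans ?_) _)
          rw [norm_smul, norm_smul]
      _ ≤ δ * (g⁻¹ * (2 * δ / g) * 1) + (2 * δ / g) ^ 2 * (g⁻¹ * δ * 1) +
          g⁻¹ * δ * ((2 * δ / g) * 1) := by gcongr
      _ = _ := by field_simp; ring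
  have hYs : star (Y + S * V * P) = P * P' * (1 - P) + P * star V * S := by
    rw [star_add, hY, star_mul, star_mul, star_mul, star_mul, star_sub, hP2, hP, G.star_proj,
      hS, G.star_resolvent, star_one]
    noncomm_ring
  have hVs : star V = V := by rw [hV, star_sub, hH.star_eq, hH'.star_eq]
  have hfin : P' - P + (S * V * P + P * V * S) =
      (τ - 1) • P + (Y + S * V * P) + star (Y + S * V * P) + X * star X := by
    have h1 : X * star X = (1 - P) * P' * (1 - P) := by
      rw [hX, star_mul, star_sub, star_one, hP2, hP, G.star_proj]
      calc _ = (1 - G.proj) * (P' * P') * (1 - G.proj) := by noncomm_ring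
        _ = _ := by rw [hP1]
    rw [hYs, h1, hVs, sub_smul, one_smul, ← hPP, hY]
    noncomm_ring
  rw [hfin]
  have h2 : ‖X * star X‖ ≤ (2 * δ / g) * (2 * δ / g) := by
    refine (norm_mul_le _ _).trans ?_
    rw [norm_star]
    gcongr
  have h3 : ‖star (Y + S * V * P)‖ ≤ 4 * δ ^ 2 / g ^ 2 + 4 * δ ^ 3 / g ^ 3 := by
    rw [norm_star]; exact hYn
  have h4 : ‖(τ - 1) • P‖ ≤ (2 * δ / g) ^ 2 * 1 := by
    rw [norm_smul]; gcongr
  calc _ ≤ ‖(τ - 1) • P‖ + ‖Y + S * V * P‖ + ‖star (Y + S * V * P)‖ + ‖X * star X‖ :=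
        (norm_add_le _ _).trans (add_le_add_left ((norm_add_le _ _).trans
          (add_le_add_left (norm_add_le _ _) _)) _)
    _ ≤ (2 * δ / g) ^ 2 * 1 + (4 * δ ^ 2 / g ^ 2 + 4 * δ ^ 3 / g ^ 3) +
        (4 * δ ^ 2 / g ^ 2 + 4 * δ ^ 3 / g ^ 3) + (2 * δ / g) * (2 * δ / g) := by gcongr
    _ = _ := by field_simp; ring

/-- The ground state projection is differentiable along differentiable perturbations. -/
lemma hasDerivAt_proj {Hs Ps : ℝ → E →L[ℂ] E} {H₁ : E →L[ℂ] E} (h0 : Hs 0 = H)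
    (hP0 : Ps 0 = G.proj) (hd : HasDerivAt Hs H₁ 0) (hH : ∀ s, IsSelfAdjoint (Hs s))
    (hP1 : ∀ s, Ps s * Ps s = Ps s) (hP2 : ∀ s, star (Ps s) = Ps s)
    (hP3 : ∀ s, ∃ e : ℝ, Hs s * Ps s = (e : ℂ) • Ps s ∧
      |e - G.energy G.ground| ≤ ‖Hs s - H‖ ∧ ∃ x, ‖x‖ = 1 ∧ Ps s x = x) :
    HasDerivAt Ps (-(G.resolvent * H₁ * G.proj + G.proj * H₁ * G.resolvent)) 0 := by
  have hH0 : IsSelfAdjoint H := h0 ▸ hH 0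
  rw [hasDerivAt_iff_isLittleO_nhds_zero] at hd ⊢
  simp only [zero_add, h0, hP0] at hd ⊢
  -- the linear response of the projection
  let ℓ : (E →L[ℂ] E) →L[ℝ] (E →L[ℂ] E) :=
    ((ContinuousLinearMap.mul ℝ (E →L[ℂ] E)).flip G.proj).comp
        (ContinuousLinearMap.mul ℝ (E →L[ℂ] E) G.resolvent) +
      ((ContinuousLinearMap.mul ℝ (E →L[ℂ] E)).flip G.resolvent).comp
        (ContinuousLinearMap.mul ℝ (E →L[ℂ] E) G.proj)
  have hℓ : ∀ A, ℓ A = G.resolvent * A * G.proj + G.proj * A * G.resolvent := fun A => rfl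
  have h1 : (fun s : ℝ => ℓ (Hs s - H - s • H₁)) =o[nhds 0] fun s => s :=
    (ℓ.isBigO_comp _ _).trans_isLittleO hd
  have hO : (fun s : ℝ => Hs s - H) =O[nhds 0] fun s => s := by
    have h2 : (fun s : ℝ => s • H₁) =O[nhds 0] fun s => s := by
      refine Asymptotics.IsBigO.of_bound ‖H₁‖ (Filter.Eventually.of_forall fun s => ?_)
      rw [norm_smul, mul_comm]
    have := hd.isBigO.add h2
    simpa using this
  have h2 : (fun s : ℝ => Ps s - G.proj + ℓ (Hs s - H)) =o[nhds 0] fun s => s := by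
    have hO2 : (fun s : ℝ => (16 / g ^ 2 + 8 / g ^ 3 * ‖Hs s - H‖) * ‖Hs s - H‖ ^ 2) =o[nhds 0]
        fun s => s := by
      have h3 : (fun s : ℝ => 16 / g ^ 2 + 8 / g ^ 3 * ‖Hs s - H‖) =O[nhds 0]
          fun _ => (1 : ℝ) := by
        have h4 : (fun s : ℝ => ‖Hs s - H‖) =O[nhds 0] fun _ => (1 : ℝ) :=
          (hO.trans (Filter.tendsto_id.isBigO_one ℝ)).norm_left
        exact (Asymptotics.isBigO_const_const _ one_ne_zero _).add (h4.const_mul_left _)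
      have h5 : (fun s : ℝ => ‖Hs s - H‖ ^ 2) =o[nhds 0] fun s => s := by
        refine (hO.norm_left.pow 2).trans_isLittleO ?_
        simpa using Asymptotics.isLittleO_pow_id (𝕜 := ℝ) one_lt_two
      simpa using h3.mul_isLittleO h5
    refine (Asymptotics.IsBigO.of_bound 1 (Filter.Eventually.of_forall fun s => ?_)).trans_isLittleO
      hO2
    obtain ⟨e, he1, he2, x, hx1, hx2⟩ := hP3 s
    have h6 := G.norm_proj_sub_le hH0 (hH s) (hP1 s) (hP2 s) he1 he2 hx1 hx2
    rw [one_mul, Real.norm_eq_abs, hℓ]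
    exact h6.trans (le_abs_self _)
  refine (h2.sub h1).congr_left fun s => ?_
  rw [map_sub ℓ (Hs s - H), map_smul, hℓ H₁, smul_neg]
  abel

/-! ### The zero-frequency response -/

/-- The contribution of a single excitation to the regularized response integral. -/
lemma weight_integrand (z : ℂ) (ω ε : ℝ) (hε : 0 < ε) :
    MeasureTheory.IntegrableOn
        (fun t : ℝ => (z * exp (I * ω * t) - (starRingEnd ℂ) z * exp (-(I * ω * t))) *
          (Real.exp (-(ε * t)) : ℂ)) (Set.Ioi 0) ∧
      ∫ t in Set.Ioi (0 : ℝ), (z * exp (I * ω * t) - (starRingEnd ℂ) z * exp (-(I * ω * t))) *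
          (Real.exp (-(ε * t)) : ℂ) =
        z / (ε - I * ω) - (starRingEnd ℂ) z / (ε + I * ω) := by
  have h1 : ((I * ω - ε : ℂ)).re < 0 := by simp [hε]
  have h2 : ((-(I * ω) - ε : ℂ)).re < 0 := by simp [hε]
  have e : (fun t : ℝ => (z * exp (I * ω * t) - (starRingEnd ℂ) z * exp (-(I * ω * t))) *
      (Real.exp (-(ε * t)) : ℂ)) = fun t : ℝ => z * exp ((I * ω - ε) * t) -
        (starRingEnd ℂ) z * exp ((-(I * ω) - ε) * t) := by
    funext t
    have e1 : exp ((I * ω - ε) * t) = exp (I * ω * t) * (Real.exp (-(ε * t)) : ℂ) := by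
      rw [ofReal_exp, ← exp_add]; congr 1; push_cast; ring
    have e2 : exp ((-(I * ω) - ε) * t) = exp (-(I * ω * t)) * (Real.exp (-(ε * t)) : ℂ) := by
      rw [ofReal_exp, ← exp_add]; congr 1; push_cast; ring
    rw [e1, e2]
    ring
  have i1 := (integrableOn_exp_mul_complex_Ioi h1 0).const_mul z
  have i2 := (integrableOn_exp_mul_complex_Ioi h2 0).const_mul ((starRingEnd ℂ) z)
  rw [e]
  refine ⟨i1.sub i2, ?_⟩
  rw [MeasureTheory.integral_sub i1 i2, MeasureTheory.integral_const_mul,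
    MeasureTheory.integral_const_mul, integral_exp_mul_complex_Ioi h1,
    integral_exp_mul_complex_Ioi h2]
  have e3 : (ε - I * ω : ℂ) = -(I * ω - ε) := by ring
  have e4 : (ε + I * ω : ℂ) = -(-(I * ω) - ε) := by ring
  rw [e3, e4, ofReal_zero, mul_zero, mul_zero, exp_zero, div_neg, div_neg]
  ring

/-- The zero-frequency response of `B` to the perturbation `A` exists, and it is the static
susceptibility. -/
lemma kubo_limit {A B : E →L[ℂ] E} (hA : IsSelfAdjoint A) (hB : IsSelfAdjoint B) {c : ℝ → ℂ}
    (hc : ∀ t, c t = ∑ i, (G.weight A B i * exp (I * G.freq i * t) -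
        (starRingEnd ℂ) (G.weight A B i) * exp (-(I * G.freq i * t)))) :
    (∀ ε : ℝ, 0 < ε → MeasureTheory.IntegrableOn (fun t : ℝ => c t * (Real.exp (-(ε * t)) : ℂ))
        (Set.Ioi 0)) ∧
      Filter.Tendsto
        (fun ε : ℝ => I * ∫ t in Set.Ioi (0 : ℝ), c t * (Real.exp (-(ε * t)) : ℂ))
        (nhdsWithin 0 (Set.Ioi 0))
        (nhds ((-2 * (inner ℂ (A G.vec) (G.resolvent (B G.vec))).re : ℝ) : ℂ)) := by
  have hc' : ∀ ε : ℝ, (fun t : ℝ => c t * (Real.exp (-(ε * t)) : ℂ)) = fun t : ℝ =>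
      ∑ i, (G.weight A B i * exp (I * G.freq i * t) -
        (starRingEnd ℂ) (G.weight A B i) * exp (-(I * G.freq i * t))) *
          (Real.exp (-(ε * t)) : ℂ) := by
    intro ε
    funext t
    rw [hc, Finset.sum_mul]
  constructor
  · intro ε hε
    rw [hc']
    exact MeasureTheory.integrable_finsetSum _ fun i _ => (weight_integrand _ _ ε hε).1
  · have hint : ∀ ε : ℝ, 0 < ε →
        I * ∑ i, (G.weight A B i / (ε - I * G.freq i) -
          (starRingEnd ℂ) (G.weight A B i) / (ε + I * G.freq i)) =
        I * ∫ t in Set.Ioi (0 : ℝ), c t * (Real.exp (-(ε * t)) : ℂ) := by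
      intro ε hε
      rw [hc', MeasureTheory.integral_finsetSum _ fun i _ => (weight_integrand _ _ ε hε).1]
      congr 1
      exact Finset.sum_congr rfl fun i _ => (weight_integrand _ _ ε hε).2.symm
    have hev : ∀ᶠ ε : ℝ in nhdsWithin 0 (Set.Ioi 0),
        I * ∑ i, (G.weight A B i / (ε - I * G.freq i) -
          (starRingEnd ℂ) (G.weight A B i) / (ε + I * G.freq i)) =
        I * ∫ t in Set.Ioi (0 : ℝ), c t * (Real.exp (-(ε * t)) : ℂ) := by
      filter_upwards [self_mem_nhdsWithin] with ε hε
      exact hint ε hε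
    refine Filter.Tendsto.congr' hev ?_
    have hlim : ((-2 * (inner ℂ (A G.vec) (G.resolvent (B G.vec))).re : ℝ) : ℂ) =
        I * ∑ i, (I * (G.weight A B i + (starRingEnd ℂ) (G.weight A B i)) *
          ((G.freq i)⁻¹ : ℝ)) := by
      have h1 : inner ℂ (A G.vec) (G.resolvent (B G.vec)) =
          ∑ i, (((G.freq i)⁻¹ : ℝ) : ℂ) * G.weight A B i := by
        rw [resolvent, inner_diagOp_eq_sum]
      have h2 := add_conj (inner ℂ (A G.vec) (G.resolvent (B G.vec)))
      rw [ofReal_mul, ofReal_neg, neg_mul, ofReal_ofNat]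
      rw [ofReal_mul, ofReal_ofNat] at h2
      rw [← h2, h1, map_sum, ← Finset.sum_add_distrib, ← Finset.sum_neg_distrib, Finset.mul_sum]
      refine Finset.sum_congr rfl fun i _ => ?_
      rw [map_mul, conj_ofReal]
      linear_combination (-(G.weight A B i + (starRingEnd ℂ) (G.weight A B i)) *
          ((G.freq i)⁻¹ : ℝ)) * I_sq
    rw [hlim]
    refine Filter.Tendsto.const_mul I (tendsto_finsetSum _ fun i _ => ?_)
    by_cases hi : i = G.ground
    · subst hi
      rw [G.freq_ground, G.weight_ground_real hA hB]
      simp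
    · have h0 : (G.freq i : ℂ) ≠ 0 := by exact_mod_cast (G.freq_pos hi).ne'
      have hcont : ContinuousAt (fun ε : ℝ => G.weight A B i / (ε - I * G.freq i) -
          (starRingEnd ℂ) (G.weight A B i) / (ε + I * G.freq i)) 0 := by
        refine ContinuousAt.sub (ContinuousAt.div (by fun_prop) (by fun_prop) ?_)
          (ContinuousAt.div (by fun_prop) (by fun_prop) ?_)
        · simp [h0]
        · simp [h0]
      have h3 := hcont.tendsto.mono_left (nhdsWithin_le_nhds (s := Set.Ioi (0 : ℝ)))
      convert h3 using 2
      rw [ofReal_zero, zero_sub, zero_add, ofReal_inv]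
      field_simp
      linear_combination (G.weight A B i + (starRingEnd ℂ) (G.weight A B i)) * I_sq

end SpectralGap

end Perturbation

/-! ### The Lieb-Robinson bound -/

section LiebRobinson

open Complex
open scoped Nat

variable {E : Type*} [NormedAddCommGroup E] [InnerProductSpace ℂ E] [CompleteSpace E]

/-- Heisenberg evolution `exp (i t H) O exp (-i t H)` on a general Hilbert space. -/
def heis (H O : E →L[ℂ] E) (t : ℝ) : E →L[ℂ] E :=
  NormedSpace.exp ((I * (t : ℂ)) • H) * O * NormedSpace.exp ((-(I * (t : ℂ))) • H)

lemma exp_I_smul_mem_unitary {H : E →L[ℂ] E} (hH : IsSelfAdjoint H) (t : ℝ) :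
    NormedSpace.exp ((I * (t : ℂ)) • H) ∈ unitary (E →L[ℂ] E) := by
  let _ : NormedAlgebra ℚ (E →L[ℂ] E) := NormedAlgebra.restrictScalars ℚ ℂ _
  apply NormedSpace.exp_mem_unitary_of_mem_skewAdjoint
  rw [skewAdjoint.mem_iff, star_smul, hH.star_eq, ← neg_smul]
  congr 1
  simp

lemma star_exp_I_smul {H : E →L[ℂ] E} (hH : IsSelfAdjoint H) (t : ℝ) :
    star (NormedSpace.exp ((I * (t : ℂ)) • H)) = NormedSpace.exp ((-(I * (t : ℂ))) • H) := by
  rw [NormedSpace.star_exp, star_smul, hH.star_eq]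
  congr 2
  simp

lemma exp_mul_exp_neg {H : E →L[ℂ] E} (hH : IsSelfAdjoint H) (t : ℝ) :
    NormedSpace.exp ((I * (t : ℂ)) • H) * NormedSpace.exp ((-(I * (t : ℂ))) • H) = 1 := by
  rw [← star_exp_I_smul hH]
  exact (exp_I_smul_mem_unitary hH t).2

lemma exp_neg_mul_exp {H : E →L[ℂ] E} (hH : IsSelfAdjoint H) (t : ℝ) :
    NormedSpace.exp ((-(I * (t : ℂ))) • H) * NormedSpace.exp ((I * (t : ℂ)) • H) = 1 := by
  rw [← star_exp_I_smul hH]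
  exact (exp_I_smul_mem_unitary hH t).1

lemma norm_heis {H : E →L[ℂ] E} (hH : IsSelfAdjoint H) (O : E →L[ℂ] E) (t : ℝ) :
    ‖heis H O t‖ = ‖O‖ := by
  rw [heis, ← star_exp_I_smul hH]
  have hU := exp_I_smul_mem_unitary hH t
  have h1 := CStarRing.norm_mul_coe_unitary (NormedSpace.exp ((I * (t : ℂ)) • H) * O)
    (star ⟨_, hU⟩)
  have h2 := CStarRing.norm_coe_unitary_mul ⟨_, hU⟩ O
  exact h1.trans h2

lemma heis_zero (H O : E →L[ℂ] E) : heis H O 0 = O := by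
  simp [heis]

lemma heis_mul {H : E →L[ℂ] E} (hH : IsSelfAdjoint H) (O O' : E →L[ℂ] E) (t : ℝ) :
    heis H (O * O') t = heis H O t * heis H O' t := by
  simp only [heis]
  calc _ = NormedSpace.exp ((I * (t : ℂ)) • H) * O * 1 * O' *
        NormedSpace.exp ((-(I * (t : ℂ))) • H) := by noncomm_ring
    _ = _ := by rw [← exp_neg_mul_exp hH t]; noncomm_ring

lemma heis_sub (H O O' : E →L[ℂ] E) (t : ℝ) :
    heis H (O - O') t = heis H O t - heis H O' t := by
  simp only [heis]; noncomm_ring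

lemma heis_sum {σ : Type*} (s : Finset σ) (H : E →L[ℂ] E) (O : σ → E →L[ℂ] E) (t : ℝ) :
    heis H (∑ w ∈ s, O w) t = ∑ w ∈ s, heis H (O w) t := by
  simp only [heis, Finset.mul_sum, Finset.sum_mul]

lemma heis_neg_heis {H : E →L[ℂ] E} (hH : IsSelfAdjoint H) (O : E →L[ℂ] E) (t : ℝ) :
    heis H (heis H O (-t)) t = O := by
  have h1 := exp_mul_exp_neg hH t
  simp only [heis, ofReal_neg, mul_neg, neg_neg]
  calc _ = (NormedSpace.exp ((I * (t : ℂ)) • H) * NormedSpace.exp ((-(I * (t : ℂ))) • H)) * O *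
        (NormedSpace.exp ((I * (t : ℂ)) • H) * NormedSpace.exp ((-(I * (t : ℂ))) • H)) := by
        noncomm_ring
    _ = O := by rw [h1]; simp

lemma heis_of_commute {H O : E →L[ℂ] E} (hH : IsSelfAdjoint H) (h : Commute O H) (t : ℝ) :
    heis H O t = O := by
  let _ : Algebra ℚ (E →L[ℂ] E) := Algebra.compHom _ (algebraMap ℚ ℂ)
  have h1 : Commute O (NormedSpace.exp ((I * (t : ℂ)) • H)) := (h.smul_right _).exp_right
  rw [heis, ← h1.eq, mul_assoc, exp_mul_exp_neg hH, mul_one]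

/-- The norm of a commutator `[A(t), B]` is symmetric up to reversal of the time. -/
lemma norm_commutator_heis_neg {H : E →L[ℂ] E} (hH : IsSelfAdjoint H) (A B : E →L[ℂ] E) (t : ℝ) :
    ‖heis H A (-t) * B - B * heis H A (-t)‖ = ‖heis H B t * A - A * heis H B t‖ := by
  rw [← norm_heis hH (heis H A (-t) * B - B * heis H A (-t)) t, heis_sub, heis_mul hH,
    heis_mul hH, heis_neg_heis hH, norm_sub_rev]

lemma hasDerivAt_exp_I_smul (H : E →L[ℂ] E) (t : ℝ) :
    HasDerivAt (fun t : ℝ => NormedSpace.exp ((I * (t : ℂ)) • H))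
      (NormedSpace.exp ((I * (t : ℂ)) • H) * (I • H)) t := by
  have h := (hasDerivAt_exp_smul_const (𝕂 := ℝ) (I • H) t)
  have e : ∀ s : ℝ, s • I • H = (I * (s : ℂ)) • H := fun s => by
    rw [mul_comm, mul_smul, Complex.coe_smul]
  simpa only [e] using h

lemma hasDerivAt_heis (H O : E →L[ℂ] E) (t : ℝ) :
    HasDerivAt (heis H O) (I • heis H (H * O - O * H) t) t := by
  have h1 := hasDerivAt_exp_I_smul H t
  have h2 := hasDerivAt_exp_I_smul (-H) t
  have e2 : ∀ s : ℝ, (I * (s : ℂ)) • (-H) = (-(I * (s : ℂ))) • H := fun s => by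
    rw [smul_neg, neg_smul]
  simp only [e2] at h2
  have hc : Commute H (NormedSpace.exp ((-(I * (t : ℂ))) • H)) := by
    let _ : Algebra ℚ (E →L[ℂ] E) := Algebra.compHom _ (algebraMap ℚ ℂ)
    exact ((Commute.refl H).smul_right _).exp_right
  refine ((h1.mul_const O).mul h2).congr_deriv ?_
  simp only [heis, smul_neg, mul_neg, mul_smul_comm, smul_mul_assoc]
  rw [← sub_eq_add_neg, ← smul_sub, ← hc.eq]
  congr 1
  noncomm_ring

/-- Locality of the dynamics in one step: only the part `H - F` of the Hamiltonian that does not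
commute with `A` transports `A` towards `B`. -/
lemma norm_commutator_heis_le {H F A B : E →L[ℂ] E} (hH : IsSelfAdjoint H) (hF : IsSelfAdjoint F)
    (hAF : Commute A F) {β β' : ℝ → ℝ} (hβ0 : 0 ≤ β 0) (hβ : ∀ s, HasDerivAt β (β' s) s) {t : ℝ}
    (ht : 0 ≤ t) (h : ∀ s, 0 ≤ s → ‖heis H (H - F) s * B - B * heis H (H - F) s‖ ≤ β' s) :
    ‖heis H A t * B - B * heis H A t‖ ≤ ‖A * B - B * A‖ + 2 * ‖A‖ * β t := by
  -- `B` in the interaction picture: it moves only because of `H - F`, and the part `F` of the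
  -- dynamics drops out of the commutator with `A`
  let Bs : ℝ → E →L[ℂ] E := fun s => heis F (heis H B (-s)) s
  have hd : ∀ s, HasDerivAt Bs
      (-(I • heis F ((H - F) * heis H B (-s) - heis H B (-s) * (H - F)) s)) s := by
    intro s
    have h1 := hasDerivAt_exp_I_smul F s
    have h2 := hasDerivAt_exp_I_smul (-F) s
    have e2 : ∀ s : ℝ, (I * (s : ℂ)) • (-F) = (-(I * (s : ℂ))) • F := fun s => by
      rw [smul_neg, neg_smul]
    simp only [e2] at h2
    have h3 : HasDerivAt (fun s => heis H B (-s))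
        (-(I • heis H (H * B - B * H) (-s))) s := by
      refine ((hasDerivAt_heis H B (-s)).scomp s (hasDerivAt_neg s)).congr_deriv ?_
      rw [neg_smul, one_smul]
    have hc : Commute F (NormedSpace.exp ((-(I * (s : ℂ))) • F)) := by
      let _ : Algebra ℚ (E →L[ℂ] E) := Algebra.compHom _ (algebraMap ℚ ℂ)
      exact ((Commute.refl F).smul_right _).exp_right
    have hHH : heis H H (-s) = H := heis_of_commute hH (Commute.refl H) _
    refine ((h1.mul h3).mul h2).congr_deriv ?_
    rw [heis_sub, heis_mul hH, heis_mul hH, hHH]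
    simp only [Pi.mul_apply]
    generalize heis H B (-s) = D
    simp only [heis, smul_neg, mul_neg, mul_smul_comm, smul_mul_assoc]
    rw [← hc.eq, add_mul, neg_mul, smul_mul_assoc, smul_mul_assoc, ← smul_neg, ← smul_neg,
      ← smul_neg, ← smul_add, ← smul_add]
    congr 1
    noncomm_ring
  have hbound : ‖Bs t - B‖ ≤ β t := by
    have hB0 : Bs 0 = B := by
      change heis F (heis H B (-0)) 0 = B
      rw [neg_zero, heis_zero, heis_zero]
    refine image_norm_le_of_norm_deriv_right_le_deriv_boundary (a := 0) (b := t)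
      (f := fun s => Bs s - B)
      (fun s _ => ((hd s).sub_const B).continuousAt.continuousWithinAt)
      (fun s _ => ((hd s).sub_const B).hasDerivWithinAt) (by simpa [hB0] using hβ0) hβ ?_
      (Set.right_mem_Icc.mpr ht)
    intro s hs
    rw [norm_neg, norm_smul, norm_I, one_mul, norm_heis hF, ← norm_heis hH _ s, heis_sub,
      heis_mul hH, heis_mul hH, heis_neg_heis hH]
    exact h s hs.1
  have hkey : ‖heis H A t * B - B * heis H A t‖ = ‖A * Bs t - Bs t * A‖ := by
    have h1 := norm_commutator_heis_neg hH B A t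
    rw [← h1, ← norm_heis hF _ t, heis_sub, heis_mul hF, heis_mul hF,
      heis_of_commute hF hAF, norm_sub_rev]
  rw [hkey]
  calc ‖A * Bs t - Bs t * A‖ = ‖(A * B - B * A) + (A * (Bs t - B) - (Bs t - B) * A)‖ := by
        congr 1; noncomm_ring
    _ ≤ ‖A * B - B * A‖ + (‖A‖ * β t + β t * ‖A‖) := by
        refine (norm_add_le _ _).trans (add_le_add_right ((norm_sub_le _ _).trans
          (add_le_add ?_ ?_)) _)
        · exact (norm_mul_le _ _).trans (by gcongr)
        · exact (norm_mul_le _ _).trans (by gcongr)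
    _ = _ := by ring

/-- The Lieb-Robinson bound, for a Hamiltonian that is a sum of bounded local terms `h w` labelled
by the points of a finite metric space. Here `Loc z A` says that `A` is localized near `z`. -/
lemma lieb_robinson {σ : Type*} [Fintype σ] (h : σ → E →L[ℂ] E) (hsa : ∀ w, IsSelfAdjoint (h w))
    {M : ℝ} (hM : ∀ w, ‖h w‖ ≤ M) (d : σ → σ → ℕ) (htri : ∀ x y z, d x z ≤ d x y + d y z)
    (Loc : σ → (E →L[ℂ] E) → Prop) (hLoc : ∀ w, Loc w (h w)) {ρ N : ℕ}
    (hcomm : ∀ z w A B, Loc z A → Loc w B → ρ ≤ d z w → Commute A B)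
    (hN : ∀ z, (Finset.univ.filter fun w => d z w < ρ).card ≤ N) (m : ℕ) :
    ∀ z y A B, Loc z A → Loc y B → ρ * m ≤ d z y → ∀ t : ℝ, 0 ≤ t →
      ‖heis (∑ w, h w) A t * B - B * heis (∑ w, h w) A t‖ ≤
        2 * ‖A‖ * ‖B‖ * ((2 * M * N * t) ^ m / m !) := by
  classical
  have hH : IsSelfAdjoint (∑ w, h w) := isSelfAdjoint_sum _ fun w _ => hsa w
  induction m with
  | zero =>
    intro z y A B _ _ _ t _
    rw [pow_zero, Nat.factorial_zero, Nat.cast_one, div_one, mul_one]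
    refine (norm_sub_le _ _).trans ?_
    have h1 := norm_mul_le (heis (∑ w, h w) A t) B
    have h2 := norm_mul_le B (heis (∑ w, h w) A t)
    rw [norm_heis hH] at h1 h2
    linarith
  | succ m ih =>
    intro z y A B hA hB hd t ht
    have hM0 : 0 ≤ M := (norm_nonneg _).trans (hM z)
    set S := Finset.univ.filter fun w => d z w < ρ with hS
    set F := ∑ w ∈ Sᶜ, h w with hF
    have hHF : ∑ w, h w - F = ∑ w ∈ S, h w := by
      rw [hF, ← Finset.sum_add_sum_compl S]; abel
    have hAF : Commute A F := by
      refine Commute.sum_right _ _ _ fun w hw => hcomm z w A (h w) hA (hLoc w) ?_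
      simpa [hS] using hw
    have hAB : A * B - B * A = 0 := by
      rw [sub_eq_zero]
      exact hcomm z y A B hA hB ((Nat.le_mul_of_pos_right ρ m.succ_pos).trans hd)
    have hder : ∀ s : ℝ, HasDerivAt
        (fun s : ℝ => ‖B‖ * ((2 * M * N * s) ^ (m + 1) / (m + 1)!))
        (‖B‖ * (2 * M * N * ((2 * M * N * s) ^ m / m !))) s := by
      intro s
      have h1 := ((((hasDerivAt_id s).const_mul (2 * M * N)).pow (m + 1)).div_const
        ((m + 1)! : ℝ)).const_mul ‖B‖
      refine h1.congr_deriv ?_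
      rw [Nat.factorial_succ]
      push_cast
      have : (m ! : ℝ) ≠ 0 := by positivity
      have : (m + 1 : ℝ) ≠ 0 := by positivity
      simp only [id, mul_one]
      field_simp
    have h1 := norm_commutator_heis_le (A := A) (B := B) hH (isSelfAdjoint_sum _ fun w _ => hsa w)
      hAF (β := fun s : ℝ => ‖B‖ * ((2 * M * N * s) ^ (m + 1) / (m + 1)!)) (by simp) hder ht ?_
    · rw [hAB, norm_zero, zero_add] at h1
      refine h1.trans (le_of_eq ?_)
      ring
    · intro s hs
      rw [hHF, heis_sum, Finset.sum_mul, Finset.mul_sum, ← Finset.sum_sub_distrib]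
      calc _ ≤ ∑ w ∈ S, 2 * M * ‖B‖ * ((2 * M * N * s) ^ m / m !) := by
            refine norm_sum_le_of_le _ fun w hw => ?_
            refine (ih w y (h w) B (hLoc w) hB ?_ s hs).trans ?_
            · have h2 : d z w < ρ := by simpa [hS] using hw
              have h3 := htri z w y
              rw [Nat.mul_succ] at hd
              omega
            · have := hM w
              gcongr
        _ = S.card * (2 * M * ‖B‖ * ((2 * M * N * s) ^ m / m !)) := by
            rw [Finset.sum_const, nsmul_eq_mul]
        _ ≤ N * (2 * M * ‖B‖ * ((2 * M * N * s) ^ m / m !)) := by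
            have : (S.card : ℝ) ≤ N := by exact_mod_cast hN z
            gcongr
        _ = _ := by ring

/-- The bound `min 1 (x ^ m / m !)` decays in `m` faster than the power `p`, at the cost of a factor
`(1 + x) ^ p`. -/
lemma min_one_pow_div_factorial_le (p m : ℕ) {x y : ℝ} (hx : 0 ≤ x) (hy1 : y ≤ 1)
    (hy2 : y ≤ x ^ m / m !) :
    y ≤ (6 ^ p + 2 * 2 ^ p * p !) * (1 + x) ^ p / (1 + m) ^ p := by
  rw [le_div_iff₀ (by positivity)]
  have he := Real.exp_one_lt_d9
  have he' := Real.exp_one_gt_d9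
  by_cases h : x ≤ m / 6
  · -- here `x ^ m / m !` is exponentially small in `m`
    have h1 : (Real.exp 1 * x) ^ m / m ! ≤ Real.exp (Real.exp 1 * x) :=
      Real.pow_div_factorial_le_exp _ (by positivity) _
    have h2 : Real.exp (Real.exp 1 * x) ≤ Real.exp (m / 2) := by
      apply Real.exp_le_exp.mpr
      nlinarith
    have h3 : x ^ m / m ! * Real.exp m ≤ Real.exp (m / 2) := by
      rw [mul_pow, ← Real.exp_nat_mul, mul_one] at h1
      calc _ = Real.exp m * x ^ m / m ! := by ring
        _ ≤ _ := h1.trans h2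
    have h4 : Real.exp m = Real.exp (m / 2) * Real.exp (m / 2) := by
      rw [← Real.exp_add]; ring_nf
    have h5 : x ^ m / m ! * Real.exp (m / 2) ≤ 1 := by
      rw [h4, ← mul_assoc] at h3
      have := Real.exp_pos ((m : ℝ) / 2)
      nlinarith
    have h6 : ((1 + m : ℝ) / 2) ^ p / p ! ≤ Real.exp ((1 + m) / 2) :=
      Real.pow_div_factorial_le_exp _ (by positivity) _
    have h7 : Real.exp ((1 + m : ℝ) / 2) ≤ 2 * Real.exp (m / 2) := by
      rw [add_div, Real.exp_add]
      gcongr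
      have h8 : Real.exp (1 / 2) * Real.exp (1 / 2) = Real.exp 1 := by
        rw [← Real.exp_add]; norm_num
      nlinarith [Real.exp_pos (1 / 2)]
    have h8 : (1 + m : ℝ) ^ p ≤ 2 ^ p * p ! * (2 * Real.exp (m / 2)) := by
      have h9 := h6.trans h7
      rw [div_le_iff₀ (by positivity), div_pow, div_le_iff₀ (by positivity)] at h9
      linarith
    have h9 : (1 : ℝ) ≤ (1 + x) ^ p := one_le_pow₀ (by linarith)
    have h10 : 0 ≤ x ^ m / m ! := by positivity
    calc y * (1 + m) ^ p ≤ x ^ m / m ! * (1 + m) ^ p := by gcongr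
      _ ≤ x ^ m / m ! * (2 ^ p * p ! * (2 * Real.exp (m / 2))) := by gcongr
      _ = 2 * 2 ^ p * p ! * (x ^ m / m ! * Real.exp (m / 2)) := by ring
      _ ≤ 2 * 2 ^ p * p ! * 1 := by gcongr
      _ ≤ (6 ^ p + 2 * 2 ^ p * p !) * (1 + x) ^ p := by
        apply mul_le_mul _ h9 zero_le_one (by positivity)
        have : (0 : ℝ) ≤ 6 ^ p := by positivity
        linarith
  · push Not at h
    calc y * (1 + m) ^ p ≤ 1 * (6 * (1 + x)) ^ p := by
          gcongr
          linarith
      _ = 6 ^ p * (1 + x) ^ p := by rw [mul_pow, one_mul]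
      _ ≤ _ := by
          gcongr
          have : (0 : ℝ) ≤ 2 * 2 ^ p * p ! := by positivity
          linarith

/-- The Lieb-Robinson bound in polynomial form, with a constant that depends only on the strength
and the range of the Hamiltonian. -/
lemma lieb_robinson_pow (M : ℝ) {ρ : ℕ} (hρ : 0 < ρ) (N p : ℕ) :
    ∃ C : ℝ, 0 ≤ C ∧ ∀ {E : Type} [NormedAddCommGroup E] [InnerProductSpace ℂ E] [CompleteSpace E]
      {σ : Type} [Fintype σ] (h : σ → E →L[ℂ] E), (∀ w, IsSelfAdjoint (h w)) →
      (∀ w, ‖h w‖ ≤ M) → ∀ (d : σ → σ → ℕ), (∀ x y z, d x z ≤ d x y + d y z) →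
      (∀ x y, d x y = d y x) → ∀ (Loc : σ → (E →L[ℂ] E) → Prop), (∀ w, Loc w (h w)) →
      (∀ z w A B, Loc z A → Loc w B → ρ ≤ d z w → Commute A B) →
      (∀ z, (Finset.univ.filter fun w => d z w < ρ).card ≤ N) →
      ∀ z y A B, Loc z A → Loc y B → ∀ t : ℝ,
        ‖heis (∑ w, h w) A t * B - B * heis (∑ w, h w) A t‖ ≤
          (2 * ‖A‖ * ‖B‖ * C / (1 + d z y) ^ p) * (1 + |t|) ^ p := by
  refine ⟨(6 ^ p + 2 * 2 ^ p * p !) * (1 + |2 * M * N|) ^ p * ρ ^ p, by positivity, ?_⟩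
  intro E _ _ _ σ _ h hsa hM d htri hsymm Loc hLoc hcomm hN
  have hH : IsSelfAdjoint (∑ w, h w) := isSelfAdjoint_sum _ fun w _ => hsa w
  have key : ∀ z y A B, Loc z A → Loc y B → ∀ t : ℝ, 0 ≤ t →
      ‖heis (∑ w, h w) A t * B - B * heis (∑ w, h w) A t‖ ≤
        (2 * ‖A‖ * ‖B‖ * ((6 ^ p + 2 * 2 ^ p * p !) * (1 + |2 * M * N|) ^ p * ρ ^ p) /
          (1 + d z y) ^ p) * (1 + |t|) ^ p := by
    intro z y A B hA hB t ht
    have hM0 : 0 ≤ M := (norm_nonneg _).trans (hM z)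
    set m := d z y / ρ with hm
    have h0 := lieb_robinson h hsa hM d htri Loc hLoc hcomm hN 0 z y A B hA hB (by simp) t ht
    have h1 := lieb_robinson h hsa hM d htri Loc hLoc hcomm hN m z y A B hA hB
      (Nat.mul_div_le _ _) t ht
    rw [pow_zero, Nat.factorial_zero, Nat.cast_one, div_one] at h0
    set x := 2 * M * N * t with hx
    have hx0 : 0 ≤ x := by positivity
    have h2 : min 1 (x ^ m / m !) ≤ (6 ^ p + 2 * 2 ^ p * p !) * (1 + x) ^ p / (1 + m) ^ p :=
      min_one_pow_div_factorial_le p m hx0 (min_le_left _ _) (min_le_right _ _)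
    have h3 : ‖heis (∑ w, h w) A t * B - B * heis (∑ w, h w) A t‖ ≤
        2 * ‖A‖ * ‖B‖ * min 1 (x ^ m / m !) := by
      rcases min_choice 1 (x ^ m / (m ! : ℝ)) with h4 | h4 <;> rw [h4] <;> assumption
    have h4 : (1 + d z y : ℝ) ≤ ρ * (1 + m) := by
      have : 1 + d z y ≤ ρ * (1 + m) := by
        have h5 := Nat.div_add_mod (d z y) ρ
        have h6 := Nat.mod_lt (d z y) hρ
        rw [mul_add, mul_one, hm]
        omega
      exact_mod_cast this
    have h5 : 1 + x ≤ (1 + |2 * M * N|) * (1 + |t|) := by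
      rw [hx, abs_of_nonneg ht, abs_of_nonneg (by positivity : 0 ≤ 2 * M * N)]
      have : 0 ≤ 2 * M * N := by positivity
      nlinarith
    have h6 : (1 + m : ℝ) ^ p * ρ ^ p ≥ (1 + d z y) ^ p := by
      rw [← mul_pow, mul_comm]; gcongr
    calc _ ≤ 2 * ‖A‖ * ‖B‖ * ((6 ^ p + 2 * 2 ^ p * p !) * (1 + x) ^ p / (1 + m) ^ p) := by
          refine h3.trans ?_; gcongr
      _ = 2 * ‖A‖ * ‖B‖ * ((6 ^ p + 2 * 2 ^ p * p !) * (1 + x) ^ p * ρ ^ p) /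
          ((1 + m) ^ p * ρ ^ p) := by
          have : (ρ : ℝ) ^ p ≠ 0 := by positivity
          field_simp
      _ ≤ 2 * ‖A‖ * ‖B‖ * ((6 ^ p + 2 * 2 ^ p * p !) *
          ((1 + |2 * M * N|) * (1 + |t|)) ^ p * ρ ^ p) / (1 + d z y) ^ p := by gcongr
      _ = _ := by rw [mul_pow]; ring
  intro z y A B hA hB t
  rcases le_total 0 t with ht | ht
  · exact key z y A B hA hB t ht
  · have h1 := norm_commutator_heis_neg hH A B (-t)
    rw [neg_neg] at h1
    rw [h1]
    have h2 := key y z B A hB hA (-t) (by linarith)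
    rw [abs_neg, hsymm y z] at h2
    refine h2.trans (le_of_eq ?_)
    ring

end LiebRobinson

/-! ### Geometry of the discrete torus -/

section Geometry

variable {L : ℕ}

/-- The distance to `0` along the discrete circle. -/
def zabs (a : ZMod L) : ℕ := a.valMinAbs.natAbs

/-- The maximum distance on the discrete torus. -/
def sdist (x y : Site L) : ℕ := max (zabs (x.1 - y.1)) (zabs (x.2 - y.2))

lemma zabs_zero : zabs (0 : ZMod L) = 0 := by simp [zabs]

lemma zabs_neg (a : ZMod L) : zabs (-a) = zabs a := ZMod.natAbs_valMinAbs_neg a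

lemma zabs_sub_comm (a b : ZMod L) : zabs (a - b) = zabs (b - a) := by
  rw [← zabs_neg, neg_sub]

lemma zabs_add_le (a b : ZMod L) : zabs (a + b) ≤ zabs a + zabs b :=
  (ZMod.natAbs_valMinAbs_add_le a b).trans (Int.natAbs_add_le _ _)

lemma sdist_self (x : Site L) : sdist x x = 0 := by simp [sdist, zabs_zero]

lemma sdist_comm (x y : Site L) : sdist x y = sdist y x := by
  rw [sdist, sdist, zabs_sub_comm x.1, zabs_sub_comm x.2]

lemma sdist_triangle (x y z : Site L) : sdist x z ≤ sdist x y + sdist y z := by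
  have h1 := zabs_add_le (x.1 - y.1) (y.1 - z.1)
  have h2 := zabs_add_le (x.2 - y.2) (y.2 - z.2)
  rw [sub_add_sub_cancel] at h1 h2
  simp only [sdist]
  omega

/-- A potential that changes by at most `D` between neighbours is Lipschitz. -/
lemma abs_sub_le_of_adj {v : Site L → ℝ} {D : ℝ} (h : ∀ x y, Adj x y → |v y - v x| ≤ D)
    (x y : Site L) : |v x - v y| ≤ 2 * D * sdist x y := by
  have hD : 0 ≤ D := (abs_nonneg _).trans (h x _ ⟨.east, rfl⟩)
  have key : ∀ (d : Dir) (k : ℕ) (y : Site L), |v (y + k • d.vec L) - v y| ≤ D * k := by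
    intro d k y
    induction k with
    | zero => simp
    | succ k ih =>
      have h1 := h (y + k • d.vec L) (y + (k + 1) • d.vec L) ⟨d, by rw [succ_nsmul, add_assoc]⟩
      have h2 := abs_sub_le (v (y + (k + 1) • d.vec L)) (v (y + k • d.vec L)) (v y)
      push_cast
      linarith
  have h1 : ∀ (y : Site L) (a : ZMod L), |v (y + (a, 0)) - v y| ≤ D * zabs a := by
    intro y a
    have ha := ZMod.coe_valMinAbs a
    rcases Int.natAbs_eq a.valMinAbs with he | he
    · have h2 := key .east (zabs a) y
      have e : zabs a • Dir.east.vec L = (a, 0) := by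
        rw [he] at ha
        rw [Int.cast_natCast] at ha
        simp only [Dir.vec, Prod.smul_mk, nsmul_eq_mul, mul_one, mul_zero, zabs, ha]
      rwa [e] at h2
    · have h2 := key .west (zabs a) y
      have e : zabs a • Dir.west.vec L = (a, 0) := by
        rw [he] at ha
        rw [Int.cast_neg, Int.cast_natCast] at ha
        simp only [Dir.vec, Prod.smul_mk, nsmul_eq_mul, mul_neg, mul_one, mul_zero, zabs, ha]
      rwa [e] at h2
  have h2 : ∀ (y : Site L) (a : ZMod L), |v (y + (0, a)) - v y| ≤ D * zabs a := by
    intro y a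
    have ha := ZMod.coe_valMinAbs a
    rcases Int.natAbs_eq a.valMinAbs with he | he
    · have h2 := key .north (zabs a) y
      have e : zabs a • Dir.north.vec L = (0, a) := by
        rw [he] at ha
        rw [Int.cast_natCast] at ha
        simp only [Dir.vec, Prod.smul_mk, nsmul_eq_mul, mul_one, mul_zero, zabs, ha]
      rwa [e] at h2
    · have h2 := key .south (zabs a) y
      have e : zabs a • Dir.south.vec L = (0, a) := by
        rw [he] at ha
        rw [Int.cast_neg, Int.cast_natCast] at ha
        simp only [Dir.vec, Prod.smul_mk, nsmul_eq_mul, mul_neg, mul_one, mul_zero, zabs, ha]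
      rwa [e] at h2
  have h3 := h1 y (x.1 - y.1)
  have h4 := h2 (y + (x.1 - y.1, 0)) (x.2 - y.2)
  have e : y + (x.1 - y.1, 0) + (0, x.2 - y.2) = x := by ext <;> simp
  rw [e] at h4
  have h5 := abs_sub_le (v x) (v (y + (x.1 - y.1, 0))) (v y)
  have e1 : (zabs (x.1 - y.1) : ℝ) ≤ sdist x y := by exact_mod_cast le_max_left _ _
  have e2 : (zabs (x.2 - y.2) : ℝ) ≤ sdist x y := by exact_mod_cast le_max_right _ _
  nlinarith

variable [NeZero L]

lemma zabs_eq_min (a : ZMod L) : zabs a = min a.val (L - a.val) := a.valMinAbs_natAbs_eq_min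

lemma zabs_le_half (a : ZMod L) : zabs a ≤ L / 2 := ZMod.natAbs_valMinAbs_le a

lemma zabs_intCast_le (k : ℤ) : zabs (k : ZMod L) ≤ k.natAbs := by
  refine ZMod.natAbs_min_of_le_div_two L _ _ ?_ (zabs_le_half _)
  rw [ZMod.coe_valMinAbs]

lemma zabs_natCast_le (k : ℕ) : zabs (k : ZMod L) ≤ k := by
  simpa using zabs_intCast_le (L := L) (k : ℤ)

lemma zabs_one_le : zabs (1 : ZMod L) ≤ 1 := by simpa using zabs_natCast_le (L := L) 1

lemma sdist_le_half (x y : Site L) : sdist x y ≤ L / 2 :=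
  max_le (zabs_le_half _) (zabs_le_half _)

/-- The lattice vector of a positively oriented edge: `false` for the first and `true` for the
second coordinate direction. -/
def edgeVec (L : ℕ) (i : Bool) : Site L := if i then (0, 1) else (1, 0)

/-- The positively oriented edges of the torus: the edge `(x, i)` leads from `x` to
`x + edgeVec i`. Functions on them represent vector potentials. -/
abbrev Edge (L : ℕ) : Type := Site L × Bool

lemma sdist_add_edgeVec (x : Site L) (i : Bool) : sdist (x + edgeVec L i) x ≤ 1 := by
  have := zabs_one_le (L := L)
  cases i <;> simp [sdist, edgeVec, zabs_zero, this]

/-- The number of sites at distance at most `s` from a given site. -/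
lemma card_ball_le (x : Site L) (s : ℕ) :
    (Finset.univ.filter fun y => sdist x y ≤ s).card ≤ (2 * s + 1) ^ 2 := by
  let f : Site L → ℤ × ℤ := fun y => ((x.1 - y.1).valMinAbs, (x.2 - y.2).valMinAbs)
  have hf : Function.Injective f := by
    rintro ⟨a, b⟩ ⟨a', b'⟩ h
    simp only [f, Prod.mk.injEq, ZMod.valMinAbs_inj, sub_right_inj] at h
    rw [h.1, h.2]
  have h1 : (Finset.univ.filter fun y => sdist x y ≤ s).card ≤
      (Finset.Icc (-s : ℤ) s ×ˢ Finset.Icc (-s : ℤ) s).card := by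
    refine Finset.card_le_card_of_injOn f (fun y hy => ?_) hf.injOn
    have hy := (Finset.mem_filter.mp (Finset.mem_coe.mp hy)).2
    simp only [sdist, zabs] at hy
    simp only [f, Finset.coe_product, Finset.coe_Icc, Set.mem_prod, Set.mem_Icc]
    omega
  refine h1.trans (le_of_eq ?_)
  rw [Finset.card_product, Int.card_Icc, pow_two]
  congr 1 <;> omega

/-- A bound for the sum of `(1 + dist)⁻⁴` over the sites, uniform in the size of the torus. -/
def decayConst : ℝ := (∑' k : ℤ, ((1 + (k.natAbs : ℝ)) ^ 2)⁻¹) ^ 2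

lemma summable_decay : Summable fun k : ℤ => ((1 + (k.natAbs : ℝ)) ^ 2)⁻¹ := by
  have h : Summable fun k : ℕ => ((1 + (k : ℝ)) ^ 2)⁻¹ := by
    have h1 : Summable fun k : ℕ => ((k : ℝ) ^ 2)⁻¹ := Real.summable_nat_pow_inv.mpr one_lt_two
    have h2 := (summable_nat_add_iff 1).mpr h1
    refine h2.congr fun k => ?_
    push_cast
    rw [add_comm]
  refine Summable.of_nat_of_neg ?_ ?_
  · simpa using h
  · simpa using h

lemma decayConst_nonneg : 0 ≤ decayConst := sq_nonneg _

lemma sum_decay_le (x : Site L) : ∑ y : Site L, ((1 + (sdist x y : ℝ)) ^ 4)⁻¹ ≤ decayConst := by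
  have h1 : ∀ a : ZMod L, ∑ b : ZMod L, ((1 + (zabs (a - b) : ℝ)) ^ 2)⁻¹ ≤
      ∑' k : ℤ, ((1 + (k.natAbs : ℝ)) ^ 2)⁻¹ := by
    intro a
    have hinj : Function.Injective fun b : ZMod L => (a - b).valMinAbs := fun b b' h => by
      simpa using h
    have h2 := summable_decay.sum_le_tsum (Finset.univ.map ⟨_, hinj⟩) fun k _ => by positivity
    rw [Finset.sum_map] at h2
    exact h2
  calc ∑ y : Site L, ((1 + (sdist x y : ℝ)) ^ 4)⁻¹
      ≤ ∑ y : Site L, ((1 + (zabs (x.1 - y.1) : ℝ)) ^ 2)⁻¹ *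
          ((1 + (zabs (x.2 - y.2) : ℝ)) ^ 2)⁻¹ := by
        refine Finset.sum_le_sum fun y _ => ?_
        rw [← mul_inv]
        refine inv_anti₀ (by positivity) ?_
        have e1 : (zabs (x.1 - y.1) : ℝ) ≤ sdist x y := by exact_mod_cast le_max_left _ _
        have e2 : (zabs (x.2 - y.2) : ℝ) ≤ sdist x y := by exact_mod_cast le_max_right _ _
        calc _ ≤ (1 + (sdist x y : ℝ)) ^ 2 * (1 + (sdist x y : ℝ)) ^ 2 := by gcongr
          _ = _ := by ring
    _ = (∑ b : ZMod L, ((1 + (zabs (x.1 - b) : ℝ)) ^ 2)⁻¹) *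
          ∑ b : ZMod L, ((1 + (zabs (x.2 - b) : ℝ)) ^ 2)⁻¹ := by
        rw [Finset.sum_mul_sum, ← Finset.univ_product_univ, Finset.sum_product]
    _ ≤ _ := by
        rw [decayConst, pow_two]
        exact mul_le_mul (h1 _) (h1 _) (Finset.sum_nonneg fun _ _ => by positivity)
          (tsum_nonneg fun _ => by positivity)

lemma sum_far_le (x : Site L) (s q : ℕ) :
    ∑ y ∈ Finset.univ.filter (fun y => s ≤ sdist x y), ((1 + (sdist x y : ℝ)) ^ (q + 4))⁻¹ ≤
      decayConst / (1 + s) ^ q := by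
  rw [le_div_iff₀ (by positivity), Finset.sum_mul]
  refine le_trans ?_ (sum_decay_le x)
  refine (Finset.sum_le_sum fun y hy => ?_).trans
    (Finset.sum_le_sum_of_subset_of_nonneg (Finset.filter_subset _ _) fun _ _ _ => by positivity)
  have hs : (s : ℝ) ≤ sdist x y := by
    have := (Finset.mem_filter.mp hy).2
    exact_mod_cast this
  have h0 : (0 : ℝ) < 1 + sdist x y := by positivity
  rw [pow_add, mul_inv, mul_right_comm]
  refine mul_le_of_le_one_left (by positivity) ?_
  rw [inv_mul_le_iff₀ (by positivity), mul_one]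
  gcongr

end Geometry

/-! ### Quasi-local forms on vector potentials -/

section Forms

variable {L : ℕ} [NeZero L]

/-- The gradient of a function on the sites, a pure gauge vector potential. -/
def grad (f : Site L → ℝ) : Edge L → ℝ := fun e => f (e.1 + edgeVec L e.2) - f e.1

/-- The flux of a vector potential through the plaquette with lower left corner `x`, that is,
through the dual site labelled by `x`. -/
def curl (A : Edge L → ℝ) (x : Site L) : ℝ :=
  A (x, false) + A (x + edgeVec L false, true) - A (x + edgeVec L true, false) - A (x, true)

/-- The bilinear form on vector potentials with kernel `Ω`. -/
def form (Ω : Edge L → Edge L → ℝ) (A B : Edge L → ℝ) : ℝ := ∑ e, ∑ e', A e * B e' * Ω e e'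

/-- The response of the charge at the site `x` to the vector potential `A`. -/
def charge (Ω : Edge L → Edge L → ℝ) (A : Edge L → ℝ) (x : Site L) : ℝ :=
  form Ω (grad (Pi.single x 1)) A

/-- The kernel `Ω` is antisymmetric, decays like the power `p` of the distance, and its form
vanishes on pairs of pure gauge potentials. -/
structure IsQuasiLocal (Ω : Edge L → Edge L → ℝ) (C : ℝ) (p : ℕ) : Prop where
  nonneg : 0 ≤ C
  bound : ∀ e e', |Ω e e'| ≤ C / (1 + sdist e.1 e'.1) ^ p
  antisymm : ∀ e e', Ω e e' = -Ω e' e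
  closed : ∀ f h, form Ω (grad f) (grad h) = 0

variable {Ω : Edge L → Edge L → ℝ}

lemma form_add_left (A A' B : Edge L → ℝ) : form Ω (A + A') B = form Ω A B + form Ω A' B := by
  simp only [form, Pi.add_apply, add_mul, Finset.sum_add_distrib]

lemma form_add_right (A B B' : Edge L → ℝ) : form Ω A (B + B') = form Ω A B + form Ω A B' := by
  simp only [form, Pi.add_apply, mul_add, add_mul, Finset.sum_add_distrib]

lemma form_smul_left (c : ℝ) (A B : Edge L → ℝ) : form Ω (c • A) B = c * form Ω A B := by
  simp only [form, Pi.smul_apply, smul_eq_mul, mul_assoc, Finset.mul_sum]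

lemma form_smul_right (c : ℝ) (A B : Edge L → ℝ) : form Ω A (c • B) = c * form Ω A B := by
  simp only [form, Pi.smul_apply, smul_eq_mul, Finset.mul_sum]
  refine Finset.sum_congr rfl fun e _ => Finset.sum_congr rfl fun e' _ => by ring

lemma form_sub_left (A A' B : Edge L → ℝ) : form Ω (A - A') B = form Ω A B - form Ω A' B := by
  simp only [form, Pi.sub_apply, sub_mul, Finset.sum_sub_distrib]

lemma form_sub_right (A B B' : Edge L → ℝ) : form Ω A (B - B') = form Ω A B - form Ω A B' := by
  simp only [form, Pi.sub_apply, mul_sub, sub_mul, Finset.sum_sub_distrib]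

lemma form_zero_right (A : Edge L → ℝ) : form Ω A 0 = 0 := by simp [form]

lemma form_antisymm {C : ℝ} {p : ℕ} (hΩ : IsQuasiLocal Ω C p) (A B : Edge L → ℝ) :
    form Ω A B = -form Ω B A := by
  rw [form, form, Finset.sum_comm, ← Finset.sum_neg_distrib]
  refine Finset.sum_congr rfl fun e _ => ?_
  rw [← Finset.sum_neg_distrib]
  refine Finset.sum_congr rfl fun e' _ => ?_
  rw [hΩ.antisymm]
  ring

lemma form_grad (f : Site L → ℝ) (A : Edge L → ℝ) :
    form Ω (grad f) A = ∑ x, f x * charge Ω A x := by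
  have h : grad f = ∑ x, f x • grad (Pi.single x 1) := by
    ext e
    simp [grad, Finset.sum_apply, mul_sub, Pi.single_apply]
  have h2 : ∀ (s : Finset (Site L)), form Ω (∑ x ∈ s, f x • grad (Pi.single x 1)) A =
      ∑ x ∈ s, f x * charge Ω A x := by
    intro s
    induction s using Finset.induction_on with
    | empty => simp [form]
    | insert a s ha ih =>
      rw [Finset.sum_insert ha, Finset.sum_insert ha, form_add_left, form_smul_left, ih, charge]
  rw [h, h2]

lemma charge_add (A B : Edge L → ℝ) (x : Site L) :
    charge Ω (A + B) x = charge Ω A x + charge Ω B x := form_add_right _ _ _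

lemma charge_sub (A B : Edge L → ℝ) (x : Site L) :
    charge Ω (A - B) x = charge Ω A x - charge Ω B x := form_sub_right _ _ _

lemma charge_smul (c : ℝ) (A : Edge L → ℝ) (x : Site L) :
    charge Ω (c • A) x = c * charge Ω A x := form_smul_right _ _ _

lemma charge_grad {C : ℝ} {p : ℕ} (hΩ : IsQuasiLocal Ω C p) (f : Site L → ℝ) (x : Site L) :
    charge Ω (grad f) x = 0 := hΩ.closed _ _

/-- The charge at `x` is only affected by the vector potential near `x`. -/
lemma abs_charge_le_of_far {C : ℝ} {q : ℕ} (hΩ : IsQuasiLocal Ω C (q + 4)) {A : Edge L → ℝ} {a : ℝ}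
    (ha : ∀ e, |A e| ≤ a) (x : Site L) (s : ℕ) (hA : ∀ e : Edge L, sdist x e.1 < s → A e = 0) :
    |charge Ω A x| ≤ 8 * 2 ^ (q + 4) * C * decayConst * a / (1 + s) ^ q := by
  have hC := hΩ.nonneg
  have ha0 : 0 ≤ a := (abs_nonneg _).trans (ha (x, true))
  set Z := 2 * (2 ^ (q + 4) * C * a * (decayConst / (1 + s) ^ q)) with hZ
  have h1 : ∀ e : Edge L, sdist x e.1 ≤ 1 → ∑ e', |A e'| * |Ω e e'| ≤ Z := by
    intro e he
    have h2 : ∀ e' : Edge L, |A e'| * |Ω e e'| ≤ if s ≤ sdist x e'.1 then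
        2 ^ (q + 4) * C * a * ((1 + (sdist x e'.1 : ℝ)) ^ (q + 4))⁻¹ else 0 := by
      intro e'
      split_ifs with hs
      · have h3 : (1 + sdist x e'.1 : ℝ) ≤ 2 * (1 + sdist e.1 e'.1) := by
          have := sdist_triangle x e.1 e'.1
          have : 1 + sdist x e'.1 ≤ 2 * (1 + sdist e.1 e'.1) := by omega
          exact_mod_cast this
        calc |A e'| * |Ω e e'| ≤ a * (C / (1 + sdist e.1 e'.1) ^ (q + 4)) :=
              mul_le_mul (ha _) (hΩ.bound _ _) (abs_nonneg _) ha0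
          _ = 2 ^ (q + 4) * C * a * ((2 * (1 + (sdist e.1 e'.1 : ℝ))) ^ (q + 4))⁻¹ := by
              rw [mul_pow]; field_simp
          _ ≤ _ := by gcongr
      · rw [hA e' (not_le.mp hs), abs_zero, zero_mul]
    refine (Finset.sum_le_sum fun e' _ => h2 e').trans ?_
    rw [← Finset.univ_product_univ, Finset.sum_product]
    simp only [Finset.sum_const, Finset.card_univ, Fintype.card_bool, nsmul_eq_mul]
    rw [← Finset.mul_sum, ← Finset.sum_filter, ← Finset.mul_sum, hZ]
    push_cast
    gcongr
    exact sum_far_le x s q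
  have h4 : |charge Ω A x| ≤ ∑ e, |grad (Pi.single x (1 : ℝ)) e| * ∑ e', |A e'| * |Ω e e'| := by
    refine (Finset.abs_sum_le_sum_abs _ _).trans (Finset.sum_le_sum fun e _ => ?_)
    rw [Finset.mul_sum]
    refine (Finset.abs_sum_le_sum_abs _ _).trans (Finset.sum_le_sum fun e' _ => ?_)
    rw [abs_mul, abs_mul, mul_assoc]
  have h5 : ∀ e : Edge L, |grad (Pi.single x (1 : ℝ)) e| * ∑ e', |A e'| * |Ω e e'| ≤
      ((if e.1 = x - edgeVec L e.2 then 1 else 0) + (if e.1 = x then 1 else 0)) * Z := by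
    intro e
    have hZ0 : 0 ≤ Z := by have := decayConst_nonneg; positivity
    have h6 : |grad (Pi.single x (1 : ℝ)) e| ≤
        (if e.1 = x - edgeVec L e.2 then 1 else 0) + (if e.1 = x then 1 else 0) := by
      rw [grad, Pi.single_apply, Pi.single_apply]
      have e1 : (e.1 + edgeVec L e.2 = x) = (e.1 = x - edgeVec L e.2) := by
        rw [eq_sub_iff_add_eq]
      simp only [e1]
      split_ifs <;> norm_num
    by_cases h7 : sdist x e.1 ≤ 1
    · exact mul_le_mul h6 (h1 e h7) (Finset.sum_nonneg fun _ _ => by positivity)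
        ((abs_nonneg _).trans h6)
    · have h8 : e.1 ≠ x - edgeVec L e.2 := fun h8 => h7 (by
        have := sdist_add_edgeVec e.1 e.2
        rw [h8, sub_add_cancel, ← h8] at this
        exact this)
      have h9 : e.1 ≠ x := fun h9 => h7 (by rw [h9, sdist_self]; exact zero_le_one)
      rw [if_neg h8, if_neg h9, add_zero] at h6 ⊢
      rw [zero_mul, abs_nonpos_iff.mp h6, abs_zero, zero_mul]
  refine (h4.trans (Finset.sum_le_sum fun e _ => h5 e)).trans ?_
  rw [← Finset.sum_mul, Finset.sum_add_distrib, ← Finset.univ_product_univ, Finset.sum_product_right,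
    Finset.sum_product_right]
  simp only [Finset.sum_ite_eq', Finset.mem_univ, if_true, Finset.sum_const, Finset.card_univ,
    Fintype.card_bool, nsmul_eq_mul]
  refine le_of_eq ?_
  rw [hZ]
  push_cast
  ring

/-- The discrete Poincaré lemma: a vector potential without flux in a square is a pure gauge in the
square, with an explicit bound on the gauge function. -/
lemma exists_grad_eq {A : Edge L → ℝ} {a : ℝ} (ha : ∀ e, |A e| ≤ a) (x : Site L) {s : ℕ}
    (hs : 2 * s < L) (hA : ∀ y, sdist x y ≤ s → curl A y = 0) :
    ∃ f : Site L → ℝ, (∀ y, |f y| ≤ 4 * s * a) ∧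
      ∀ e : Edge L, sdist x e.1 < s → grad f e = A e := by
  have ha0 : 0 ≤ a := (abs_nonneg _).trans (ha (x, true))
  -- coordinates relative to the lower left corner of the square
  set z : Site L := x - ((s : ZMod L), (s : ZMod L)) with hz
  let U : Site L → ℕ := fun y => (y.1 - z.1).val
  let W : Site L → ℕ := fun y => (y.2 - z.2).val
  let h : Site L → ℝ := fun y => ∑ k ∈ Finset.range (U y), A ((z.1 + k, z.2), false) +
    ∑ k ∈ Finset.range (W y), A ((y.1, z.2 + k), true)
  have hsum : ∀ (m : ℕ) (F : ℕ → Edge L), |∑ k ∈ Finset.range m, A (F k)| ≤ m * a := by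
    intro m F
    refine (Finset.abs_sum_le_sum_abs _ _).trans ((Finset.sum_le_sum fun k _ => ha (F k)).trans ?_)
    simp
  refine ⟨fun y => if U y ≤ 2 * s ∧ W y ≤ 2 * s then h y else 0, fun y => ?_, fun e he => ?_⟩
  · simp only
    split_ifs with hy
    · have h1 := hsum (U y) fun k => ((z.1 + k, z.2), false)
      have h2 := hsum (W y) fun k => ((y.1, z.2 + k), true)
      have h3 : (U y : ℝ) ≤ 2 * s := by exact_mod_cast hy.1
      have h4 : (W y : ℝ) ≤ 2 * s := by exact_mod_cast hy.2
      refine (abs_add_le _ _).trans ((add_le_add h1 h2).trans ?_)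
      nlinarith
    · rw [abs_zero]; positivity
  · obtain ⟨y, i⟩ := e
    -- a coordinate at distance less than `s` from the centre has offset between `1` and `2 s - 1`
    have hcoord : ∀ b c : ZMod L, zabs (b - c) < s →
        (c - (b - s)).val + 1 ≤ 2 * s ∧ (c + 1 - (b - s)).val = (c - (b - s)).val + 1 := by
      intro b c hbc
      set j : ℤ := (c - b).valMinAbs with hj
      have hj1 : j.natAbs < s := by rw [zabs_sub_comm] at hbc; exact hbc
      have hj2 : (j : ZMod L) = c - b := ZMod.coe_valMinAbs _
      obtain ⟨m, hm⟩ : ∃ m : ℕ, (m : ℤ) = j + s := ⟨(j + s).toNat, by omega⟩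
      have hm2 : (m : ZMod L) = c - (b - s) := by
        have := congrArg (Int.cast : ℤ → ZMod L) hm
        push_cast at this
        rw [this, hj2]; ring
      have hm3 : ((m + 1 : ℕ) : ZMod L) = c + 1 - (b - s) := by
        push_cast
        rw [hm2]; ring
      rw [← hm2, ← hm3, ZMod.val_natCast_of_lt (by omega), ZMod.val_natCast_of_lt (by omega)]
      omega
    have hx1 : zabs (x.1 - y.1) < s := (le_max_left _ _).trans_lt he
    have hx2 : zabs (x.2 - y.2) < s := (le_max_right _ _).trans_lt he
    obtain ⟨hU1, hU2⟩ := hcoord _ _ hx1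
    obtain ⟨hW1, hW2⟩ := hcoord _ _ hx2
    change U y + 1 ≤ 2 * s at hU1
    change W y + 1 ≤ 2 * s at hW1
    change (y.1 + 1 - z.1).val = U y + 1 at hU2
    change (y.2 + 1 - z.2).val = W y + 1 at hW2
    have hyz1 : z.1 + (U y : ZMod L) = y.1 := by
      simp only [U]; rw [ZMod.natCast_zmod_val]; ring
    have hyz2 : z.2 + (W y : ZMod L) = y.2 := by
      simp only [W]; rw [ZMod.natCast_zmod_val]; ring
    simp only [grad]
    cases i
    · have hU' : U (y + edgeVec L false) = U y + 1 := by
        simpa [U, edgeVec] using hU2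
      have hW' : W (y + edgeVec L false) = W y := by simp [W, edgeVec]
      rw [if_pos ⟨by omega, by omega⟩, if_pos ⟨by omega, by omega⟩]
      simp only [h, hU', hW']
      rw [Finset.sum_range_succ, hyz1]
      have h1 : ∑ k ∈ Finset.range (W y), A (((y + edgeVec L false).1, z.2 + k), true) -
          ∑ k ∈ Finset.range (W y), A ((y.1, z.2 + k), true) =
          A ((y.1, z.2 + (W y : ℕ)), false) - A ((y.1, z.2 + (0 : ℕ)), false) := by
        rw [← Finset.sum_sub_distrib,
          ← Finset.sum_range_sub fun k : ℕ => A ((y.1, z.2 + (k : ZMod L)), false)]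
        refine Finset.sum_congr rfl fun k hk => ?_
        have hc := hA (y.1, z.2 + k) ?_
        · simp only [curl, edgeVec, Prod.mk_add_mk, add_zero, if_true, if_false,
            Bool.false_eq_true, Prod.fst_add] at hc ⊢
          rw [add_assoc] at hc
          push_cast
          linarith
        · have hk' := Finset.mem_range.mp hk
          refine max_le hx1.le ?_
          have e : x.2 - (z.2 + k) = (((s : ℤ) - (k : ℤ) : ℤ) : ZMod L) := by
            rw [hz]
            push_cast
            simp only [Prod.snd_sub]
            ring
          simp only
          rw [e]
          refine (zabs_intCast_le _).trans ?_
          omega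
      rw [Nat.cast_zero, add_zero, hyz2] at h1
      linarith
    · have hU' : U (y + edgeVec L true) = U y := by simp [U, edgeVec]
      have hW' : W (y + edgeVec L true) = W y + 1 := by
        simpa [W, edgeVec] using hW2
      rw [if_pos ⟨by omega, by omega⟩, if_pos ⟨by omega, by omega⟩]
      simp only [h, hU', hW']
      rw [Finset.sum_range_succ]
      simp only [edgeVec, if_true, Prod.fst_add, add_zero]
      rw [hyz2]
      ring

/-- A vector potential without flux near `x` has no effect on the charge at `x`, up to a small
error. -/
lemma abs_charge_le_of_curl {C : ℝ} {q : ℕ} (hΩ : IsQuasiLocal Ω C (q + 5)) {A : Edge L → ℝ} {a : ℝ}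
    (ha : ∀ e, |A e| ≤ a) (x : Site L) {s : ℕ} (hs : 2 * s < L)
    (hA : ∀ y, sdist x y ≤ s → curl A y = 0) :
    |charge Ω A x| ≤ 72 * 2 ^ (q + 5) * C * decayConst * a / (1 + s) ^ q := by
  have ha0 : 0 ≤ a := (abs_nonneg _).trans (ha (x, true))
  have hC := hΩ.nonneg
  have hd := decayConst_nonneg
  obtain ⟨f, hf1, hf2⟩ := exists_grad_eq ha x hs hA
  have h1 : charge Ω A x = charge Ω (A - grad f) x := by
    rw [charge_sub, charge_grad hΩ, sub_zero]
  have h2 : ∀ e, |(A - grad f) e| ≤ 9 * a * (1 + s) := by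
    intro e
    have h3 := hf1 (e.1 + edgeVec L e.2)
    have h4 := hf1 e.1
    have h5 := ha e
    rw [abs_le] at h3 h4 h5 ⊢
    simp only [Pi.sub_apply, grad]
    have : 0 ≤ s * a := by positivity
    constructor <;> nlinarith
  rw [h1]
  refine (abs_charge_le_of_far (q := q + 1) hΩ h2 x s fun e he => ?_).trans (le_of_eq ?_)
  · rw [Pi.sub_apply, hf2 e he, sub_self]
  · rw [pow_succ (1 + (s : ℝ)) q]
    field_simp
    ring

end Forms

/-! ### Flux insertion along paths of the dual lattice -/

section Flux

variable {L : ℕ}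

/-- The vector potential of a unit flux tube pair that is connected by the dual edge `e`: it takes
the value `-1` from the right to the left of `e`. -/
def dualForm (e : DualEdge L) : Edge L → ℝ :=
  match e.dir with
  | .east => -Pi.single (e.right, true) 1
  | .north => Pi.single (e.left, false) 1
  | .west => Pi.single (e.left, true) 1
  | .south => -Pi.single (e.right, false) 1

/-- The vector potential of a path in the dual lattice. -/
def pathForm (γ : List (DualEdge L)) : Edge L → ℝ := (γ.map dualForm).sum

/-- The vector potential `1 / L` on the edges in the first direction. -/
def fluxForm₁ (L : ℕ) : Edge L → ℝ := fun e => if e.2 then 0 else 1 / L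

/-- The vector potential `1 / L` on the edges in the second direction. -/
def fluxForm₂ (L : ℕ) : Edge L → ℝ := fun e => if e.2 then 1 / L else 0

/-- The vector potential of the straight string of `h` dual edges that starts at the dual site `y`
in the first direction. -/
def stringForm (h : ℕ) (y : Site L) : Edge L → ℝ := fun e =>
  if e.2 = true ∧ e.1.2 = y.2 ∧ 1 ≤ (e.1.1 - y.1).val ∧ (e.1.1 - y.1).val ≤ h then 1 else 0

lemma abs_dualForm_le (e : DualEdge L) (f : Edge L) : |dualForm e f| ≤ 1 := by
  obtain ⟨s, d⟩ := e
  cases d <;> simp only [dualForm, Pi.neg_apply, abs_neg, Pi.single_apply] <;> split_ifs <;> simp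

lemma abs_stringForm_le (h : ℕ) (y : Site L) (f : Edge L) : |stringForm h y f| ≤ 1 := by
  rw [stringForm]; split_ifs <;> simp

lemma curl_sub (A B : Edge L → ℝ) (x : Site L) : curl (A - B) x = curl A x - curl B x := by
  simp only [curl, Pi.sub_apply]; ring

lemma curl_smul (c : ℝ) (A : Edge L → ℝ) (x : Site L) : curl (c • A) x = c * curl A x := by
  simp only [curl, Pi.smul_apply, smul_eq_mul]; ring

lemma curl_dualForm (e : DualEdge L) (x : Site L) :
    curl (dualForm e) x = (if x = e.tgt then 1 else 0) - (if x = e.src then 1 else 0) := by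
  obtain ⟨⟨a, b⟩, d⟩ := e
  obtain ⟨x1, x2⟩ := x
  have e1 : (x1 + 1 = a) ↔ (x1 = a + -1) := by rw [← sub_eq_add_neg, eq_sub_iff_add_eq]
  have e2 : (x2 + 1 = b) ↔ (x2 = b + -1) := by rw [← sub_eq_add_neg, eq_sub_iff_add_eq]
  cases d <;>
    simp [dualForm, curl, Pi.single_apply, DualEdge.tgt, DualEdge.left, DualEdge.right, edgeVec,
      Dir.vec, e1, e2] <;> ring

variable [NeZero L]

lemma curl_stringForm {h : ℕ} (h1 : 1 ≤ h) (h2 : h + 1 < L) (y x : Site L) :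
    curl (stringForm h y) x =
      (if x = y then 1 else 0) - (if x = y + ((h : ZMod L), 0) then 1 else 0) := by
  obtain ⟨x1, x2⟩ := x
  obtain ⟨y1, y2⟩ := y
  simp only [curl, stringForm, edgeVec, Prod.mk_add_mk, if_true, if_false, Bool.false_eq_true,
    false_and, true_and, add_zero, Prod.mk.injEq]
  by_cases hx2 : x2 = y2
  · set u := (x1 - y1).val with hu
    have hx : x1 = y1 + (u : ZMod L) := by rw [hu, ZMod.natCast_zmod_val]; ring
    have huL : u < L := ZMod.val_lt _
    have e0 : x1 = y1 ↔ u = 0 := by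
      rw [hu, ZMod.val_eq_zero, sub_eq_zero]
    have eh : x1 = y1 + (h : ZMod L) ↔ u = h := by
      rw [hx, add_right_inj]
      constructor
      · intro h3
        have := congrArg ZMod.val h3
        rwa [ZMod.val_natCast_of_lt huL, ZMod.val_natCast_of_lt (by omega)] at this
      · intro h3; rw [h3]
    have e1 : (x1 + 1 - y1).val = if u + 1 < L then u + 1 else 0 := by
      have : x1 + 1 - y1 = ((u + 1 : ℕ) : ZMod L) := by rw [hx]; push_cast; ring
      rw [this]
      split_ifs with h3
      · exact ZMod.val_natCast_of_lt h3
      · have : u + 1 = L := by omega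
        rw [this]; simp
    simp only [e1, e0, eh, hx2, true_and, and_true]
    split_ifs <;> first | omega | norm_num
  · simp [hx2]

/-- The strip of the sites whose first coordinate differs by at most `q` from the one of `y`. -/
def window (q : ℕ) (y : Site L) : Finset (Site L) :=
  Finset.univ.filter fun x => zabs (x.1 - y.1) ≤ q

/-- The charge near `y` that is induced by a flux tube at `y`, where the flux escapes through a
string of length `L / 2`. The strip of width `L / 4` around `y` cuts off the charge that is induced at
the other end of the string. -/
def tubeCharge (Ω : Edge L → Edge L → ℝ) (y x : Site L) : ℝ :=
  if x ∈ window (L / 4) y then charge Ω (stringForm (L / 2) y) x else 0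

variable {Ω : Edge L → Edge L → ℝ} {C : ℝ} {q : ℕ}

/-- The constant in the bounds for the charge that is induced away from the flux. -/
def chargeConst (C : ℝ) (q : ℕ) : ℝ := 72 * 2 ^ (q + 5) * C * decayConst

lemma chargeConst_nonneg (hC : 0 ≤ C) : 0 ≤ chargeConst C q := by
  have := decayConst_nonneg
  unfold chargeConst
  positivity

lemma half_le_zabs_add (hL : 4 ≤ L) (a : ZMod L) :
    L / 2 ≤ zabs a + zabs (a - ((L / 2 : ℕ) : ZMod L)) := by
  have h1 := zabs_add_le a (-(a - ((L / 2 : ℕ) : ZMod L)))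
  rw [zabs_neg] at h1
  have h2 : zabs (a + -(a - ((L / 2 : ℕ) : ZMod L))) = L / 2 := by
    have : a + -(a - ((L / 2 : ℕ) : ZMod L)) = ((L / 2 : ℕ) : ZMod L) := by ring
    rw [this, zabs_eq_min, ZMod.val_natCast_of_lt (by omega)]
    omega
  omega

/-- Moving a flux tube across a dual edge changes the induced charge by the effect of the edge. -/
lemma abs_charge_dualForm_sub_le (hL : 4 ≤ L) (hΩ : IsQuasiLocal Ω C (q + 5)) (e : DualEdge L)
    (x : Site L) :
    |charge Ω (dualForm e) x - (tubeCharge Ω e.tgt x - tubeCharge Ω e.src x)| ≤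
      3 * chargeConst C q / (1 + (L / 4 - 1 : ℕ)) ^ q := by
  classical
  set χ : Site L → ℝ := fun y => if x ∈ window (L / 4) y then 1 else 0 with hχ
  have hχ1 : ∀ y, |χ y| ≤ 1 := fun y => by simp only [hχ]; split_ifs <;> simp
  have ht : ∀ y, tubeCharge Ω y x = charge Ω (χ y • stringForm (L / 2) y) x := by
    intro y
    rw [charge_smul, tubeCharge]
    simp only [hχ]
    split_ifs <;> simp
  rw [ht, ht, ← charge_sub, ← charge_sub]
  have h1 := abs_charge_le_of_curl hΩ (a := 3)
    (A := dualForm e - (χ e.tgt • stringForm (L / 2) e.tgt - χ e.src • stringForm (L / 2) e.src))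
    ?_ x (s := L / 4 - 1) (by omega) ?_
  · rw [chargeConst]
    refine h1.trans (le_of_eq ?_)
    ring
  · intro f
    have b : ∀ y, |χ y * stringForm (L / 2) y f| ≤ 1 := fun y => by
      rw [abs_mul]
      exact mul_le_one₀ (hχ1 y) (abs_nonneg _) (abs_stringForm_le _ _ _)
    have b1 := abs_le.mp (abs_dualForm_le e f)
    have b2 := abs_le.mp (b e.tgt)
    have b3 := abs_le.mp (b e.src)
    simp only [Pi.sub_apply, Pi.smul_apply, smul_eq_mul]
    rw [abs_le]
    constructor <;> linarith
  · intro z hz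
    -- the flux at the end of the string is far if `x` is in the window, the flux at its beginning
    -- is far otherwise
    have key : ∀ y : Site L, χ y * curl (stringForm (L / 2) y) z = if z = y then 1 else 0 := by
      intro y
      rw [curl_stringForm (by omega) (by omega)]
      have hz1 : zabs (x.1 - z.1) ≤ L / 4 - 1 := (le_max_left _ _).trans hz
      simp only [hχ, window, Finset.mem_filter, Finset.mem_univ, true_and]
      by_cases c1 : zabs (x.1 - y.1) ≤ L / 4
      · rw [if_pos c1, one_mul, if_neg (c := z = y + _), sub_zero]
        intro c3
        have h3 := half_le_zabs_add hL (x.1 - y.1)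
        have h4 : x.1 - y.1 - ((L / 2 : ℕ) : ZMod L) = x.1 - z.1 := by
          rw [c3, Prod.fst_add]; ring
        rw [h4] at h3
        omega
      · rw [if_neg c1, zero_mul, if_neg]
        intro c2
        rw [c2] at hz1
        omega
    rw [curl_sub, curl_sub, curl_smul, curl_smul, key, key, curl_dualForm, sub_self]

/-- The charge that is induced by a flux tube is concentrated near the tube. -/
lemma abs_tubeCharge_le (hL : 4 ≤ L) (hΩ : IsQuasiLocal Ω C (q + 5)) (y x : Site L) :
    |tubeCharge Ω y x| ≤ chargeConst C q * 8 ^ q / (1 + sdist x y) ^ q := by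
  have hC0 := chargeConst_nonneg (q := q) hΩ.nonneg
  rw [tubeCharge]
  split_ifs with hx
  · have hxw : zabs (x.1 - y.1) ≤ L / 4 := (Finset.mem_filter.mp hx).2
    by_cases h0 : sdist x y = 0
    · have h1 := abs_charge_le_of_far (q := q + 1) hΩ (abs_stringForm_le (L / 2) y) x 0
        (fun e he => absurd he (Nat.not_lt_zero _))
      rw [h0]
      refine h1.trans ?_
      simp only [Nat.cast_zero, add_zero, one_pow, div_one, mul_one]
      have h8 : (1 : ℝ) ≤ 8 ^ q := one_le_pow₀ (by norm_num)
      have h9 : 8 * 2 ^ (q + 1 + 4) * C * decayConst ≤ chargeConst C q := by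
        have := hΩ.nonneg
        have := decayConst_nonneg
        rw [chargeConst, show q + 1 + 4 = q + 5 from rfl]
        have : 0 ≤ 2 ^ (q + 5) * C * decayConst := by positivity
        linarith
      nlinarith
    · set s := min (sdist x y - 1) (L / 4 - 1) with hs
      have h1 := abs_charge_le_of_curl hΩ (abs_stringForm_le (L / 2) y) x (s := s) (by omega) ?_
      · rw [mul_one] at h1
        refine h1.trans ?_
        have h2 : (1 + sdist x y : ℝ) ≤ 8 * (1 + s) := by
          have h3 := sdist_le_half x y
          have : 1 + sdist x y ≤ 8 * (1 + s) := by omega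
          exact_mod_cast this
        rw [← chargeConst, div_le_div_iff₀ (by positivity) (by positivity), mul_assoc, ← mul_pow]
        gcongr
      · intro z hz
        rw [curl_stringForm (by omega) (by omega), if_neg, if_neg, sub_zero]
        · rintro rfl
          have hz1 : zabs (x.1 - (y + (((L / 2 : ℕ) : ZMod L), 0)).1) ≤ s :=
            (le_max_left _ _).trans hz
          have h3 := half_le_zabs_add hL (x.1 - y.1)
          rw [Prod.fst_add, ← sub_sub] at hz1
          simp only at hz1
          omega
        · rintro rfl
          omega
  · rw [abs_zero]
    positivity

end Flux

/-! ### The response to the current through a path -/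

section PathResponse

variable {L : ℕ}

/-- The vector potential with unit circulation that is supported on the edges in the first
direction with first coordinate `a`. -/
def sliceForm₁ (a : ZMod L) : Edge L → ℝ := fun e => if e.2 = false ∧ e.1.1 = a then 1 else 0

/-- The vector potential with unit circulation that is supported on the edges in the second
direction with second coordinate `b`. -/
def sliceForm₂ (b : ZMod L) : Edge L → ℝ := fun e => if e.2 = true ∧ e.1.2 = b then 1 else 0

lemma abs_sliceForm₁_le (a : ZMod L) (e : Edge L) : |sliceForm₁ a e| ≤ 1 := by
  rw [sliceForm₁]; split_ifs <;> simp

variable [NeZero L] {Ω : Edge L → Edge L → ℝ} {C : ℝ} {q : ℕ}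

/-- The charge induced by the vector potential of a path only depends on the end points, up to a
small error. -/
lemma abs_charge_pathForm_sub_le (hL : 4 ≤ L) (hΩ : IsQuasiLocal Ω C (q + 5)) (x : Site L) :
    ∀ (γ : List (DualEdge L)) (yb ye : Site L), IsDualPath yb γ ye →
      |charge Ω (pathForm γ) x - (tubeCharge Ω ye x - tubeCharge Ω yb x)| ≤
        γ.length * (3 * chargeConst C q / (1 + (L / 4 - 1 : ℕ)) ^ q) := by
  intro γ
  induction γ with
  | nil =>
    rintro yb ye rfl
    simp [pathForm, charge, form_zero_right]
  | cons e γ ih =>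
    rintro yb ye ⟨rfl, h⟩
    have h1 := ih _ _ h
    have h2 := abs_charge_dualForm_sub_le hL hΩ e x
    have h3 : pathForm (e :: γ) = dualForm e + pathForm γ := by simp [pathForm]
    rw [h3, charge_add, List.length_cons]
    push_cast
    rw [abs_le] at h1 h2 ⊢
    constructor <;> linarith

lemma length_le_of_nodup {γ : List (DualEdge L)} (h : γ.Nodup) : γ.length ≤ 4 * L ^ 2 := by
  let f : DualEdge L → Site L × Fin 4 := fun e =>
    (e.src, match e.dir with | .east => 0 | .north => 1 | .west => 2 | .south => 3)
  have hf : Function.Injective f := by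
    rintro ⟨s, d⟩ ⟨s', d'⟩ h
    simp only [f, Prod.mk.injEq] at h
    obtain ⟨rfl, h⟩ := h
    cases d <;> cases d' <;> simp_all
  have h1 := (h.map hf).length_le_card
  rw [List.length_map] at h1
  refine h1.trans (le_of_eq ?_)
  simp [ZMod.card]
  ring

/-- Vector potentials with distant supports have a small response to each other. -/
lemma abs_form_le_of_far {p : ℕ} (hΩ : IsQuasiLocal Ω C p) {A B : Edge L → ℝ} (s : ℕ)
    (hA : ∀ e, |A e| ≤ 1) (hB : ∀ e, |B e| ≤ 1)
    (h : ∀ e e', A e ≠ 0 → B e' ≠ 0 → s ≤ sdist e.1 e'.1) :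
    |form Ω A B| ≤ 4 * L ^ 4 * C / (1 + s) ^ p := by
  have hC := hΩ.nonneg
  have h1 : ∀ e e', |A e * B e' * Ω e e'| ≤ C / (1 + s) ^ p := by
    intro e e'
    by_cases h1 : A e = 0
    · rw [h1, zero_mul, zero_mul, abs_zero]; positivity
    by_cases h2 : B e' = 0
    · rw [h2, mul_zero, zero_mul, abs_zero]; positivity
    have h3 : (s : ℝ) ≤ sdist e.1 e'.1 := by exact_mod_cast h e e' h1 h2
    rw [abs_mul, abs_mul]
    calc |A e| * |B e'| * |Ω e e'| ≤ 1 * 1 * (C / (1 + sdist e.1 e'.1) ^ p) := by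
          gcongr
          · exact hA e
          · exact hB e'
          · exact hΩ.bound e e'
      _ = C / (1 + sdist e.1 e'.1) ^ p := by ring
      _ ≤ _ := by gcongr
  calc |form Ω A B| ≤ ∑ e : Edge L, ∑ e' : Edge L, C / (1 + s) ^ p := by
        refine (Finset.abs_sum_le_sum_abs _ _).trans (Finset.sum_le_sum fun e _ => ?_)
        exact (Finset.abs_sum_le_sum_abs _ _).trans (Finset.sum_le_sum fun e' _ => h1 e e')
    _ = _ := by
        simp [ZMod.card]
        ring

lemma val_sub_val_pred (hL : 4 ≤ L) (u : ZMod L) :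
    (u.val : ℝ) - ((u - 1).val : ℝ) = 1 - if u = 0 then (L : ℝ) else 0 := by
  have : Fact (1 < L) := ⟨by omega⟩
  split_ifs with h
  · rw [h, ZMod.val_zero, zero_sub, ZMod.neg_val, if_neg one_ne_zero, ZMod.val_one,
      Nat.cast_sub (by omega)]
    push_cast; ring
  · have h1 : 1 ≤ u.val := Nat.one_le_iff_ne_zero.mpr ((ZMod.val_ne_zero u).mpr h)
    rw [ZMod.val_sub (by rwa [ZMod.val_one]), ZMod.val_one, Nat.cast_sub h1]
    push_cast; ring

/-- The gauge function that concentrates a constant vector potential on a slice. -/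
def sliceGauge (a u : ZMod L) : ℝ := -((u - a - 1).val : ℝ) / L

lemma abs_sliceGauge_le (a u : ZMod L) : |sliceGauge a u| ≤ 1 := by
  have h1 : ((u - a - 1).val : ℝ) ≤ L := by exact_mod_cast (ZMod.val_lt _).le
  have h2 : (0 : ℝ) < L := by exact_mod_cast Nat.pos_of_ne_zero (NeZero.ne L)
  rw [sliceGauge, abs_div, abs_neg, Nat.abs_cast, Nat.abs_cast, div_le_one h2]
  exact h1

lemma sliceGauge_succ_sub (hL : 4 ≤ L) (a u : ZMod L) :
    sliceGauge a (u + 1) - sliceGauge a u = (if u = a then 1 else 0) - 1 / L := by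
  have h2 : (L : ℝ) ≠ 0 := by exact_mod_cast NeZero.ne L
  have h3 := val_sub_val_pred hL (u - a)
  rw [sliceGauge, sliceGauge, show u + 1 - a - 1 = u - a by ring]
  simp only [sub_eq_zero] at h3
  split_ifs at h3 ⊢ <;> field_simp <;> linarith

lemma sliceForm₁_eq (hL : 4 ≤ L) (a : ZMod L) :
    sliceForm₁ a = fluxForm₁ L + grad fun x => sliceGauge a x.1 := by
  ext ⟨x, i⟩
  cases i
  · simp [sliceForm₁, fluxForm₁, grad, edgeVec, sliceGauge_succ_sub hL]
  · simp [sliceForm₁, fluxForm₁, grad, edgeVec]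

lemma sliceForm₂_eq (hL : 4 ≤ L) (b : ZMod L) :
    sliceForm₂ b = fluxForm₂ L + grad fun x => sliceGauge b x.2 := by
  ext ⟨x, i⟩
  cases i
  · simp [sliceForm₂, fluxForm₂, grad, edgeVec]
  · simp [sliceForm₂, fluxForm₂, grad, edgeVec, sliceGauge_succ_sub hL]

/-- A constant vector potential only has a small response to pure gauge potentials. -/
lemma abs_form_grad_le (hL : 4 ≤ L) (hΩ : IsQuasiLocal Ω C (q + 5)) {f : Site L → ℝ}
    (hf : ∀ x, |f x| ≤ 1) {A : Edge L → ℝ} (hA : ∀ e, |A e| ≤ 1) (hA' : ∀ x, curl A x = 0) :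
    |form Ω (grad f) A| ≤ L ^ 2 * chargeConst C q / (1 + (L / 4 - 1 : ℕ)) ^ q := by
  rw [form_grad]
  have h1 : ∀ x, |f x * charge Ω A x| ≤ chargeConst C q / (1 + (L / 4 - 1 : ℕ)) ^ q := by
    intro x
    have h2 := abs_charge_le_of_curl hΩ hA x (s := L / 4 - 1) (by omega) fun y _ => hA' y
    rw [mul_one] at h2
    rw [abs_mul]
    calc |f x| * |charge Ω A x| ≤ 1 * |charge Ω A x| := by gcongr; exact hf x
      _ ≤ _ := by rw [one_mul]; exact h2
  calc |∑ x, f x * charge Ω A x|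
      ≤ ∑ x : Site L, chargeConst C q / (1 + (L / 4 - 1 : ℕ)) ^ q :=
        (Finset.abs_sum_le_sum_abs _ _).trans (Finset.sum_le_sum fun x _ => h1 x)
    _ = _ := by
        simp [ZMod.card]
        ring

lemma abs_fluxForm₁_le (e : Edge L) : |fluxForm₁ L e| ≤ 1 := by
  have h1 : (1 : ℝ) ≤ L := by exact_mod_cast Nat.one_le_iff_ne_zero.mpr (NeZero.ne L)
  rw [fluxForm₁]
  split_ifs
  · simp
  · rw [abs_of_nonneg (by positivity), div_le_one (by positivity)]; exact h1

lemma abs_fluxForm₂_le (e : Edge L) : |fluxForm₂ L e| ≤ 1 := by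
  have h1 : (1 : ℝ) ≤ L := by exact_mod_cast Nat.one_le_iff_ne_zero.mpr (NeZero.ne L)
  rw [fluxForm₂]
  split_ifs
  · rw [abs_of_nonneg (by positivity), div_le_one (by positivity)]; exact h1
  · simp

/-- The response of a slice to a perpendicular slice is the response of the constant vector
potentials to each other, up to a small error. -/
lemma abs_form_sliceForm_sub_le (hL : 4 ≤ L) (hΩ : IsQuasiLocal Ω C (q + 5)) (a b : ZMod L) :
    |form Ω (sliceForm₁ a) (sliceForm₂ b) - form Ω (fluxForm₁ L) (fluxForm₂ L)| ≤
      2 * L ^ 2 * chargeConst C q / (1 + (L / 4 - 1 : ℕ)) ^ q := by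
  have h1 := abs_form_grad_le hL hΩ (f := fun x => sliceGauge a x.1)
    (fun x => abs_sliceGauge_le _ _) abs_fluxForm₂_le fun x => by simp [curl, fluxForm₂]
  have h2 := abs_form_grad_le hL hΩ (f := fun x => sliceGauge b x.2)
    (fun x => abs_sliceGauge_le _ _) abs_fluxForm₁_le fun x => by simp [curl, fluxForm₁]
  have h3 : 2 * (L : ℝ) ^ 2 * chargeConst C q / (1 + (L / 4 - 1 : ℕ)) ^ q =
      2 * (L ^ 2 * chargeConst C q / (1 + (L / 4 - 1 : ℕ)) ^ q) := by ring
  rw [sliceForm₁_eq hL, sliceForm₂_eq hL, form_add_left, form_add_right, form_add_right,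
    hΩ.closed, h3, form_antisymm hΩ (fluxForm₁ L) (grad _)]
  rw [abs_le] at h1 h2 ⊢
  constructor <;> linarith

lemma zabs_natCast {j : ℕ} (hj : j < L) : zabs (j : ZMod L) = min j (L - j) := by
  rw [zabs_eq_min, ZMod.val_natCast_of_lt hj]

lemma zabs_sub_natCast (u : ZMod L) {j : ℕ} (hj : j ≤ L) :
    zabs (u - (j : ZMod L)) = if j ≤ u.val then min (u.val - j) (L - (u.val - j)) else
      min (j - u.val) (L - (j - u.val)) := by
  have hu := ZMod.val_lt u
  split_ifs with h
  · have e : u - (j : ZMod L) = ((u.val - j : ℕ) : ZMod L) := by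
      rw [Nat.cast_sub h, ZMod.natCast_zmod_val]
    rw [e, zabs_natCast (by omega)]
  · have e : u - (j : ZMod L) = -((j - u.val : ℕ) : ZMod L) := by
      rw [Nat.cast_sub (by omega), ZMod.natCast_zmod_val, neg_sub]
    rw [e, zabs_neg]
    rcases (show j - u.val < L ∨ j - u.val = L by omega) with h1 | h1
    · exact zabs_natCast h1
    · rw [h1]; simp [zabs_zero]

/-- The total charge that is induced by a flux tube is minus the response of the constant vector
potentials to each other: it is the current through a slice in response to the string, and the
string may be closed around the torus far away from the slice. -/
lemma abs_sum_tubeCharge_add_le (hL : 4 ≤ L) (hΩ : IsQuasiLocal Ω C (q + 5))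
    (y : Site L) :
    |∑ x, tubeCharge Ω y x + form Ω (fluxForm₁ L) (fluxForm₂ L)| ≤
      (8 * L ^ 4 * C + 2 * L ^ 2 * chargeConst C q) / (1 + (L / 4 - 1 : ℕ)) ^ q := by
  set S := stringForm (L / 2) y with hS
  set am : ZMod L := y.1 - ((L / 4 + 1 : ℕ) : ZMod L) with ham
  set ap : ZMod L := y.1 + ((L / 4 : ℕ) : ZMod L) with hap
  set s := L / 4 - 1 with hs
  have hC := hΩ.nonneg
  -- the total charge in the window is the current through its two boundaries
  have h1 : ∑ x, tubeCharge Ω y x = form Ω (sliceForm₁ am) S - form Ω (sliceForm₁ ap) S := by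
    have h2 : grad (fun x => if x ∈ window (L / 4) y then (1 : ℝ) else 0) =
        sliceForm₁ am - sliceForm₁ ap := by
      ext ⟨x, i⟩
      cases i
      · set u := (x.1 - y.1).val with hu
        have huL : u < L := ZMod.val_lt _
        have hx : x.1 - y.1 = (u : ZMod L) := by rw [hu, ZMod.natCast_zmod_val]
        have em : x.1 = am ↔ u = L - (L / 4 + 1) := by
          have : am = y.1 + ((L - (L / 4 + 1) : ℕ) : ZMod L) := by
            rw [ham, Nat.cast_sub (by omega), ZMod.natCast_self]; ring
          rw [this, ← sub_eq_iff_eq_add', hx]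
          constructor
          · intro h3
            have := congrArg ZMod.val h3
            rwa [ZMod.val_natCast_of_lt huL, ZMod.val_natCast_of_lt (by omega)] at this
          · intro h3; rw [h3]
        have ep : x.1 = ap ↔ u = L / 4 := by
          rw [hap, ← sub_eq_iff_eq_add', hx]
          constructor
          · intro h3
            have := congrArg ZMod.val h3
            rwa [ZMod.val_natCast_of_lt huL, ZMod.val_natCast_of_lt (by omega)] at this
          · intro h3; rw [h3]
        have z1 : zabs (x.1 - y.1) = min u (L - u) := by rw [hx, zabs_natCast huL]
        have z2 : zabs (x.1 + 1 - y.1) = if u + 1 < L then min (u + 1) (L - (u + 1)) else 0 := by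
          have : x.1 + 1 - y.1 = ((u + 1 : ℕ) : ZMod L) := by
            push_cast; rw [← hx]; ring
          rw [this]
          split_ifs with h3
          · exact zabs_natCast h3
          · have : u + 1 = L := by omega
            rw [this]; simp [zabs_zero]
        simp only [grad, edgeVec, window, Finset.mem_filter, Finset.mem_univ, true_and,
          Pi.sub_apply, sliceForm₁, Bool.false_eq_true, if_false, Prod.fst_add, z1, z2, em, ep]
        split_ifs <;> first | omega | norm_num
      · simp [grad, edgeVec, window, sliceForm₁]
    rw [← form_sub_left, ← h2, form_grad]
    refine Finset.sum_congr rfl fun x _ => ?_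
    rw [tubeCharge]
    split_ifs <;> simp [hS]
  have hfar1 : |form Ω (sliceForm₁ am) S| ≤ 4 * L ^ 4 * C / (1 + s) ^ (q + 5) := by
    refine abs_form_le_of_far hΩ s (abs_sliceForm₁_le am) (abs_stringForm_le _ _) ?_
    rintro ⟨x, i⟩ ⟨z, j⟩ hx hz
    simp only [sliceForm₁, hS, stringForm, ne_eq, ite_eq_right_iff, one_ne_zero, imp_false,
      not_not] at hx hz
    refine le_trans ?_ (le_max_left _ _)
    simp only
    rw [zabs_sub_comm, hx.2, ham, show z.1 - (y.1 - ((L / 4 + 1 : ℕ) : ZMod L)) =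
      ((L / 4 + 1 : ℕ) : ZMod L) - (-(z.1 - y.1)) by ring, zabs_sub_comm, ← zabs_neg,
      neg_sub, sub_neg_eq_add]
    set u := (z.1 - y.1).val with hu
    have e : ((L / 4 + 1 : ℕ) : ZMod L) + (z.1 - y.1) = ((L / 4 + 1 + u : ℕ) : ZMod L) := by
      push_cast
      rw [hu, ZMod.natCast_zmod_val]
    rw [e]
    -- for `L = 4` the claim is void
    rcases Nat.eq_zero_or_pos s with h0 | h0
    · omega
    rw [zabs_natCast (by omega)]
    omega
  have hfar2 : |form Ω (sliceForm₁ ap) (sliceForm₂ y.2 - S)| ≤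
      4 * L ^ 4 * C / (1 + s) ^ (q + 5) := by
    refine abs_form_le_of_far hΩ s (abs_sliceForm₁_le ap) (fun e => ?_) ?_
    · simp only [Pi.sub_apply, sliceForm₂, hS, stringForm]
      split_ifs <;> norm_num
    · rintro ⟨x, i⟩ ⟨z, j⟩ hx hz
      simp only [sliceForm₁, ne_eq, ite_eq_right_iff, one_ne_zero, imp_false, not_not] at hx
      refine le_trans ?_ (le_max_left _ _)
      simp only
      rw [zabs_sub_comm, hx.2, hap, ← sub_sub, zabs_sub_natCast _ (by omega)]
      set u := (z.1 - y.1).val with hu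
      have huL : u < L := ZMod.val_lt _
      have hz' : u = 0 ∨ L / 2 < u := by
        by_contra hcon
        apply hz
        have e1 : 1 ≤ u := by omega
        have e2 : u ≤ L / 2 := by omega
        simp only [Pi.sub_apply, sliceForm₂, hS, stringForm, ← hu, e1, e2, and_true, sub_self]
      split_ifs <;> omega
  have hsl := abs_form_sliceForm_sub_le hL hΩ ap y.2
  rw [form_sub_right] at hfar2
  have hpow : 4 * (L : ℝ) ^ 4 * C / (1 + s) ^ (q + 5) ≤ 4 * L ^ 4 * C / (1 + s) ^ q := by
    gcongr
    · linarith [(Nat.cast_nonneg s : (0 : ℝ) ≤ s)]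
    · omega
  have e : (8 * (L : ℝ) ^ 4 * C + 2 * L ^ 2 * chargeConst C q) / (1 + (s : ℝ)) ^ q =
      4 * L ^ 4 * C / (1 + s) ^ q + 4 * L ^ 4 * C / (1 + s) ^ q +
        2 * L ^ 2 * chargeConst C q / (1 + (s : ℝ)) ^ q := by ring
  rw [h1, e]
  rw [abs_le] at hfar1 hfar2 hsl ⊢
  constructor <;> linarith

/-- The response of a potential that is flat near the flux tube only depends on the total charge of
the tube. -/
lemma abs_sum_mul_tubeCharge_sub_le {k : ℕ} (hL : 4 ≤ L) (hΩ : IsQuasiLocal Ω C (k + 5 + 5))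
    {w : Site L → ℝ} {D r c : ℝ} (hr : 0 < r) (hD : 0 ≤ D) {y : Site L}
    (hw : ∀ x, |w x - c| ≤ 2 * D * sdist x y) (hflat : ∀ x, w x ≠ c → r ≤ 2 * (1 + sdist x y)) :
    |∑ x, w x * tubeCharge Ω y x - c * ∑ x, tubeCharge Ω y x| ≤
      2 * D * chargeConst C (k + 5) * 8 ^ (k + 5) * decayConst * 2 ^ k / r ^ k := by
  have hC := chargeConst_nonneg (q := k + 5) hΩ.nonneg
  have h1 : ∀ x, |(w x - c) * tubeCharge Ω y x| ≤
      2 * D * chargeConst C (k + 5) * 8 ^ (k + 5) * 2 ^ k / r ^ k *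
        ((1 + (sdist y x : ℝ)) ^ 4)⁻¹ := by
    intro x
    rw [sdist_comm y x]
    by_cases h : w x = c
    · rw [h, sub_self, zero_mul, abs_zero]; positivity
    have h2 := hflat x h
    have h3 := abs_tubeCharge_le hL hΩ y x
    have hd : (0 : ℝ) ≤ sdist x y := Nat.cast_nonneg _
    calc |(w x - c) * tubeCharge Ω y x|
        ≤ 2 * D * (1 + sdist x y) * (chargeConst C (k + 5) * 8 ^ (k + 5) /
            (1 + sdist x y) ^ (k + 5)) := by
          rw [abs_mul]
          refine mul_le_mul ((hw x).trans ?_) h3 (abs_nonneg _) (by positivity)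
          gcongr
          linarith
      _ = 2 * D * chargeConst C (k + 5) * 8 ^ (k + 5) * 2 ^ k / (2 * (1 + sdist x y)) ^ k *
            ((1 + (sdist x y : ℝ)) ^ 4)⁻¹ := by
          rw [mul_pow, show k + 5 = k + 1 + 4 from rfl, pow_add _ (k + 1) 4, pow_succ _ k]
          field_simp
          ring
      _ ≤ _ := by gcongr
  have h4 : ∑ x, w x * tubeCharge Ω y x - c * ∑ x, tubeCharge Ω y x =
      ∑ x, (w x - c) * tubeCharge Ω y x := by
    rw [Finset.mul_sum, ← Finset.sum_sub_distrib]
    exact Finset.sum_congr rfl fun x _ => by ring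
  rw [h4]
  refine (Finset.abs_sum_le_sum_abs _ _).trans ((Finset.sum_le_sum fun x _ => h1 x).trans ?_)
  rw [← Finset.mul_sum]
  calc _ ≤ 2 * D * chargeConst C (k + 5) * 8 ^ (k + 5) * 2 ^ k / r ^ k * decayConst := by
        gcongr
        exact sum_decay_le y
    _ = _ := by ring

/-- The combinatorial core: for a quasi-local form, the response of the current through a path to a
potential that is flat near the end points is the response of the constant vector potentials to
each other, times the potential difference. -/
theorem exists_abs_form_grad_pathForm_add_le (k : ℕ) :
    ∃ K : ℝ, 0 ≤ K ∧ ∀ (L : ℕ) [NeZero L], 4 ≤ L → ∀ (Ω : Edge L → Edge L → ℝ) (C : ℝ),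
      IsQuasiLocal Ω C (k + 5 + 5) → ∀ (γ : List (DualEdge L)) (yb ye : Site L),
      IsDualPath yb γ ye → γ.Nodup → ∀ (v : Site L → ℝ) (D r : ℝ), 0 < r →
      (∀ x y, Adj x y → |v y - v x| ≤ D) →
      (∀ x, v x ≠ v yb → r ≤ 2 * (1 + sdist x yb)) →
      (∀ x, v x ≠ v ye → r ≤ 2 * (1 + sdist x ye)) → v yb ≠ v ye →
      |form Ω (grad v) (pathForm γ) + (v ye - v yb) * form Ω (fluxForm₁ L) (fluxForm₂ L)| ≤
        K * C * D / r ^ k := by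
  set c₀ : ℝ := 72 * 2 ^ (k + 5 + 5) * decayConst with hc₀
  have hc₀' : 0 ≤ c₀ := by have := decayConst_nonneg; positivity
  refine ⟨12 * 8 ^ 5 * c₀ * 16 ^ k + 4 * c₀ * 8 ^ (k + 5) * decayConst * 2 ^ k +
    (8 + 2 * c₀) * 8 ^ 5 * 16 ^ k, by have := decayConst_nonneg; positivity, ?_⟩
  intro L _ hL Ω C hΩ γ yb ye hγ hγ' v D r hr hv hflatb hflate hne
  have hC := hΩ.nonneg
  have hD : 0 ≤ D := (abs_nonneg _).trans (hv yb _ ⟨.east, rfl⟩)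
  have hcc : chargeConst C (k + 5) = c₀ * C := by rw [chargeConst, hc₀]; ring
  have hcc0 := chargeConst_nonneg (q := k + 5) hC
  set s := L / 4 - 1 with hs
  set w : Site L → ℝ := fun x => v x - v yb with hw
  have hs0 : (0 : ℝ) ≤ s := Nat.cast_nonneg _
  have hLs : (L : ℝ) ≤ 8 * (1 + s) := by
    have : L ≤ 8 * (1 + s) := by omega
    exact_mod_cast this
  have hL1 : (1 : ℝ) ≤ L := by exact_mod_cast (by omega : 1 ≤ L)
  have hrs : r ≤ 16 * (1 + s) := by
    have h1 := hflate yb hne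
    have h2 := sdist_le_half yb ye
    have h3 : 2 * (1 + sdist yb ye) ≤ 16 * (1 + s) := by omega
    have h4 : (2 * (1 + sdist yb ye) : ℝ) ≤ 16 * (1 + s) := by exact_mod_cast h3
    linarith
  have hpow : (L : ℝ) ^ 5 / (1 + s) ^ (k + 5) ≤ 8 ^ 5 * 16 ^ k / r ^ k := by
    rw [div_le_div_iff₀ (by positivity) (by positivity)]
    calc (L : ℝ) ^ 5 * r ^ k ≤ (8 * (1 + s)) ^ 5 * (16 * (1 + s)) ^ k := by gcongr
      _ = _ := by rw [mul_pow, mul_pow]; ring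
  have hlip := abs_sub_le_of_adj hv
  have hdL : ∀ x y : Site L, 2 * D * sdist x y ≤ D * L := by
    intro x y
    have h1 : 2 * sdist x y ≤ L := by have := sdist_le_half x y; omega
    have h2 : (2 * sdist x y : ℝ) ≤ L := by exact_mod_cast h1
    nlinarith
  have hgrad : grad v = grad w := by ext e; simp [grad, hw]
  -- replace the path by its end points
  have hE1 : |form Ω (grad v) (pathForm γ) -
      (∑ x, w x * tubeCharge Ω ye x - ∑ x, w x * tubeCharge Ω yb x)| ≤
      12 * c₀ * C * D * (8 ^ 5 * 16 ^ k / r ^ k) := by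
    rw [hgrad, form_grad, ← Finset.sum_sub_distrib, ← Finset.sum_sub_distrib]
    have h1 : ∀ x, |w x * charge Ω (pathForm γ) x -
        (w x * tubeCharge Ω ye x - w x * tubeCharge Ω yb x)| ≤
        D * L * (4 * L ^ 2 * (3 * chargeConst C (k + 5) / (1 + s) ^ (k + 5))) := by
      intro x
      rw [← mul_sub, ← mul_sub, abs_mul]
      refine mul_le_mul ((hlip x yb).trans (hdL x yb)) ?_ (abs_nonneg _) (by positivity)
      refine (abs_charge_pathForm_sub_le hL hΩ x γ yb ye hγ).trans ?_
      gcongr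
      exact_mod_cast length_le_of_nodup hγ'
    refine (Finset.abs_sum_le_sum_abs _ _).trans ((Finset.sum_le_sum fun x _ => h1 x).trans ?_)
    rw [Finset.sum_const, Finset.card_univ, Fintype.card_prod, ZMod.card, nsmul_eq_mul, hcc]
    push_cast
    calc _ = 12 * c₀ * C * D * ((L : ℝ) ^ 5 / (1 + s) ^ (k + 5)) := by ring
      _ ≤ _ := by gcongr
  have hE2 := abs_sum_mul_tubeCharge_sub_le (k := k) hL hΩ (w := w) (c := 0) hr hD (y := yb)
    (fun x => by rw [sub_zero]; exact hlip x yb)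
    (fun x hx => hflatb x fun h => hx (by simp [hw, h]))
  have hE3 := abs_sum_mul_tubeCharge_sub_le (k := k) hL hΩ (w := w) (c := v ye - v yb) hr hD
    (y := ye) (fun x => by simpa [hw] using hlip x ye)
    (fun x hx => hflate x fun h => hx (by simp [hw, h]))
  rw [zero_mul, sub_zero] at hE2
  have hE4 : |(v ye - v yb) * (∑ x, tubeCharge Ω ye x + form Ω (fluxForm₁ L) (fluxForm₂ L))| ≤
      (8 + 2 * c₀) * C * D * (8 ^ 5 * 16 ^ k / r ^ k) := by
    rw [abs_mul]
    calc _ ≤ D * L * ((8 * L ^ 4 * C + 2 * L ^ 2 * chargeConst C (k + 5)) /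
            (1 + s) ^ (k + 5)) := by
          refine mul_le_mul ((hlip ye yb).trans (hdL _ _))
            (abs_sum_tubeCharge_add_le hL hΩ ye) (abs_nonneg _) (by positivity)
      _ ≤ D * L * ((8 * L ^ 4 * C + 2 * L ^ 4 * chargeConst C (k + 5)) /
            (1 + s) ^ (k + 5)) := by
          gcongr
          norm_num
      _ = (8 + 2 * c₀) * C * D * ((L : ℝ) ^ 5 / (1 + s) ^ (k + 5)) := by rw [hcc]; ring
      _ ≤ _ := by gcongr
  rw [hcc] at hE2 hE3
  have e : (12 * 8 ^ 5 * c₀ * 16 ^ k + 4 * c₀ * 8 ^ (k + 5) * decayConst * 2 ^ k +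
      (8 + 2 * c₀) * 8 ^ 5 * 16 ^ k) * C * D / r ^ k =
      12 * c₀ * C * D * (8 ^ 5 * 16 ^ k / r ^ k) +
      2 * (2 * D * (c₀ * C) * 8 ^ (k + 5) * decayConst * 2 ^ k / r ^ k) +
      (8 + 2 * c₀) * C * D * (8 ^ 5 * 16 ^ k / r ^ k) := by ring
  rw [e]
  rw [abs_le] at hE1 hE2 hE3 hE4 ⊢
  constructor <;> linarith

end PathResponse

/-! ### Curvature, linear response and commutators -/

section CurvatureForm

open Complex

variable {E : Type*} [NormedAddCommGroup E] [InnerProductSpace ℂ E]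

lemma inner_apply_left_of_isSelfAdjoint [CompleteSpace E] {A : E →L[ℂ] E} (hA : IsSelfAdjoint A) (x y : E) :
    inner ℂ (A x) y = inner ℂ x (A y) := by
  rw [← ContinuousLinearMap.adjoint_inner_right, ← ContinuousLinearMap.star_eq_adjoint, hA.star_eq]

namespace SpectralGap

variable {H : E →L[ℂ] E} {g : ℝ} (G : SpectralGap H g)

lemma curvForm_antisymm (A B : E →L[ℂ] E) : G.curvForm A B = -G.curvForm B A := by
  rw [curvForm, curvForm, ← inner_conj_symm, conj_im]
  ring

lemma curvForm_sum {κ : Type*} [Fintype κ] (a b : κ → ℝ) (j : κ → E →L[ℂ] E) :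
    G.curvForm (∑ e, (a e : ℂ) • j e) (∑ e, (b e : ℂ) • j e) =
      ∑ e, ∑ e', a e * b e' * G.curvForm (j e) (j e') := by
  have h1 : ∀ a : κ → ℝ, G.resolvent ((∑ e, (a e : ℂ) • j e) G.vec) =
      ∑ e, (a e : ℂ) • G.resolvent (j e G.vec) := by
    intro a
    rw [sum_apply, map_sum]
    exact Finset.sum_congr rfl fun e _ => by rw [smul_apply, map_smul]
  rw [curvForm, h1, h1, sum_inner, im_sum, Finset.mul_sum]
  refine Finset.sum_congr rfl fun e _ => ?_
  rw [inner_sum, im_sum, Finset.mul_sum]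
  refine Finset.sum_congr rfl fun e' _ => ?_
  rw [inner_smul_left, inner_smul_right, conj_ofReal, im_ofReal_mul, im_ofReal_mul, curvForm]
  ring

lemma resolvent_commutator_vec (V : E →L[ℂ] E) :
    G.resolvent ((I • (H * V - V * H)) G.vec) = I • (V G.vec - G.proj (V G.vec)) := by
  have h1 := congrArg (fun A : E →L[ℂ] E => A (V G.vec)) G.resolvent_mul
  simp only [mul_apply_eq_comp, sub_apply, smul_apply, one_apply_eq_self] at h1
  rw [← h1, smul_apply, map_smul, sub_apply, mul_apply_eq_comp, mul_apply_eq_comp, G.apply_vec,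
    map_smul]

variable [CompleteSpace E]

/-- The curvature form vanishes on the time derivatives of two commuting observables. -/
lemma curvForm_commutator_commutator {V W : E →L[ℂ] E} (hV : IsSelfAdjoint V)
    (hW : IsSelfAdjoint W) (hVW : Commute V W) :
    G.curvForm (I • (H * V - V * H)) (I • (H * W - W * H)) = 0 := by
  have hP : ∀ x y : E, inner ℂ (G.proj x) y = inner ℂ x (G.proj y) :=
    inner_apply_left_of_isSelfAdjoint G.star_proj
  have hPP : ∀ x, G.proj (G.proj x) = G.proj x := fun x =>
    congrArg (fun A : E →L[ℂ] E => A x) G.proj_mul_proj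
  have h0 : ∀ z : ℂ, (starRingEnd ℂ) z = z → z.im = 0 := fun z hz => conj_eq_iff_im.mp hz
  have h1 : (inner ℂ (V G.vec) (W G.vec)).im = 0 := by
    apply h0
    rw [inner_conj_symm, inner_apply_left_of_isSelfAdjoint hV, inner_apply_left_of_isSelfAdjoint hW]
    exact congrArg (fun A : E →L[ℂ] E => inner ℂ G.vec (A G.vec)) hVW.eq.symm
  have h2 : (inner ℂ (V G.vec) (G.proj (W G.vec))).im = 0 := by
    rw [G.proj_apply, inner_smul_right]
    apply h0
    rw [map_mul, inner_conj_symm, inner_conj_symm, inner_apply_left_of_isSelfAdjoint hW,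
      inner_apply_left_of_isSelfAdjoint hV]
  rw [curvForm, resolvent_commutator_vec, resolvent_commutator_vec, inner_smul_left,
    inner_smul_right, ← mul_assoc, conj_I, neg_mul I I, I_mul_I, neg_neg, one_mul, inner_sub_left,
    inner_sub_right, inner_sub_right, hP, hP, hPP, sub_self, sub_zero, sub_im, h1, h2]
  simp

/-- The linear response of an observable `J` to a potential `V` is the curvature form of `J` and of
the time derivative of `V`. -/
lemma curvForm_commutator (J V : E →L[ℂ] E) :
    G.curvForm J (I • (H * V - V * H)) =
      -2 * (inner ℂ (V G.vec) (G.resolvent (J G.vec))).re := by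
  have h1 : inner ℂ (G.resolvent (J G.vec)) (G.proj (V G.vec)) = 0 := by
    rw [← inner_apply_left_of_isSelfAdjoint G.star_proj]
    have := congrArg (fun A : E →L[ℂ] E => A (J G.vec)) G.proj_mul_resolvent
    simp only [mul_apply_eq_comp, zero_apply] at this
    rw [this, inner_zero_left]
  rw [curvForm, resolvent_commutator_vec, inner_smul_right, inner_sub_right, h1, sub_zero,
    ← inner_conj_symm, I_mul_im, conj_re]

/-- The adiabatic curvature of a projection whose derivatives are given by perturbation theory. -/
lemma I_mul_inner_commutator_eq_curvForm {A B : E →L[ℂ] E} (hA : IsSelfAdjoint A)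
    (hB : IsSelfAdjoint B) :
    let D := fun A : E →L[ℂ] E => -(G.resolvent * A * G.proj + G.proj * A * G.resolvent)
    I * inner ℂ G.vec ((D A * D B - D B * D A) G.vec) = (G.curvForm A B : ℂ) := by
  intro D
  have hPvec : G.proj G.vec = G.vec := by
    rw [G.proj_apply, inner_self_eq_norm_sq_to_K, G.norm_vec]
    simp
  have hD : ∀ A, D A G.vec = -G.resolvent (A G.vec) := by
    intro A
    simp only [D, neg_apply, add_apply, mul_apply_eq_comp, G.resolvent_vec, map_zero, add_zero,
      hPvec]
  have hDs : ∀ {A}, IsSelfAdjoint A → IsSelfAdjoint (D A) := by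
    intro A hA
    simp only [D, IsSelfAdjoint, star_neg, star_add, star_mul, G.star_resolvent, G.star_proj,
      hA.star_eq, mul_assoc]
    rw [add_comm]
  rw [sub_apply, mul_apply_eq_comp, mul_apply_eq_comp, inner_sub_right,
    ← inner_apply_left_of_isSelfAdjoint (hDs hA) G.vec (D B G.vec),
    ← inner_apply_left_of_isSelfAdjoint (hDs hB) G.vec (D A G.vec), hD, hD, inner_neg_neg, inner_neg_neg, ← inner_conj_symm (G.resolvent (B G.vec)), sub_conj,
    curvForm, mul_comm I, mul_assoc, I_mul_I]
  push_cast
  ring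

end SpectralGap

end CurvatureForm

/-! ### Ground states on Fock space -/

section GroundState

variable {L n : ℕ} [NeZero L] {H : Op L n}

lemma isSymmetric_of_isSelfAdjoint (hH : IsSelfAdjoint H) :
    (H : Fock L n →ₗ[ℂ] Fock L n).IsSymmetric := fun x y =>
  inner_apply_left_of_isSelfAdjoint hH x y

/-- An orthonormal eigenbasis, whose eigenvalues are the energies. -/
lemma exists_eigenbasis (hH : IsSelfAdjoint H) :
    ∃ (b : OrthonormalBasis (Fin (Module.finrank ℂ (Fock L n))) ℂ (Fock L n))
      (e : Fin (Module.finrank ℂ (Fock L n)) → ℝ), (∀ i, H (b i) = (e i : ℂ) • b i) ∧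
        energies H = Set.range e := by
  have hs := isSymmetric_of_isSelfAdjoint hH
  refine ⟨hs.eigenvectorBasis rfl, hs.eigenvalues rfl, hs.apply_eigenvectorBasis rfl, ?_⟩
  ext E
  constructor
  · intro hE
    obtain ⟨i, hi⟩ := hs.exists_eigenvalues_eq rfl hE
    exact ⟨i, Complex.ofReal_injective hi⟩
  · rintro ⟨i, rfl⟩
    exact hs.hasEigenvalue_eigenvalues rfl i

lemma groundEnergy_mem (hH : IsSelfAdjoint H) : groundEnergy H ∈ energies H := by
  obtain ⟨b, e, -, he⟩ := exists_eigenbasis hH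
  have hpos : 0 < Module.finrank ℂ (Fock L n) := Module.finrank_pos
  have : Nonempty (Fin (Module.finrank ℂ (Fock L n))) := ⟨⟨0, hpos⟩⟩
  rw [groundEnergy, he]
  exact (Set.range_nonempty e).csInf_mem (Set.finite_range e)

lemma groundEnergy_le (hH : IsSelfAdjoint H) {E : ℝ} (hE : E ∈ energies H) :
    groundEnergy H ≤ E := by
  obtain ⟨b, e, -, he⟩ := exists_eigenbasis hH
  refine csInf_le ?_ hE
  rw [he]
  exact (Set.finite_range e).bddBelow

lemma apply_of_mem_groundSpace {x : Fock L n} (hx : x ∈ groundSpace H) :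
    H x = (groundEnergy H : ℂ) • x := Module.End.mem_eigenspace_iff.mp hx

lemma exists_unit_groundSpace (hH : IsSelfAdjoint H) : ∃ x ∈ groundSpace H, ‖x‖ = 1 := by
  obtain ⟨x, hx⟩ := (show Module.End.HasEigenvalue _ _ from
    groundEnergy_mem hH).exists_hasEigenvector
  refine ⟨((‖x‖⁻¹ : ℝ) : ℂ) • x, (groundSpace H).smul_mem _ hx.1, ?_⟩
  rw [norm_smul, Complex.norm_real, norm_inv, norm_norm,
    inv_mul_cancel₀ (norm_ne_zero_iff.mpr hx.2)]

lemma groundEnergy_mul_le_re_inner (hH : IsSelfAdjoint H) (x : Fock L n) :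
    groundEnergy H * ‖x‖ ^ 2 ≤ (inner ℂ x (H x)).re := by
  obtain ⟨b, e, hb, he⟩ := exists_eigenbasis hH
  rw [← b.sum_sq_norm_inner_right x, ← b.sum_inner_mul_inner, Complex.re_sum, Finset.mul_sum]
  refine Finset.sum_le_sum fun i _ => ?_
  have h1 : inner ℂ (b i) (H x) = (e i : ℂ) * inner ℂ (b i) x := by
    rw [← inner_apply_left_of_isSelfAdjoint hH, hb, inner_smul_left, Complex.conj_ofReal]
  have h2 : inner ℂ x (b i) * inner ℂ (b i) (H x) = ((e i * ‖inner ℂ (b i) x‖ ^ 2 : ℝ) : ℂ) := by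
    rw [h1, ← inner_conj_symm x (b i), mul_left_comm, Complex.conj_mul']
    push_cast
    rfl
  rw [h2, Complex.ofReal_re]
  refine mul_le_mul_of_nonneg_right (groundEnergy_le hH ?_) (sq_nonneg _)
  rw [he]
  exact ⟨i, rfl⟩

lemma groundEnergy_sub_le {H' : Op L n} (hH : IsSelfAdjoint H) (hH' : IsSelfAdjoint H') :
    groundEnergy H' - groundEnergy H ≤ ‖H' - H‖ := by
  obtain ⟨x, hx, hx1⟩ := exists_unit_groundSpace hH
  have h1 := groundEnergy_mul_le_re_inner hH' x
  have h2 : inner ℂ x (H' x) = groundEnergy H + inner ℂ x ((H' - H) x) := by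
    rw [sub_apply, inner_sub_right, apply_of_mem_groundSpace hx, inner_smul_right,
      inner_self_eq_norm_sq_to_K, hx1]
    simp
  have h3 : (inner ℂ x ((H' - H) x)).re ≤ ‖H' - H‖ := by
    refine (Complex.re_le_norm _).trans ((norm_inner_le_norm _ _).trans ?_)
    rw [hx1, one_mul]
    simpa [hx1] using ContinuousLinearMap.le_opNorm (H' - H) x
  rw [h2, hx1, Complex.add_re, Complex.ofReal_re] at h1
  linarith

/-- The ground state energy is a Lipschitz function of the Hamiltonian. -/
lemma abs_groundEnergy_sub_le {H' : Op L n} (hH : IsSelfAdjoint H) (hH' : IsSelfAdjoint H') :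
    |groundEnergy H' - groundEnergy H| ≤ ‖H' - H‖ := by
  rw [abs_le]
  have h1 := groundEnergy_sub_le hH hH'
  have h2 := groundEnergy_sub_le hH' hH
  have h3 : ‖H - H'‖ = ‖H' - H‖ := norm_sub_rev H H'
  constructor <;> linarith

lemma groundProj_mul_self (H : Op L n) : groundProj H * groundProj H = groundProj H :=
  (groundSpace H).isIdempotentElem_starProjection

lemma star_groundProj (H : Op L n) : star (groundProj H) = groundProj H :=
  isSelfAdjoint_starProjection (groundSpace H)

lemma mul_groundProj (H : Op L n) : H * groundProj H = (groundEnergy H : ℂ) • groundProj H :=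
  ContinuousLinearMap.ext fun x =>
    apply_of_mem_groundSpace ((groundSpace H).starProjection_apply_mem x)

/-- A gapped Hamiltonian has an eigenbasis with a distinguished ground state vector. -/
lemma exists_spectralGap {g : ℝ} (hg : 0 < g) (hH : IsSelfAdjoint H) (hgap : HasGap H g) :
    ∃ G : SpectralGap H g, G.energy G.ground = groundEnergy H ∧ groundProj H = G.proj := by
  obtain ⟨b, e, hb, he⟩ := exists_eigenbasis hH
  obtain ⟨i₀, hi₀⟩ : groundEnergy H ∈ Set.range e := he ▸ groundEnergy_mem hH
  have hmem : ∀ i, e i = groundEnergy H → b i ∈ groundSpace H := fun i hi =>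
    Module.End.mem_eigenspace_iff.mpr ((hb i).trans (by rw [hi]))
  have hspan : ∀ x ∈ groundSpace H, ∃ c : ℂ, c • b i₀ = x := by
    intro x hx
    have h0 : (⟨b i₀, hmem i₀ hi₀⟩ : groundSpace H) ≠ 0 := fun h =>
      b.orthonormal.ne_zero i₀ (congrArg Subtype.val h)
    obtain ⟨c, hc⟩ := (finrank_eq_one_iff_of_nonzero' _ h0).mp hgap.1 ⟨x, hx⟩
    exact ⟨c, congrArg Subtype.val hc⟩
  have hne : ∀ i, i ≠ i₀ → e i ≠ groundEnergy H := by
    intro i hi h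
    obtain ⟨c, hc⟩ := hspan _ (hmem i h)
    have h1 : inner ℂ (b i) (b i) = (0 : ℂ) := by
      conv_lhs => rw [← hc]
      rw [inner_smul_left, hc, b.inner_eq_zero hi.symm, mul_zero]
    rw [b.inner_eq_one] at h1
    exact one_ne_zero h1
  have hgs : groundSpace H = Submodule.span ℂ {b i₀} := by
    ext x
    rw [Submodule.mem_span_singleton]
    exact ⟨hspan x, fun ⟨c, hc⟩ => hc ▸ (groundSpace H).smul_mem c (hmem i₀ hi₀)⟩
  let G : SpectralGap H g :=
    { basis := b
      energy := e
      ground := i₀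
      apply_basis := hb
      gap_pos := hg
      gap_le := fun i hi => by
        rw [hi₀]
        exact hgap.2 _ (he ▸ ⟨i, rfl⟩) (hne i hi) }
  refine ⟨G, hi₀, ContinuousLinearMap.ext fun x => ?_⟩
  rw [G.proj_apply]
  refine (groundSpace H).eq_starProjection_of_mem_of_inner_eq_zero
    ((groundSpace H).smul_mem _ (hmem i₀ hi₀)) fun w hw => ?_
  obtain ⟨c, rfl⟩ := hspan w hw
  have hv : inner ℂ G.vec G.vec = (1 : ℂ) := b.inner_eq_one i₀
  rw [inner_smul_right, inner_sub_left, inner_smul_left, inner_conj_symm]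
  change c * (inner ℂ x G.vec - inner ℂ x G.vec * inner ℂ G.vec G.vec) = 0
  rw [hv, mul_one, sub_self, mul_zero]

lemma expect_eq_inner {g : ℝ} (G : SpectralGap H g) (hG : groundProj H = G.proj) (O : Op L n) :
    expect H O = inner ℂ G.vec (O G.vec) := by
  rw [expect, LinearMap.trace_eq_sum_inner _ G.basis, Finset.sum_eq_single G.ground]
  · change inner ℂ G.vec (groundProj H (O G.vec)) = _
    rw [hG, G.proj_apply, inner_smul_right, inner_self_eq_norm_sq_to_K, G.norm_vec]
    simp
  · intro i _ hi
    change inner ℂ (G.basis i) (groundProj H (O (G.basis i))) = _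
    rw [hG, G.proj_apply, inner_smul_right, SpectralGap.vec, G.basis.inner_eq_zero hi, mul_zero]
  · simp

/-- First order perturbation theory for the ground state projection. -/
lemma hasDerivAt_groundProj {g : ℝ} (G : SpectralGap H g)
    (hGe : G.energy G.ground = groundEnergy H) (hG : groundProj H = G.proj) {Hs : ℝ → Op L n}
    {H₁ : Op L n} (h0 : Hs 0 = H) (hd : HasDerivAt Hs H₁ 0) (hs : ∀ s, IsSelfAdjoint (Hs s)) :
    HasDerivAt (fun s => groundProj (Hs s))
      (-(G.resolvent * H₁ * G.proj + G.proj * H₁ * G.resolvent)) 0 := by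
  have hH : IsSelfAdjoint H := h0 ▸ hs 0
  refine G.hasDerivAt_proj h0 (by rw [h0, hG]) hd hs (fun s => groundProj_mul_self _)
    (fun s => star_groundProj _) fun s => ⟨groundEnergy (Hs s), mul_groundProj _, ?_, ?_⟩
  · rw [hGe]
    exact abs_groundEnergy_sub_le hH (hs s)
  · obtain ⟨x, hx, hx1⟩ := exists_unit_groundSpace (hs s)
    exact ⟨x, hx1, (groundSpace (Hs s)).starProjection_eq_self_iff.mpr hx⟩

/-- The Kubo coefficient is a curvature form. -/
lemma isKuboCoefficient_curvForm {g : ℝ} (G : SpectralGap H g) (hG : groundProj H = G.proj)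
    {J V : Op L n} (hJ : IsSelfAdjoint J) (hV : IsSelfAdjoint V) :
    IsKuboCoefficient H J V (G.curvForm J (Complex.I • (H * V - V * H)) : ℝ) := by
  rw [G.curvForm_commutator]
  have h := G.kubo_limit hV hJ (c := fun t => expect H (evolve H V (-t) * J - J * evolve H V (-t)))
    fun t => ?_
  · exact h
  · rw [expect_eq_inner G hG]
    have h1 := G.inner_commutator_eq_sum hV hJ (-t)
    simp only [evolve]
    rw [h1]
    refine Finset.sum_congr rfl fun i _ => ?_
    push_cast
    rw [mul_neg, neg_neg]

end GroundState

/-! ### Distances on the continuous torus -/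

section TorusDistance

variable {L : ℕ} [NeZero L]

lemma zabs_le_norm (a b : ZMod L) :
    (zabs (a - b) : ℝ) ≤ ‖((a.val : ℝ) : AddCircle (L : ℝ)) - ((b.val : ℝ) : AddCircle (L : ℝ))‖ := by
  rw [← AddCircle.coe_sub, AddCircle.norm_eq]
  set N := round ((L : ℝ)⁻¹ * ((a.val : ℝ) - b.val))
  have h1 : (((a.val : ℤ) - b.val - N * L : ℤ) : ZMod L) = a - b := by
    push_cast
    rw [ZMod.natCast_zmod_val, ZMod.natCast_zmod_val, ZMod.natCast_self, mul_zero, sub_zero]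
  have h2 := zabs_intCast_le (L := L) ((a.val : ℤ) - b.val - N * L)
  rw [h1] at h2
  have h3 : (zabs (a - b) : ℝ) ≤ ((((a.val : ℤ) - b.val - N * L).natAbs : ℕ) : ℝ) := by
    exact_mod_cast h2
  rw [Nat.cast_natAbs, Int.cast_abs] at h3
  push_cast at h3
  exact h3

lemma sdist_le_torusDist (x y : Site L) : (sdist x y : ℝ) ≤ torusDist (sitePos x) (sitePos y) := by
  refine Real.le_sqrt_of_sq_le ?_
  have h1 := zabs_le_norm x.1 y.1
  have h2 := zabs_le_norm x.2 y.2
  rw [sdist, Nat.cast_max]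
  rcases max_choice (zabs (x.1 - y.1) : ℝ) (zabs (x.2 - y.2)) with h | h <;> rw [h]
  · have := pow_le_pow_left₀ (Nat.cast_nonneg _) h1 2
    exact this.trans (le_add_of_nonneg_right (sq_nonneg _))
  · have := pow_le_pow_left₀ (Nat.cast_nonneg _) h2 2
    exact this.trans (le_add_of_nonneg_left (sq_nonneg _))

lemma norm_sub_le_zabs (a b : ZMod L) :
    ‖((a.val : ℝ) : AddCircle (L : ℝ)) - ((b.val + 1 / 2 : ℝ) : AddCircle (L : ℝ))‖ ≤
      zabs (a - b) + 1 / 2 := by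
  set j : ℤ := (a - b).valMinAbs with hj
  have hj2 : ((a.val - b.val - j : ℤ) : ZMod L) = 0 := by
    push_cast
    rw [ZMod.natCast_zmod_val, ZMod.natCast_zmod_val, ZMod.coe_valMinAbs, sub_self]
  obtain ⟨t, ht⟩ := (ZMod.intCast_zmod_eq_zero_iff_dvd _ L).mp hj2
  have h1 : (a.val : ℝ) - (b.val + 1 / 2) = (j - 1 / 2 : ℝ) + t • (L : ℝ) := by
    have := congrArg (Int.cast : ℤ → ℝ) ht
    push_cast at this
    rw [zsmul_eq_mul]
    linarith
  have h2 : (((j - 1 / 2 : ℝ) + t • (L : ℝ) : ℝ) : AddCircle (L : ℝ)) =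
      ((j - 1 / 2 : ℝ) : AddCircle (L : ℝ)) := by
    rw [AddCircle.coe_add, AddCircle.coe_zsmul, AddCircle.coe_period, smul_zero, add_zero]
  rw [← AddCircle.coe_sub, h1, h2]
  refine (QuotientAddGroup.norm_mk_le_norm).trans ?_
  rw [Real.norm_eq_abs]
  refine (abs_sub _ _).trans ?_
  rw [abs_of_pos (by norm_num : (0 : ℝ) < 1 / 2), zabs, Nat.cast_natAbs, Int.cast_abs]

lemma torusDist_dualPos_le (x y : Site L) :
    torusDist (sitePos x) (dualPos y) ≤ 1 + 2 * sdist x y := by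
  have h1 := norm_sub_le_zabs x.1 y.1
  have h2 := norm_sub_le_zabs x.2 y.2
  have e1 : (zabs (x.1 - y.1) : ℝ) ≤ sdist x y := by exact_mod_cast le_max_left _ _
  have e2 : (zabs (x.2 - y.2) : ℝ) ≤ sdist x y := by exact_mod_cast le_max_right _ _
  refine Real.sqrt_le_iff.mpr ⟨by positivity, ?_⟩
  have h3 := pow_le_pow_left₀ (norm_nonneg _) (h1.trans (add_le_add_left e1 _)) 2
  have h4 := pow_le_pow_left₀ (norm_nonneg _) (h2.trans (add_le_add_left e2 _)) 2
  have h5 : (0 : ℝ) ≤ sdist x y := Nat.cast_nonneg _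
  refine (add_le_add h3 h4).trans ?_
  nlinarith

end TorusDistance

/-! ### Hopping operators and currents -/

section Hopping

variable {L n : ℕ}

lemma Adj.symm {x y : Site L} (h : Adj x y) : Adj y x := by
  obtain ⟨d, rfl⟩ := h
  cases d
  · exact ⟨.west, by ext <;> simp [Dir.vec]⟩
  · exact ⟨.south, by ext <;> simp [Dir.vec]⟩
  · exact ⟨.east, by ext <;> simp [Dir.vec]⟩
  · exact ⟨.north, by ext <;> simp [Dir.vec]⟩

lemma adj_add_edgeVec (x : Site L) (i : Bool) : Adj x (x + edgeVec L i) := by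
  cases i
  · exact ⟨.east, rfl⟩
  · exact ⟨.north, rfl⟩

lemma zmod_one_ne_zero (hL : 4 ≤ L) : (1 : ZMod L) ≠ 0 := by
  have : Fact (1 < L) := ⟨by omega⟩
  exact one_ne_zero

lemma zmod_one_ne_neg_one (hL : 4 ≤ L) : (1 : ZMod L) ≠ -1 := by
  have : Fact (2 < L) := ⟨by omega⟩
  exact (ZMod.neg_one_ne_one).symm

variable [NeZero L]

lemma op_star_sum {ι : Type*} (s : Finset ι) (f : ι → Op L n) :
    star (∑ i ∈ s, f i) = ∑ i ∈ s, star (f i) := star_sum s f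

lemma op_star_smul (c : ℂ) (A : Op L n) : star (c • A) = (starRingEnd ℂ) c • star A :=
  star_smul c A

lemma op_add_smul (a b : ℂ) (A : Op L n) : (a + b) • A = a • A + b • A := add_smul a b A

lemma op_zero_smul (A : Op L n) : (0 : ℂ) • A = 0 := zero_smul ℂ A

lemma op_one_smul (A : Op L n) : (1 : ℂ) • A = A := one_smul ℂ A

lemma op_smul_zero (c : ℂ) : c • (0 : Op L n) = 0 := smul_zero (A := Op L n) c

lemma op_norm_smul (c : ℂ) (A : Op L n) : ‖c • A‖ = ‖c‖ * ‖A‖ := norm_smul c A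

lemma neg_smul_sub {M : Type*} [AddCommGroup M] [Module ℂ M] (c : ℂ) (A B : M) :
    (-c) • (A - B) = c • (B - A) := by
  rw [neg_smul, ← smul_neg, neg_sub]

lemma op_neg_smul_sub (c : ℂ) (A B : Op L n) : (-c) • (A - B) = c • (B - A) := neg_smul_sub c A B

lemma op_star_add (A B : Op L n) : star (A + B) = star A + star B := star_add A B

lemma op_star_sub (A B : Op L n) : star (A - B) = star A - star B := star_sub A B

open Classical in
/-- Sums over ordered pairs of neighbours are sums over the edges. -/
lemma sum_adj_eq_sum_edge {M : Type*} [AddCommMonoid M] (hL : 4 ≤ L) (F : Site L → Site L → M) :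
    (∑ x : Site L, ∑ y : Site L, if Adj x y then F x y else 0) =
      ∑ e : Edge L, (F e.1 (e.1 + edgeVec L e.2) + F (e.1 + edgeVec L e.2) e.1) := by
  have h10 := zmod_one_ne_zero hL
  have h11 := zmod_one_ne_neg_one hL
  have h1 : ∀ x : Site L, (∑ y : Site L, if Adj x y then F x y else 0) =
      (F x (x + edgeVec L true) + F x (x + edgeVec L false)) +
        (F x (x - edgeVec L true) + F x (x - edgeVec L false)) := by
    intro x
    have h2 : (Finset.univ.filter fun y => Adj x y) =
        {x + edgeVec L true, x + edgeVec L false, x - edgeVec L true, x - edgeVec L false} := by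
      ext y
      simp only [Finset.mem_filter, Finset.mem_univ, true_and, Finset.mem_insert,
        Finset.mem_singleton]
      constructor
      · rintro ⟨d, rfl⟩
        cases d
        · exact Or.inr (Or.inl rfl)
        · exact Or.inl rfl
        · exact Or.inr (Or.inr (Or.inr (by ext <;> simp [Dir.vec, edgeVec, sub_eq_add_neg])))
        · exact Or.inr (Or.inr (Or.inl (by ext <;> simp [Dir.vec, edgeVec, sub_eq_add_neg])))
      · rintro (rfl | rfl | rfl | rfl)
        · exact ⟨.north, rfl⟩
        · exact ⟨.east, rfl⟩
        · exact ⟨.south, by ext <;> simp [Dir.vec, edgeVec, sub_eq_add_neg]⟩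
        · exact ⟨.west, by ext <;> simp [Dir.vec, edgeVec, sub_eq_add_neg]⟩
    rw [← Finset.sum_filter, h2, Finset.sum_insert, Finset.sum_insert, Finset.sum_insert,
      Finset.sum_singleton, add_assoc]
    · simp [edgeVec, Prod.ext_iff, h10, sub_eq_add_neg]
    · simp [edgeVec, Prod.ext_iff, h10, h11, sub_eq_add_neg]
    · simp [edgeVec, Prod.ext_iff, h10, h10.symm, h11, sub_eq_add_neg]
  have h3 : ∀ i, ∑ x : Site L, F x (x - edgeVec L i) = ∑ x : Site L, F (x + edgeVec L i) x := by
    intro i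
    rw [← Equiv.sum_comp (Equiv.addRight (edgeVec L i))]
    simp
  rw [Finset.sum_congr rfl fun x _ => h1 x, Finset.sum_add_distrib, Finset.sum_add_distrib,
    Finset.sum_add_distrib, h3, h3, Finset.sum_add_distrib]
  congr 1 <;> rw [Fintype.sum_prod_type_right (α₁ := Site L), Fintype.sum_bool]

namespace LatticeHamiltonian

variable (Φ : LatticeHamiltonian L n)

/-- The operator of all hoppings from `y` to `x`. -/
def hopOp (x y : Site L) : Op L n :=
  ∑ σ : Fin n, ∑ τ : Fin n, Φ.hop x σ y τ • (create (x, σ) * annihilate (y, τ))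

/-- The current operator of the edge `e`. -/
def edgeCurrent (e : Edge L) : Op L n :=
  Complex.I • (Φ.hopOp e.1 (e.1 + edgeVec L e.2) - Φ.hopOp (e.1 + edgeVec L e.2) e.1)

/-- The linear response of the Hamiltonian to the vector potential `A`. -/
def totalCurrent (A : Edge L → ℝ) : Op L n := ∑ e, (A e : ℂ) • Φ.edgeCurrent e

lemma star_hopOp {x y : Site L} (h : Adj x y) : star (Φ.hopOp x y) = Φ.hopOp y x := by
  rw [hopOp, hopOp, op_star_sum, Finset.sum_comm]
  rw [Finset.sum_comm]
  rw [Finset.sum_comm (f := fun σ τ => Φ.hop y σ x τ • (create (y, σ) * annihilate (x, τ)))]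
  refine Finset.sum_congr rfl fun σ _ => ?_
  rw [op_star_sum]
  refine Finset.sum_congr rfl fun τ _ => ?_
  rw [op_star_smul, star_mul, Φ.hop_symm x y h, Complex.conj_conj, create, create, star_star]

lemma norm_hopOp_le {m : ℝ} {x y : Site L} (h : ∀ σ τ, ‖Φ.hop x σ y τ‖ ≤ m) :
    ‖Φ.hopOp x y‖ ≤ n ^ 2 * m := by
  have h1 : ∀ σ τ, ‖Φ.hop x σ y τ • (create (x, σ) * annihilate (y, τ))‖ ≤ m := by
    intro σ τ
    rw [op_norm_smul]
    calc _ ≤ m * 1 := mul_le_mul (h σ τ) (norm_create_mul_annihilate_le _ _) (norm_nonneg _)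
          ((norm_nonneg _).trans (h σ τ))
      _ = m := mul_one m
  calc ‖Φ.hopOp x y‖ ≤ ∑ σ : Fin n, ∑ τ : Fin n, m :=
        (norm_sum_le _ _).trans (Finset.sum_le_sum fun σ _ =>
          (norm_sum_le _ _).trans (Finset.sum_le_sum fun τ _ => h1 σ τ))
    _ = _ := by simp; ring

lemma isEvenLocal_hopOp {X : Finset (Site L)} {x y : Site L} (hx : x ∈ X) (hy : y ∈ X) :
    IsEvenLocal X (Φ.hopOp x y) :=
  IsEvenLocal.sum fun _ _ => IsEvenLocal.sum fun _ _ => (isEvenLocal_hop hx hy).smul _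

lemma potentialOp_mul_hopOp (v : Site L → ℝ) (x y : Site L) :
    potentialOp n v * Φ.hopOp x y =
      Φ.hopOp x y * potentialOp n v + ((v x - v y : ℝ) : ℂ) • Φ.hopOp x y := by
  simp only [hopOp, Finset.mul_sum, Finset.sum_mul, Finset.smul_sum, ← Finset.sum_add_distrib]
  refine Finset.sum_congr rfl fun σ _ => Finset.sum_congr rfl fun τ _ => ?_
  rw [mul_smul_comm, smul_mul_assoc, potentialOp_mul_hop, smul_add, smul_comm]

lemma isSelfAdjoint_edgeCurrent (e : Edge L) : IsSelfAdjoint (Φ.edgeCurrent e) := by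
  rw [IsSelfAdjoint, edgeCurrent, op_star_smul, op_star_sub,
    Φ.star_hopOp (adj_add_edgeVec _ _), Φ.star_hopOp (adj_add_edgeVec _ _).symm, Complex.conj_I,
    op_neg_smul_sub]

lemma isSelfAdjoint_totalCurrent (A : Edge L → ℝ) : IsSelfAdjoint (Φ.totalCurrent A) := by
  rw [IsSelfAdjoint, totalCurrent, op_star_sum]
  refine Finset.sum_congr rfl fun e _ => ?_
  rw [op_star_smul, Complex.conj_ofReal, (Φ.isSelfAdjoint_edgeCurrent e).star_eq]

lemma totalCurrent_add (A B : Edge L → ℝ) :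
    Φ.totalCurrent (A + B) = Φ.totalCurrent A + Φ.totalCurrent B := by
  simp only [totalCurrent, Pi.add_apply, Complex.ofReal_add, op_add_smul, Finset.sum_add_distrib]

lemma totalCurrent_single (e : Edge L) (c : ℝ) :
    Φ.totalCurrent (Pi.single e c) = (c : ℂ) • Φ.edgeCurrent e := by
  rw [totalCurrent, Finset.sum_eq_single e]
  · simp
  · intro e' _ h
    rw [Pi.single_eq_of_ne h, Complex.ofReal_zero, op_zero_smul]
  · simp

lemma current_eq_totalCurrent (γ : List (DualEdge L)) :
    Φ.current γ = Φ.totalCurrent (pathForm γ) := by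
  induction γ with
  | nil => simp [current, pathForm, totalCurrent, op_zero_smul, op_smul_zero]
  | cons e γ ih =>
    have h1 : pathForm (e :: γ) = dualForm e + pathForm γ := by simp [pathForm]
    have h2 : Φ.current (e :: γ) = (-Complex.I) • (Φ.hopOp e.right e.left - Φ.hopOp e.left e.right) +
        Φ.current γ := by
      rw [current, List.map_cons, List.sum_cons, smul_add, current]
      congr 2
      simp only [hopOp, Finset.sum_sub_distrib]
    rw [h1, h2, totalCurrent_add, ih]
    congr 1
    obtain ⟨⟨a, b⟩, d⟩ := e
    cases d
    · change _ = Φ.totalCurrent (-Pi.single ((a + 1, b), true) 1)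
      rw [← Pi.single_neg, totalCurrent_single, edgeCurrent, smul_smul, Complex.ofReal_neg,
        Complex.ofReal_one, neg_one_mul]
      simp [DualEdge.left, DualEdge.right, edgeVec]
    · change _ = Φ.totalCurrent (Pi.single ((a, b + 1), false) 1)
      rw [totalCurrent_single, edgeCurrent, smul_smul, Complex.ofReal_one, one_mul,
        op_neg_smul_sub]
      simp [DualEdge.left, DualEdge.right, edgeVec]
    · change _ = Φ.totalCurrent (Pi.single ((a, b), true) 1)
      rw [totalCurrent_single, edgeCurrent, smul_smul, Complex.ofReal_one, one_mul,
        op_neg_smul_sub]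
      simp [DualEdge.left, DualEdge.right, edgeVec]
    · change _ = Φ.totalCurrent (-Pi.single ((a, b), false) 1)
      rw [← Pi.single_neg, totalCurrent_single, edgeCurrent, smul_smul, Complex.ofReal_neg,
        Complex.ofReal_one, neg_one_mul]
      simp [DualEdge.left, DualEdge.right, edgeVec]

end LatticeHamiltonian

end Hopping

/-! ### The Hamiltonian in a vector potential -/

section Hamiltonian

open Complex

variable {L n : ℕ}

lemma xi₁_edge (hL : 4 ≤ L) (e : Edge L) :
    xi₁ e.1 (e.1 + edgeVec L e.2) = fluxForm₁ L e ∧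
      xi₁ (e.1 + edgeVec L e.2) e.1 = -fluxForm₁ L e := by
  have h10 := zmod_one_ne_zero hL
  have h11 := zmod_one_ne_neg_one hL
  have h20 : (1 + 1 : ZMod L) ≠ 0 := fun h => h11 (eq_neg_of_add_eq_zero_left h)
  obtain ⟨⟨x, y⟩, i⟩ := e
  cases i <;>
    simp [xi₁, fluxForm₁, edgeVec, Dir.vec, Prod.ext_iff, h10, h20, add_assoc]

lemma xi₂_edge (hL : 4 ≤ L) (e : Edge L) :
    xi₂ e.1 (e.1 + edgeVec L e.2) = fluxForm₂ L e ∧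
      xi₂ (e.1 + edgeVec L e.2) e.1 = -fluxForm₂ L e := by
  have h10 := zmod_one_ne_zero hL
  have h11 := zmod_one_ne_neg_one hL
  have h20 : (1 + 1 : ZMod L) ≠ 0 := fun h => h11 (eq_neg_of_add_eq_zero_left h)
  obtain ⟨⟨x, y⟩, i⟩ := e
  cases i <;>
    simp [xi₂, fluxForm₂, edgeVec, Dir.vec, Prod.ext_iff, h10, h20, add_assoc]

variable [NeZero L]

namespace LatticeHamiltonian

variable (Φ : LatticeHamiltonian L n)

/-- The Hamiltonian in the background of a vector potential that is given on the positively
oriented edges. -/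
def hamForm (A : Edge L → ℝ) : Op L n :=
  (∑ e : Edge L, (exp (I * A e) • Φ.hopOp e.1 (e.1 + edgeVec L e.2) +
    exp (-(I * A e)) • Φ.hopOp (e.1 + edgeVec L e.2) e.1)) + ∑ X : Finset (Site L), Φ.int X

lemma hamWith_eq_hamForm (hL : 4 ≤ L) {A : Site L → Site L → ℝ} {a : Edge L → ℝ}
    (h1 : ∀ e : Edge L, A e.1 (e.1 + edgeVec L e.2) = a e)
    (h2 : ∀ e : Edge L, A (e.1 + edgeVec L e.2) e.1 = -a e) : Φ.hamWith A = Φ.hamForm a := by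
  classical
  have h3 : ∀ x y, ∑ σ : Fin n, ∑ τ : Fin n, (Φ.hop x σ y τ * exp (I * (A x y : ℂ))) •
      (create (x, σ) * annihilate (y, τ)) = exp (I * (A x y : ℂ)) • Φ.hopOp x y := by
    intro x y
    simp only [hopOp, Finset.smul_sum, smul_smul, mul_comm]
  rw [hamWith, hamForm]
  congr 1
  simp only [h3]
  rw [sum_adj_eq_sum_edge hL]
  refine Finset.sum_congr rfl fun e _ => ?_
  rw [h1, h2, ofReal_neg, mul_neg]

lemma ham_eq_hamForm (hL : 4 ≤ L) : Φ.ham = Φ.hamForm 0 :=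
  Φ.hamWith_eq_hamForm hL (fun _ => rfl) fun _ => by simp

lemma twistHam_eq_hamForm (hL : 4 ≤ L) (φ₁ φ₂ : ℝ) :
    twistHam Φ φ₁ φ₂ = Φ.hamForm (φ₁ • fluxForm₁ L + φ₂ • fluxForm₂ L) := by
  refine Φ.hamWith_eq_hamForm hL (fun e => ?_) fun e => ?_
  · simp [(xi₁_edge hL e).1, (xi₂_edge hL e).1]
  · simp [(xi₁_edge hL e).2, (xi₂_edge hL e).2]
    ring

lemma star_exp_I_mul (a : ℝ) : (starRingEnd ℂ) (exp (I * a)) = exp (-(I * a)) := by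
  rw [← exp_conj, map_mul, conj_I, conj_ofReal, neg_mul]

lemma isSelfAdjoint_hamForm (A : Edge L → ℝ) : IsSelfAdjoint (Φ.hamForm A) := by
  rw [IsSelfAdjoint, hamForm, op_star_add, op_star_sum, op_star_sum]
  congr 1
  · refine Finset.sum_congr rfl fun e _ => ?_
    rw [op_star_add, op_star_smul, op_star_smul, Φ.star_hopOp (adj_add_edgeVec _ _),
      Φ.star_hopOp (adj_add_edgeVec _ _).symm, star_exp_I_mul, ← star_exp_I_mul (A e),
      conj_conj, add_comm]
  · exact Finset.sum_congr rfl fun X _ => (Φ.int_selfAdjoint X).star_eq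

lemma hasDerivAt_smul_sub_smul {M : Type*} [NormedAddCommGroup M] [NormedSpace ℂ M] (a : ℝ)
    (S T : M) : HasDerivAt (fun s : ℝ => exp (I * ((s * a : ℝ) : ℂ)) • S +
      exp (-(I * ((s * a : ℝ) : ℂ))) • T) ((a : ℂ) • I • (S - T)) 0 := by
  have h0 : HasDerivAt (fun s : ℝ => I * ((s * a : ℝ) : ℂ)) (I * a) 0 := by
    have h := ((hasDerivAt_id (0 : ℝ)).mul_const a).ofReal_comp.const_mul I
    simpa using h
  have h1 := (h0.cexp.smul_const S).add (h0.neg.cexp.smul_const T)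
  refine h1.congr_deriv ?_
  simp only [Pi.neg_apply, zero_mul, ofReal_zero, mul_zero, neg_zero, exp_zero, one_mul]
  module

/-- The first order change of the Hamiltonian in a small vector potential is the total current. -/
lemma hasDerivAt_hamForm (A : Edge L → ℝ) :
    HasDerivAt (fun s : ℝ => Φ.hamForm (s • A)) (Φ.totalCurrent A) 0 := by
  refine HasDerivAt.add_const _ ?_
  exact HasDerivAt.fun_sum fun e _ => hasDerivAt_smul_sub_smul (A e) _ _

/-- The time derivative of a potential is the total current of its gradient. -/
lemma commutator_potentialOp (hL : 4 ≤ L) (v : Site L → ℝ) :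
    I • (Φ.ham * potentialOp n v - potentialOp n v * Φ.ham) = Φ.totalCurrent (grad v) := by
  have h0 : ∀ (V S T : Op L n) (a : ℂ), V * S = S * V + a • S → V * T = T * V + (-a) • T →
      (S + T) * V - V * (S + T) = (-a) • (S - T) := by
    intro V S T a h1 h2
    rw [mul_add, h1, h2, add_mul]
    exact (by
      have : ∀ {M : Type} [AddCommGroup M] [Module ℂ M] (P Q S T : M),
          P + Q - (P + a • S + (Q + (-a) • T)) = (-a) • (S - T) := by
        intro M _ _ P Q S T
        module
      exact this _ _ _ _)
  rw [Φ.ham_eq_hamForm hL, hamForm, add_mul, mul_add]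
  have h1 : (∑ X : Finset (Site L), Φ.int X) * potentialOp n v =
      potentialOp n v * ∑ X : Finset (Site L), Φ.int X :=
    (Commute.sum_left _ _ _ fun X _ => int_commute_potentialOp Φ X v).eq
  rw [h1, add_sub_add_right_eq_sub, Finset.sum_mul, Finset.mul_sum, ← Finset.sum_sub_distrib,
    Finset.smul_sum, totalCurrent]
  refine Finset.sum_congr rfl fun e _ => ?_
  have e1 := Φ.potentialOp_mul_hopOp v e.1 (e.1 + edgeVec L e.2)
  have e2 := Φ.potentialOp_mul_hopOp v (e.1 + edgeVec L e.2) e.1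
  have e3 : ((v (e.1 + edgeVec L e.2) - v e.1 : ℝ) : ℂ) =
    -((v e.1 - v (e.1 + edgeVec L e.2) : ℝ) : ℂ) := by push_cast; ring
  rw [e3] at e2
  rw [Pi.zero_apply, ofReal_zero, mul_zero, neg_zero, exp_zero, op_one_smul, op_one_smul,
    h0 _ _ _ _ e1 e2, edgeCurrent, smul_smul, smul_smul, grad, e3, mul_comm]

end LatticeHamiltonian

end Hamiltonian

/-! ### Quasi-locality of the curvature form of the edge currents -/

section QuasiLocality

open Complex

variable {L n : ℕ}

/-- A site of the set `X`, or the origin if `X` is empty. -/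
def anchor (X : Finset (Site L)) : Site L := if h : X.Nonempty then h.choose else 0

lemma anchor_mem {X : Finset (Site L)} (h : X.Nonempty) : anchor X ∈ X := by
  rw [anchor, dif_pos h]
  exact h.choose_spec

variable [NeZero L]

/-- The sites at distance at most `s` from `z`. -/
def siteBall (z : Site L) (s : ℕ) : Finset (Site L) := Finset.univ.filter fun y => sdist z y ≤ s

lemma mem_siteBall {z y : Site L} {s : ℕ} : y ∈ siteBall z s ↔ sdist z y ≤ s := by
  simp [siteBall]

lemma disjoint_siteBall {z w : Site L} {s : ℕ} (h : 2 * s + 1 ≤ sdist z w) :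
    Disjoint (siteBall z s) (siteBall w s) := by
  rw [Finset.disjoint_left]
  intro y hz hw
  rw [mem_siteBall] at hz hw
  rw [sdist_comm] at hw
  have := sdist_triangle z y w
  omega

namespace LatticeHamiltonian

variable (Φ : LatticeHamiltonian L n)

/-- The terms of the Hamiltonian that are attributed to the site `z`. -/
def localTerm (z : Site L) : Op L n :=
  (∑ i : Bool, (Φ.hopOp z (z + edgeVec L i) + Φ.hopOp (z + edgeVec L i) z)) +
    ∑ X ∈ Finset.univ.filter fun X => anchor X = z, Φ.int X

lemma sum_localTerm (hL : 4 ≤ L) : ∑ z, Φ.localTerm z = Φ.ham := by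
  rw [Φ.ham_eq_hamForm hL, hamForm]
  simp only [localTerm, Finset.sum_add_distrib]
  congr 1
  · simp only [← Finset.sum_add_distrib, Pi.zero_apply, ofReal_zero, mul_zero, neg_zero, exp_zero,
      op_one_smul]
    exact (Fintype.sum_prod_type (fun e : Edge L =>
      Φ.hopOp e.1 (e.1 + edgeVec L e.2) + Φ.hopOp (e.1 + edgeVec L e.2) e.1)).symm
  · exact Finset.sum_fiberwise Finset.univ anchor Φ.int

lemma isSelfAdjoint_localTerm (z : Site L) : IsSelfAdjoint (Φ.localTerm z) := by
  rw [IsSelfAdjoint, localTerm, op_star_add, op_star_sum, op_star_sum]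
  congr 1
  · refine Finset.sum_congr rfl fun i _ => ?_
    rw [op_star_add, Φ.star_hopOp (adj_add_edgeVec _ _),
      Φ.star_hopOp (adj_add_edgeVec _ _).symm, add_comm]
  · exact Finset.sum_congr rfl fun X _ => (Φ.int_selfAdjoint X).star_eq

variable {Φ} {R m : ℝ}

lemma IsLocal.nonneg (h : Φ.IsLocal R m) : 0 ≤ m := (norm_nonneg _).trans (h.2.1 ∅)

lemma IsLocal.subset_siteBall (h : Φ.IsLocal R m) {X : Finset (Site L)} (hX : Φ.int X ≠ 0)
    {s : ℕ} (hs : R ≤ s) : X ⊆ siteBall (anchor X) s := by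
  intro y hy
  rw [mem_siteBall]
  have h1 := (sdist_le_torusDist (anchor X) y).trans (h.2.2 X hX _ (anchor_mem ⟨y, hy⟩) y hy)
  exact_mod_cast h1.trans hs

lemma IsLocal.isEvenLocal_localTerm (h : Φ.IsLocal R m) (z : Site L) {s : ℕ} (hs : R ≤ s)
    (hs1 : 1 ≤ s) : IsEvenLocal (siteBall z s) (Φ.localTerm z) := by
  have h1 : z ∈ siteBall z s := mem_siteBall.mpr (by rw [sdist_self]; exact Nat.zero_le _)
  have h2 : ∀ i, z + edgeVec L i ∈ siteBall z s := fun i => mem_siteBall.mpr (by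
    rw [sdist_comm]
    exact (sdist_add_edgeVec z i).trans hs1)
  refine IsEvenLocal.add (IsEvenLocal.sum fun i _ =>
    (Φ.isEvenLocal_hopOp h1 (h2 i)).add (Φ.isEvenLocal_hopOp (h2 i) h1))
    (IsEvenLocal.sum fun X hX => ?_)
  by_cases h0 : Φ.int X = 0
  · rw [h0]
    exact IsEvenLocal.zero
  · have h3 := h.subset_siteBall h0 hs
    rw [(Finset.mem_filter.mp hX).2] at h3
    exact (isEvenLocal_int Φ X).mono h3

lemma isEvenLocal_edgeCurrent (e : Edge L) {s : ℕ} (hs1 : 1 ≤ s) :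
    IsEvenLocal (siteBall e.1 s) (Φ.edgeCurrent e) := by
  have h1 : e.1 ∈ siteBall e.1 s := mem_siteBall.mpr (by rw [sdist_self]; exact Nat.zero_le _)
  have h2 : e.1 + edgeVec L e.2 ∈ siteBall e.1 s := mem_siteBall.mpr (by
    rw [sdist_comm]
    exact (sdist_add_edgeVec e.1 e.2).trans hs1)
  rw [edgeCurrent, sub_eq_add_neg]
  have h3 : -Φ.hopOp (e.1 + edgeVec L e.2) e.1 =
      (-1 : ℂ) • Φ.hopOp (e.1 + edgeVec L e.2) e.1 := (neg_one_smul ℂ _).symm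
  rw [h3]
  exact ((Φ.isEvenLocal_hopOp h1 h2).add ((Φ.isEvenLocal_hopOp h2 h1).smul _)).smul _

lemma IsLocal.norm_hopOp_le (h : Φ.IsLocal R m) {x y : Site L} (hxy : Adj x y) :
    ‖Φ.hopOp x y‖ ≤ n ^ 2 * m := Φ.norm_hopOp_le fun σ τ => h.1 x y hxy σ τ

lemma IsLocal.norm_edgeCurrent_le (h : Φ.IsLocal R m) (e : Edge L) :
    ‖Φ.edgeCurrent e‖ ≤ 2 * (n ^ 2 * m) := by
  rw [edgeCurrent, op_norm_smul, norm_I, one_mul, two_mul]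
  exact (norm_sub_le _ _).trans (add_le_add (h.norm_hopOp_le (adj_add_edgeVec _ _))
    (h.norm_hopOp_le (adj_add_edgeVec _ _).symm))

lemma IsLocal.norm_localTerm_le (h : Φ.IsLocal R m) (z : Site L) {s : ℕ} (hs : R ≤ s) :
    ‖Φ.localTerm z‖ ≤ 4 * (n ^ 2 * m) + 2 ^ ((2 * s + 1) ^ 2) * m := by
  have hm := h.nonneg
  refine (norm_add_le _ _).trans (add_le_add ?_ ?_)
  · have h1 : ∀ i : Bool, ‖Φ.hopOp z (z + edgeVec L i) + Φ.hopOp (z + edgeVec L i) z‖ ≤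
        2 * (n ^ 2 * m) := fun i => by
      rw [two_mul]
      exact (norm_add_le _ _).trans (add_le_add (h.norm_hopOp_le (adj_add_edgeVec _ _))
        (h.norm_hopOp_le (adj_add_edgeVec _ _).symm))
    refine (norm_sum_le _ _).trans ((Finset.sum_le_sum fun i _ => h1 i).trans (le_of_eq ?_))
    simp
    ring
  · -- only the subsets of the ball contribute
    have h1 : ∀ X ∈ Finset.univ.filter fun X : Finset (Site L) => anchor X = z,
        ‖Φ.int X‖ ≤ if X ∈ (siteBall z s).powerset then m else 0 := by
      intro X hX
      split_ifs with h2
      · exact h.2.1 X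
      · rw [norm_le_zero_iff]
        by_contra h0
        have h3 := h.subset_siteBall h0 hs
        rw [(Finset.mem_filter.mp hX).2] at h3
        exact h2 (Finset.mem_powerset.mpr h3)
    calc ‖∑ X ∈ Finset.univ.filter fun X => anchor X = z, Φ.int X‖
        ≤ ∑ X ∈ Finset.univ.filter fun X : Finset (Site L) => anchor X = z,
            (if X ∈ (siteBall z s).powerset then m else 0) :=
          (norm_sum_le _ _).trans (Finset.sum_le_sum h1)
      _ ≤ ∑ X : Finset (Site L), (if X ∈ (siteBall z s).powerset then m else 0) :=
          Finset.sum_le_sum_of_subset_of_nonneg (Finset.filter_subset _ _) fun X _ _ => by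
            split_ifs <;> simp [hm]
      _ = 2 ^ (siteBall z s).card * m := by
          rw [Finset.sum_ite_mem, Finset.univ_inter, Finset.sum_const, Finset.card_powerset,
            nsmul_eq_mul]
          push_cast
          rfl
      _ ≤ 2 ^ ((2 * s + 1) ^ 2) * m := by
          gcongr
          · norm_num
          · exact card_ball_le z s

/-- The curvature form of the edge currents. -/
def curvKernel (Φ : LatticeHamiltonian L n) {g : ℝ} (G : SpectralGap Φ.ham g) (e e' : Edge L) : ℝ :=
  G.curvForm (Φ.edgeCurrent e) (Φ.edgeCurrent e')

lemma form_curvKernel {g : ℝ} (G : SpectralGap Φ.ham g) (A B : Edge L → ℝ) :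
    form (Φ.curvKernel G) A B = G.curvForm (Φ.totalCurrent A) (Φ.totalCurrent B) :=
  (G.curvForm_sum A B Φ.edgeCurrent).symm

end LatticeHamiltonian

open LatticeHamiltonian in
/-- The curvature form of the edge currents is quasi-local, uniformly in the size of the torus. -/
theorem exists_isQuasiLocal_curvKernel (n : ℕ) (R m : ℝ) {g : ℝ} (hg : 0 < g) (p : ℕ) :
    ∃ C : ℝ, ∀ (L : ℕ) [NeZero L], 4 ≤ L → ∀ Φ : LatticeHamiltonian L n, Φ.IsLocal R m →
      ∀ G : SpectralGap Φ.ham g, IsQuasiLocal (Φ.curvKernel G) C p := by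
  set s := max ⌈R⌉₊ 1 with hs
  have hs1 : 1 ≤ s := le_max_right _ _
  have hsR : R ≤ s := (Nat.le_ceil R).trans (by exact_mod_cast le_max_left _ _)
  obtain ⟨M, hM, h1⟩ := exists_abs_curvForm_le hg p
  obtain ⟨C, hC, h2⟩ := lieb_robinson_pow (4 * (n ^ 2 * m) + 2 ^ ((2 * s + 1) ^ 2) * m)
    (ρ := 2 * s + 1) (by omega) ((2 * (2 * s + 1) + 1) ^ 2) p
  set J := 2 * (n ^ 2 * |m|) with hJ
  refine ⟨M * (2 * J * J * C), ?_⟩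
  intro L _ hL Φ hΦ G
  have hJ0 : 0 ≤ J := by positivity
  have hj : ∀ e, ‖Φ.edgeCurrent e‖ ≤ J := fun e => by
    rw [hJ, abs_of_nonneg hΦ.nonneg]
    exact hΦ.norm_edgeCurrent_le e
  refine ⟨by positivity, fun e e' => ?_, fun e e' => G.curvForm_antisymm _ _, fun f h => ?_⟩
  · have h3 := h2 Φ.localTerm Φ.isSelfAdjoint_localTerm
      (fun w => hΦ.norm_localTerm_le w hsR) sdist sdist_triangle sdist_comm
      (fun z A => IsEvenLocal (siteBall z s) A) (fun w => hΦ.isEvenLocal_localTerm w hsR hs1)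
      (fun z w A B hA hB hzw => hA.commute hB.1 (disjoint_siteBall hzw))
      (fun z => (Finset.card_le_card fun y hy => by
        simp only [Finset.mem_filter, Finset.mem_univ, true_and] at hy ⊢
        exact hy.le).trans (card_ball_le z (2 * s + 1)))
      e.1 e'.1 _ _ (isEvenLocal_edgeCurrent (Φ := Φ) e hs1) (isEvenLocal_edgeCurrent (Φ := Φ) e' hs1)
    rw [Φ.sum_localTerm hL] at h3
    have h4 := h1 G (Φ.isSelfAdjoint_edgeCurrent e) (Φ.isSelfAdjoint_edgeCurrent e') _
      (by positivity) h3
    have h5 : 2 * ‖Φ.edgeCurrent e‖ * ‖Φ.edgeCurrent e'‖ * C ≤ 2 * J * J * C := by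
      gcongr
      · exact hj e
      · exact hj e'
    calc _ ≤ M * (2 * J * J * C / (1 + sdist e.1 e'.1) ^ p) :=
          h4.trans (mul_le_mul_of_nonneg_left (div_le_div_of_nonneg_right h5 (by positivity)) hM)
      _ = _ := by ring
  · rw [form_curvKernel, ← Φ.commutator_potentialOp hL, ← Φ.commutator_potentialOp hL]
    exact G.curvForm_commutator_commutator (isSelfAdjoint_potentialOp f)
      (isSelfAdjoint_potentialOp h) (potentialOp_commute f h)

/-- The adiabatic curvature is the response of the two constant vector potentials to each other. -/
lemma isAdiabaticCurvature_form (hL : 4 ≤ L) (Φ : LatticeHamiltonian L n) {g : ℝ}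
    (G : SpectralGap Φ.ham g) (hGe : G.energy G.ground = groundEnergy Φ.ham)
    (hG : groundProj Φ.ham = G.proj) :
    IsAdiabaticCurvature Φ (form (Φ.curvKernel G) (fluxForm₁ L) (fluxForm₂ L) : ℝ) := by
  have h1 := hasDerivAt_groundProj G hGe hG (Hs := fun s => Φ.hamForm (s • fluxForm₁ L))
    (by simp only [zero_smul]; exact (Φ.ham_eq_hamForm hL).symm) (Φ.hasDerivAt_hamForm _)
    (fun s => Φ.isSelfAdjoint_hamForm _)
  have h2 := hasDerivAt_groundProj G hGe hG (Hs := fun s => Φ.hamForm (s • fluxForm₂ L))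
    (by simp only [zero_smul]; exact (Φ.ham_eq_hamForm hL).symm) (Φ.hasDerivAt_hamForm _)
    (fun s => Φ.isSelfAdjoint_hamForm _)
  have e1 : ∀ φ, twistHam Φ φ 0 = Φ.hamForm (φ • fluxForm₁ L) := fun φ => by
    rw [Φ.twistHam_eq_hamForm hL, zero_smul, add_zero]
  have e2 : ∀ φ, twistHam Φ 0 φ = Φ.hamForm (φ • fluxForm₂ L) := fun φ => by
    rw [Φ.twistHam_eq_hamForm hL, zero_smul, zero_add]
  simp only [← e1] at h1
  simp only [← e2] at h2
  refine ⟨_, _, h1, h2, ?_⟩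
  rw [expect_eq_inner G hG, LatticeHamiltonian.form_curvKernel]
  exact (G.I_mul_inner_commutator_eq_curvForm (Φ.isSelfAdjoint_totalCurrent _)
    (Φ.isSelfAdjoint_totalCurrent _)).symm

lemma isKuboCoefficient_form (hL : 4 ≤ L) (Φ : LatticeHamiltonian L n) {g : ℝ}
    (G : SpectralGap Φ.ham g) (hG : groundProj Φ.ham = G.proj) (γ : List (DualEdge L))
    (v : Site L → ℝ) :
    IsKuboCoefficient Φ.ham (Φ.current γ) (potentialOp n v)
      (form (Φ.curvKernel G) (pathForm γ) (grad v) : ℝ) := by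
  rw [LatticeHamiltonian.form_curvKernel, ← Φ.commutator_potentialOp hL,
    Φ.current_eq_totalCurrent]
  exact isKuboCoefficient_curvForm G hG (Φ.isSelfAdjoint_totalCurrent _)
    (isSelfAdjoint_potentialOp v)

end QuasiLocality

end HallTorus

end

open HallTorus in
theorem lemma4p4 (n : ℕ) (R m g : ℝ) (hg : 0 < g) (k : ℕ) :
    ∃ K : ℝ, ∀ (L : ℕ) [NeZero L], Even L → 4 ≤ L →
      ∀ Φ : HallTorus.LatticeHamiltonian L n, Φ.IsLocal R m → HallTorus.HasGap Φ.ham g →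
        ∃ κ : ℝ, HallTorus.IsAdiabaticCurvature Φ (κ : ℂ) ∧
          ∀ (γ : List (HallTorus.DualEdge L)) (yb ye : HallTorus.Site L),
            HallTorus.IsDualPath yb γ ye → HallTorus.IsPartOfBoundary γ →
            ∀ (v : HallTorus.Site L → ℝ) (D r vb ve : ℝ), 1 ≤ r →
              (∀ x y, HallTorus.Adj x y → |v y - v x| ≤ D) →
              HallTorus.IsFlatNear v yb r vb → HallTorus.IsFlatNear v ye r ve → vb ≠ ve →
                ∃ χ : ℝ,
                  HallTorus.IsKuboCoefficient Φ.ham (Φ.current γ) (HallTorus.potentialOp n v)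
                    (χ : ℂ) ∧
                  |κ - χ / (ve - vb)| ≤ K * (D / |ve - vb|) / r ^ k := by
  obtain ⟨C, hC⟩ := exists_isQuasiLocal_curvKernel n R m hg (k + 5 + 5)
  obtain ⟨K, -, hK⟩ := exists_abs_form_grad_pathForm_add_le k
  refine ⟨K * C, ?_⟩
  intro L _ _ hL Φ hΦ hgap
  have hH : IsSelfAdjoint Φ.ham := by
    rw [Φ.ham_eq_hamForm hL]
    exact Φ.isSelfAdjoint_hamForm _
  obtain ⟨G, hGe, hG⟩ := exists_spectralGap hg hH hgap
  have hΩ := hC L hL Φ hΦ G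
  refine ⟨_, isAdiabaticCurvature_form hL Φ G hGe hG, ?_⟩
  intro γ yb ye hγ hγ' v D r vb ve hr hv hb he hne
  refine ⟨_, isKuboCoefficient_form hL Φ G hG γ v, ?_⟩
  -- the site with the same label as a dual site lies in the unit ball around it
  have hflat : ∀ {y : Site L} {c : ℝ}, IsFlatNear v y r c →
      v y = c ∧ ∀ x, v x ≠ v y → r ≤ 2 * (1 + sdist x y) := by
    intro y c h
    have h1 : v y = c := h y ((torusDist_dualPos_le y y).trans (by simpa [sdist_self] using hr))
    refine ⟨h1, fun x hx => ?_⟩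
    by_contra hcon
    exact hx ((h x ((torusDist_dualPos_le x y).trans (by linarith))).trans h1.symm)
  obtain ⟨hvb, hb'⟩ := hflat hb
  obtain ⟨hve, he'⟩ := hflat he
  have h1 := hK L hL _ C hΩ γ yb ye hγ hγ'.1 v D r (by linarith) hv hb' he' (by rwa [hvb, hve])
  rw [hvb, hve, form_antisymm hΩ] at h1
  set κ := form (Φ.curvKernel G) (fluxForm₁ L) (fluxForm₂ L)
  set χ := form (Φ.curvKernel G) (pathForm γ) (grad v)
  have h2 : ve - vb ≠ 0 := sub_ne_zero.mpr hne.symm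
  have h3 : κ - χ / (ve - vb) = (-χ + (ve - vb) * κ) / (ve - vb) := by
    field_simp
    ring
  rw [h3, abs_div]
  calc _ ≤ K * C * D / r ^ k / |ve - vb| := by gcongr
    _ = _ := by ring
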